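/- Let $R$ be a profinite ring with unity (not necessarily commutative); "module" means right module. For a profinite $R$-module $Z$ and a discrete $R$-module $A$ let $\mathrm{Ext}^n_R(Z,A)$ be the value at $A$ of the $n$-th right derived functor of $\mathrm{Hom}_R(Z,-)$ (continuous homomorphisms) on the abelian category of discrete $R$-modules. An étale space of $R$-modules over a profinite space $X$ is a local homeomorphism $p\colon\mathcal A\to X$ whose fibres $A_x=p^{-1}(x)$ are discrete $R$-modules such that the zero section $X\to\mathcal A$, the addition $\mathcal A\times_X\mathcal A\to\mathcal A$ and the action $\mathcal A\times R\to\mathcal A$ are continuous. A morphism $(\mathcal A,X)\to(\mathcal B,Y)$ is a continuous map $f\colon Y\to X$ with a continuous map $\phi\colon\mathcal A\times_XY\to\mathcal B$ over $Y$ that is given by $R$-homomorphisms $\phi_y\colon A_{f(y)}\to B_y$. The continuous product $\dot\prod\mathcal A$ is the discrete $R$-module of continuous global sections of $\mathcal A$. For $U\subseteq X$ clopen, $\mathcal A(U)$ is the discrete $R$-module of continuous sections over $U$, and $\mathrm{ev}_x\colon\mathcal A(U)\to A_x$ ($x\in U$) is evaluation at $x$. Then the following hold, for every $n\ge 0$,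 profinite $R$-module $Z$, profinite space $X$ and étale space $\mathcal A$ of $R$-modules over $X$. 1. The disjoint union $\bigsqcup_{x\in X}\mathrm{Ext}^n_R(Z,A_x)$, with the topology generated by the sets $\{\mathrm{Ext}^n_R(Z,\mathrm{ev}_x)(s)\mid x\in U\}$ for $U\subseteq X$ clopen and $s\in\mathrm{Ext}^n_R(Z,\mathcal A(U))$, is an étale space over $X$ of discrete torsion abelian groups (equivalently, of discrete $\widehat{\mathbb Z}$-modules). Every morphism $(\phi,f)\colon(\mathcal A,X)\to(\mathcal B,Y)$ induces, through the maps $\mathrm{Ext}^n_R(Z,\phi_y)$, a morphism of these étale spaces. Write $\dot\prod_{x\in X}\mathrm{Ext}^n_R(Z,A_x)$ for the group of continuous global sections. 2. The assignment $a\mapsto\bigl(x\mapsto\mathrm{Ext}^n_R(Z,\mathrm{ev}_x)(a)\bigr)$ is an isomorphism of groups $$\mathrm{Ext}^n_R\bigl(Z,\dot\prod\mathcal A\bigr)\;\cong\;\dot\prod_{x\in X}\mathrm{Ext}^n_R(Z,A_x),$$ natural in $\mathcal A$ (for all morphisms $(\phi,f)$ of étale spaces) and in $Z$. 3. These isomorphisms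 form isomorphisms of cohomological $\delta$-functors. For fixed $X$ and $Z$, both sides are cohomological $\delta$-functors in the étale space $\mathcal A$ over $X$ (a sequence of étale spaces over $X$ is short exact if it is so on every fibre); for fixed $\mathcal A$, both sides are contravariant cohomological $\delta$-functors in $Z$. In both cases, the maps and connecting homomorphisms on the left are the usual ones of $\mathrm{Ext}^\bullet_R$ (in the first case for the short exact sequence of modules of global sections), on the right they are those of $\mathrm{Ext}^\bullet_R$ applied in every fibre, and the isomorphisms of 2. commute with them. -/

import Mathlib

open CategoryTheory Limits MulOpposite Topology

universe u

/-- A right `R`-module (a module over `Rᵐᵒᵖ`) is discrete if the action of `R` is continuous for the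
discrete topology on the module. -/
def IsDiscreteMod (R : Type u) [Ring R] [TopologicalSpace R] :
    ObjectProperty (ModuleCat.{u} Rᵐᵒᵖ) :=
  fun M => letI : TopologicalSpace M := ⊥; ContinuousSMul Rᵐᵒᵖ M

section DMod

variable {R : Type u} [Ring R] [TopologicalSpace R]

lemma IsDiscreteMod.isOpen_ann {M : ModuleCat.{u} Rᵐᵒᵖ} (hM : IsDiscreteMod R M) (m : M) :
    IsOpen {r : Rᵐᵒᵖ | r • m = 0} := by
  let _ : TopologicalSpace M := ⊥
  have : DiscreteTopology M := ⟨rfl⟩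
  have : ContinuousSMul Rᵐᵒᵖ M := hM
  have h : Continuous fun r : Rᵐᵒᵖ => r • m := by fun_prop
  exact (isOpen_discrete ({0} : Set M)).preimage h

variable [IsTopologicalRing R]

lemma IsDiscreteMod.of_isOpen_ann {M : ModuleCat.{u} Rᵐᵒᵖ}
    (h : ∀ m : M, IsOpen {r : Rᵐᵒᵖ | r • m = 0}) : IsDiscreteMod R M := by
  let _ : TopologicalSpace M := ⊥
  have : DiscreteTopology M := ⟨rfl⟩
  refine ⟨?_⟩
  rw [continuous_prod_of_discrete_right]
  intro m
  rw [continuous_discrete_rng]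
  intro b
  rw [isOpen_iff_mem_nhds]
  intro r hr
  have h1 : {s : Rᵐᵒᵖ | s • m = b} = (fun s => s - r) ⁻¹' {s : Rᵐᵒᵖ | s • m = 0} := by
    have hr' : r • m = b := hr
    ext s
    simp [sub_smul, hr', sub_eq_zero]
  change {s : Rᵐᵒᵖ | s • m = b} ∈ nhds r
  rw [h1]
  exact ((h m).preimage (by fun_prop)).mem_nhds (by simp)

instance : (IsDiscreteMod R).IsClosedUnderSubobjects where
  prop_of_mono {M N} f _ hN := by
    refine .of_isOpen_ann fun m => ?_
    have hf : Function.Injective f.hom := (ModuleCat.mono_iff_injective f).1 inferInstance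
    convert hN.isOpen_ann (f.hom m) using 3 with r
    rw [← map_smul, map_eq_zero_iff _ hf]

lemma isOpen_of_le_ann {M : Type u} [AddCommGroup M] [Module Rᵐᵒᵖ M] (m : M) (V : Set Rᵐᵒᵖ)
    (hV : IsOpen V) (h0 : (0 : Rᵐᵒᵖ) ∈ V) (h : ∀ r ∈ V, r • m = 0) :
    IsOpen {r : Rᵐᵒᵖ | r • m = 0} := by
  rw [isOpen_iff_mem_nhds]
  intro r hr
  have h1 : (fun s => s - r) ⁻¹' V ∈ nhds r :=
    (hV.preimage (by fun_prop)).mem_nhds (by simpa using h0)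
  refine Filter.mem_of_superset h1 fun s hs => ?_
  have := h _ hs
  have hr' : r • m = 0 := hr
  simpa [sub_smul, hr'] using this

instance : (IsDiscreteMod R).IsClosedUnderQuotients where
  prop_of_epi {M N} f _ hM := by
    refine .of_isOpen_ann fun n => ?_
    obtain ⟨m, rfl⟩ := (ModuleCat.epi_iff_surjective f).1 inferInstance n
    refine isOpen_of_le_ann _ _ (hM.isOpen_ann m) (by simp) fun r hr => ?_
    have hr' : r • m = 0 := hr
    rw [← map_smul, hr', map_zero]

instance : (IsDiscreteMod R).ContainsZero where
  exists_zero := ⟨ModuleCat.of Rᵐᵒᵖ PUnit, ModuleCat.isZero_of_subsingleton _,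
    .of_isOpen_ann fun m => by
      convert isOpen_univ using 1
      ext r
      simp⟩

instance : (IsDiscreteMod R).IsClosedUnderFiniteProducts where
  isClosedUnderLimitsOfShape J _ := by
    refine ⟨?_⟩
    rintro M ⟨p⟩
    refine .of_isOpen_ann fun m => ?_
    have h : {r : Rᵐᵒᵖ | r • m = 0} =
        ⋂ j : Discrete J, {r : Rᵐᵒᵖ | r • (p.π.app j).hom m = 0} := by
      ext r
      simp only [Set.mem_ofPred_eq, Set.mem_iInter]
      constructor
      · intro hr j
        rw [← map_smul, hr, map_zero]
      · intro hr
        refine Concrete.isLimit_ext _ p.isLimit _ _ fun j => ?_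
        have h1 := hr j
        rw [← map_smul] at h1
        exact h1.trans (map_zero (p.π.app j).hom).symm
    rw [h]
    exact isOpen_iInter_of_finite fun j => (p.prop_diag_obj j).isOpen_ann _

/-- The discrete part of a right `R`-module: the elements with open annihilator. -/
def discretePart (M : Type u) [AddCommGroup M] [Module Rᵐᵒᵖ M] : Submodule Rᵐᵒᵖ M where
  carrier := {m | IsOpen {r : Rᵐᵒᵖ | r • m = 0}}
  zero_mem' := by simp
  add_mem' {a b} ha hb := by
    refine isOpen_of_le_ann _ _ (IsOpen.inter ha hb) (by simp) fun r hr => ?_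
    have h1 : r • a = 0 := hr.1
    have h2 : r • b = 0 := hr.2
    rw [smul_add, h1, h2, add_zero]
  smul_mem' r m hm := by
    have h : {s : Rᵐᵒᵖ | s • r • m = 0} = (fun s => s * r) ⁻¹' {s : Rᵐᵒᵖ | s • m = 0} := by
      ext s
      simp [mul_smul]
    change IsOpen {s : Rᵐᵒᵖ | s • r • m = 0}
    rw [h]
    exact IsOpen.preimage (by fun_prop) hm

variable (R) in
/-- The category of discrete right `R`-modules. -/
abbrev DMod : Type (u + 1) := (IsDiscreteMod R).FullSubcategory

/-- The right `R`-module of elements with open annihilator is discrete. -/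
lemma isDiscreteMod_discretePart (M : Type u) [AddCommGroup M] [Module Rᵐᵒᵖ M] :
    IsDiscreteMod R (ModuleCat.of Rᵐᵒᵖ (discretePart (R := R) M)) := by
  refine .of_isOpen_ann fun m => ?_
  have h : {r : Rᵐᵒᵖ | r • m = 0} = {r : Rᵐᵒᵖ | r • (m : M) = 0} := by
    ext r
    exact Subtype.ext_iff
  rw [h]
  exact m.2

instance : (IsDiscreteMod R).ι.PreservesMonomorphisms :=
  (IsDiscreteMod R).preservesMonomorphisms_ι_of_isNormalEpiCategory

instance : (IsDiscreteMod R).ι.PreservesEpimorphisms :=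
  (IsDiscreteMod R).preservesEpimorphisms_ι_of_isNormalMonoCategory

instance : EnoughInjectives (DMod R) where
  presentation M := by
    let p := (EnoughInjectives.presentation M.obj).some
    let J : DMod R := ⟨ModuleCat.of Rᵐᵒᵖ (discretePart (R := R) p.J), isDiscreteMod_discretePart _⟩
    have key : ∀ (N : DMod R) (f : N.obj ⟶ p.J) (n : N.obj), f.hom n ∈ discretePart (R := R) p.J := by
      intro N f n
      refine isOpen_of_le_ann _ _ (N.property.isOpen_ann n) (by simp) fun r hr => ?_
      have hr' : r • n = 0 := hr
      rw [← map_smul, hr', map_zero]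
    let lift : ∀ (N : DMod R) (f : N.obj ⟶ p.J), N ⟶ J := fun N f =>
      ObjectProperty.homMk (ModuleCat.ofHom (f.hom.codRestrict _ (key N f)))
    let inc : J.obj ⟶ p.J := ModuleCat.ofHom (Submodule.subtype _)
    have hlift : ∀ N f, (lift N f).hom ≫ inc = f := fun N f => rfl
    have hinc : Mono inc := (ModuleCat.mono_iff_injective _).2 Subtype.val_injective
    refine ⟨⟨J, ⟨?_⟩, lift M p.f, ?_⟩⟩
    · intro X Y g f hf
      have hf' : Mono f.hom := inferInstanceAs (Mono ((IsDiscreteMod R).ι.map f))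
      refine ⟨lift Y (Injective.factorThru (g.hom ≫ inc) f.hom), ?_⟩
      ext1
      rw [← cancel_mono inc]
      simp [hlift]
    · have h1 : Mono ((lift M p.f).hom ≫ inc) := by rw [hlift]; infer_instance
      have : Mono ((IsDiscreteMod R).ι.map (lift M p.f)) := @mono_of_mono _ _ _ _ _ _ inc h1
      exact (IsDiscreteMod R).ι.mono_of_mono_map this

end DMod

section PMod

variable (R : Type u) [Ring R] [TopologicalSpace R]

/-- A topological right `R`-module is profinite if its underlying space is compact, Hausdorff and
totally disconnected. -/
def IsProfiniteMod : ObjectProperty (TopModuleCat.{u} Rᵐᵒᵖ) :=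
  fun M => CompactSpace M ∧ T2Space M ∧ TotallyDisconnectedSpace M

/-- The category of profinite right `R`-modules and continuous module homomorphisms. -/
abbrev PMod : Type (u + 1) := (IsProfiniteMod R).FullSubcategory

variable {R}

/-- The group of continuous `R`-module homomorphisms from `Z` to the discrete module `A`
(a map to a discrete space is continuous if and only if it is locally constant). -/
def contHom (Z : PMod R) (A : DMod R) : AddSubgroup (Z.obj →ₗ[Rᵐᵒᵖ] A.obj) where
  carrier := {f | IsLocallyConstant f}
  zero_mem' := IsLocallyConstant.const (0 : A.obj)
  add_mem' hf hg := IsLocallyConstant.add hf hg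
  neg_mem' hf := IsLocallyConstant.neg hf

variable [IsTopologicalRing R]

/-- The functor `A ↦ Hom_R(Z, A)` from discrete modules to abelian groups. -/
def homFunctor (Z : PMod R) : DMod R ⥤ AddCommGrpCat.{u} where
  obj A := AddCommGrpCat.of (contHom Z A)
  map {A B} φ := AddCommGrpCat.ofHom
    { toFun f := ⟨φ.hom.hom ∘ₗ f.1, f.2.comp φ.hom.hom⟩
      map_zero' := by ext; simp
      map_add' f g := by ext; simp }

instance (Z : PMod R) : (homFunctor Z).Additive where
  map_add {A B φ ψ} := by
    ext f
    rfl

/-- The natural transformation `Hom_R(Z, -) ⟶ Hom_R(Z', -)` induced by `Z' ⟶ Z`. -/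
def homPrecomp {Z' Z : PMod R} (ζ : Z' ⟶ Z) : homFunctor Z ⟶ homFunctor Z' where
  app A := AddCommGrpCat.ofHom
    { toFun f := ⟨f.1 ∘ₗ ζ.hom.hom.toLinearMap, f.2.comp_continuous ζ.hom.hom.continuous⟩
      map_zero' := by ext; simp
      map_add' f g := by ext; simp }

/-- `Ext_R^n(Z, -)`: the `n`-th right derived functor of `Hom_R(Z, -)` on discrete modules. -/
noncomputable def extFunctor (Z : PMod R) (n : ℕ) : DMod R ⥤ AddCommGrpCat.{u} :=
  (homFunctor Z).rightDerived n

/-- `Ext_R^n(Z, A)` for `Z` profinite and `A` discrete. -/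
noncomputable abbrev ExtR (Z : PMod R) (A : DMod R) (n : ℕ) : Type u := (extFunctor Z n).obj A

/-- The map `Ext_R^n(Z, A) → Ext_R^n(Z, B)` induced by `φ : A ⟶ B`. -/
noncomputable def extPost (Z : PMod R) {A B : DMod R} (φ : A ⟶ B) (n : ℕ) :
    ExtR Z A n →+ ExtR Z B n :=
  ((extFunctor Z n).map φ).hom

/-- The map `Ext_R^n(Z, A) → Ext_R^n(Z', A)` induced by `ζ : Z' ⟶ Z`. -/
noncomputable def extPre {Z' Z : PMod R} (ζ : Z' ⟶ Z) (A : DMod R) (n : ℕ) :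
    ExtR Z A n →+ ExtR Z' A n :=
  ((NatTrans.rightDerived (homPrecomp ζ) n).app A).hom

end PMod

section Horseshoe

open Preadditive

universe v₁ u₁

variable {C : Type u₁} [Category.{v₁} C] [Abelian C]

/-- A short exact sequence of injective resolutions over a short complex `S`. -/
structure ResolvedSequence (S : ShortComplex C) where
  /-- a resolution of the first object -/
  res₁ : InjectiveResolution S.X₁
  /-- a resolution of the second object -/
  res₂ : InjectiveResolution S.X₂
  /-- a resolution of the third object -/
  res₃ : InjectiveResolution S.X₃
  /-- a chain map lifting `S.f` -/
  f : res₁.cocomplex ⟶ res₂.cocomplex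
  /-- a chain map lifting `S.g` -/
  g : res₂.cocomplex ⟶ res₃.cocomplex
  zero : f ≫ g = 0
  shortExact : (ShortComplex.mk f g zero).ShortExact
  comm_f : res₁.ι ≫ f = (CochainComplex.single₀ C).map S.f ≫ res₂.ι
  comm_g : res₂.ι ≫ g = (CochainComplex.single₀ C).map S.g ≫ res₃.ι

namespace Horseshoe

variable {S : ShortComplex C} (I : InjectiveResolution S.X₁) (J : InjectiveResolution S.X₃)

/-- The augmentation of an injective resolution. -/
noncomputable def aug {X : C} (I : InjectiveResolution X) : X ⟶ I.cocomplex.X 0 := I.ι.f 0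

lemma aug_d {X : C} (I : InjectiveResolution X) : aug I ≫ I.cocomplex.d 0 1 = 0 :=
  I.ι_f_zero_comp_complex_d

instance {X : C} (I : InjectiveResolution X) : Mono (aug I) :=
  inferInstanceAs (Mono (I.ι.f 0))

lemma aug_exact {X : C} (I : InjectiveResolution X) :
    (ShortComplex.mk (aug I) (I.cocomplex.d 0 1) (aug_d I)).Exact := I.exact₀

/-- One step of the recursive construction of the twisting maps. -/
noncomputable def step (n : ℕ) (p : J.cocomplex.X n ⟶ I.cocomplex.X (n + 1))
    (q : {q : J.cocomplex.X (n + 1) ⟶ I.cocomplex.X (n + 2) //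
      J.cocomplex.d n (n + 1) ≫ q = p ≫ I.cocomplex.d (n + 1) (n + 2)}) :
    {r : J.cocomplex.X (n + 2) ⟶ I.cocomplex.X (n + 3) //
      J.cocomplex.d (n + 1) (n + 2) ≫ r = q.1 ≫ I.cocomplex.d (n + 2) (n + 3)} :=
  ⟨(J.exact_succ n).descToInjective (q.1 ≫ I.cocomplex.d (n + 2) (n + 3))
    (by have := q.2; dsimp; rw [reassoc_of% this]; simp),
    (J.exact_succ n).comp_descToInjective _ _⟩

lemma exists_twist (c : S.X₃ ⟶ I.cocomplex.X 1) (hc : c ≫ I.cocomplex.d 1 2 = 0) :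
    ∃ θ : ∀ n, J.cocomplex.X n ⟶ I.cocomplex.X (n + 1), aug J ≫ θ 0 = c ∧
      ∀ n, J.cocomplex.d n (n + 1) ≫ θ (n + 1) = θ n ≫ I.cocomplex.d (n + 1) (n + 2) := by
  let p0 : J.cocomplex.X 0 ⟶ I.cocomplex.X 1 := Injective.factorThru c (aug J)
  have hp0 : aug J ≫ p0 = c := Injective.comp_factorThru _ _
  let q0 : {q : J.cocomplex.X 1 ⟶ I.cocomplex.X 2 //
      J.cocomplex.d 0 1 ≫ q = p0 ≫ I.cocomplex.d 1 2} :=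
    ⟨(aug_exact J).descToInjective (p0 ≫ I.cocomplex.d 1 2) (by
        dsimp; rw [reassoc_of% hp0, hc]), (aug_exact J).comp_descToInjective _ _⟩
  let Q : ∀ n, Σ p : J.cocomplex.X n ⟶ I.cocomplex.X (n + 1),
      {q : J.cocomplex.X (n + 1) ⟶ I.cocomplex.X (n + 2) //
        J.cocomplex.d n (n + 1) ≫ q = p ≫ I.cocomplex.d (n + 1) (n + 2)} :=
    fun n => Nat.rec (motive := fun n => Σ p : J.cocomplex.X n ⟶ I.cocomplex.X (n + 1),
      {q : J.cocomplex.X (n + 1) ⟶ I.cocomplex.X (n + 2) //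
        J.cocomplex.d n (n + 1) ≫ q = p ≫ I.cocomplex.d (n + 1) (n + 2)})
      ⟨p0, q0⟩ (fun n P => ⟨P.2.1, step I J n P.1 P.2⟩) n
  exact ⟨fun n => (Q n).1, hp0, fun n => (Q n).2.2⟩

variable (θ : ∀ n, J.cocomplex.X n ⟶ I.cocomplex.X (n + 1))

/-- The twisted differential on `I ⊞ J`. -/
noncomputable def twD (n : ℕ) : I.cocomplex.X n ⊞ J.cocomplex.X n ⟶
    I.cocomplex.X (n + 1) ⊞ J.cocomplex.X (n + 1) :=
  biprod.desc (I.cocomplex.d n (n + 1) ≫ biprod.inl)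
    (J.cocomplex.d n (n + 1) ≫ biprod.inr + ((-1 : ℤ) ^ (n + 1)) • (θ n ≫ biprod.inl))

lemma twD_comp (h : ∀ n, J.cocomplex.d n (n + 1) ≫ θ (n + 1) =
    θ n ≫ I.cocomplex.d (n + 1) (n + 2)) (n : ℕ) : twD I J θ n ≫ twD I J θ (n + 1) = 0 := by
  have h' := h n
  ext1
  · simp [twD]
  · simp only [twD, biprod.inr_desc_assoc, add_comp, Category.assoc, zsmul_comp, biprod.inr_desc,
      biprod.inl_desc, comp_add, comp_zsmul, HomologicalComplex.d_comp_d_assoc, zero_comp,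
      zero_add, comp_zero]
    rw [reassoc_of% h', pow_succ _ (n + 1)]
    simp

/-- The middle complex. -/
noncomputable def mid (h : ∀ n, J.cocomplex.d n (n + 1) ≫ θ (n + 1) =
    θ n ≫ I.cocomplex.d (n + 1) (n + 2)) : CochainComplex C ℕ :=
  CochainComplex.of (fun n => I.cocomplex.X n ⊞ J.cocomplex.X n) (twD I J θ) (twD_comp I J θ h)

variable (h : ∀ n, J.cocomplex.d n (n + 1) ≫ θ (n + 1) =
  θ n ≫ I.cocomplex.d (n + 1) (n + 2))

/-- The inclusion of the first resolution. -/
noncomputable def midInl : I.cocomplex ⟶ mid I J θ h where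
  f n := (biprod.inl : I.cocomplex.X n ⟶ I.cocomplex.X n ⊞ J.cocomplex.X n)
  comm' := by
    rintro i _ rfl
    simp [mid, twD]

/-- The projection to the third resolution. -/
noncomputable def midSnd : mid I J θ h ⟶ J.cocomplex where
  f n := (biprod.snd : I.cocomplex.X n ⊞ J.cocomplex.X n ⟶ J.cocomplex.X n)
  comm' := by
    rintro i _ rfl
    simp only [mid, CochainComplex.of_d, twD]
    ext1 <;> simp

lemma midInl_midSnd : midInl I J θ h ≫ midSnd I J θ h = 0 := by
  ext n
  exact biprod.inl_snd

lemma mid_shortExact : (ShortComplex.mk _ _ (midInl_midSnd I J θ h)).ShortExact :=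
  HomologicalComplex.shortExact_of_degreewise_shortExact _ fun n =>
    (ShortComplex.Splitting.ofHasBinaryBiproduct (I.cocomplex.X n) (J.cocomplex.X n)).shortExact

lemma mid_exactAt_succ (n : ℕ) : (mid I J θ h).ExactAt (n + 1) := by
  rw [HomologicalComplex.exactAt_iff_isZero_homology]
  refine ((mid_shortExact I J θ h).homology_exact₂ (n + 1)).isZero_X₂ ?_ ?_
  · exact IsZero.eq_of_src ((HomologicalComplex.exactAt_iff_isZero_homology _ _).1
      (I.cocomplex_exactAt_succ n)) _ _
  · exact IsZero.eq_of_tgt ((HomologicalComplex.exactAt_iff_isZero_homology _ _).1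
      (J.cocomplex_exactAt_succ n)) _ _

lemma mid_d (n : ℕ) : (mid I J θ h).d n (n + 1) = twD I J θ n := by
  simp only [mid, CochainComplex.of_d]

variable (b : S.X₂ ⟶ I.cocomplex.X 0)

/-- The augmentation of the middle complex. -/
noncomputable def midAug : S.X₂ ⟶ (mid I J θ h).X 0 :=
  biprod.lift b (S.g ≫ aug J)

lemma midAug_d (hθ : S.g ≫ aug J ≫ θ 0 = b ≫ I.cocomplex.d 0 1) :
    midAug I J θ h b ≫ (mid I J θ h).d 0 1 = 0 := by
  have h0 : (mid I J θ h).d 0 1 = twD I J θ 0 := mid_d I J θ h 0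
  rw [h0]
  change biprod.lift b (S.g ≫ aug J) ≫ twD I J θ 0 = 0
  have h1 := aug_d J
  rw [biprod.lift_eq]
  simp only [twD, add_comp, Category.assoc, biprod.inl_desc, biprod.inr_desc, comp_add]
  rw [reassoc_of% h1]
  simp only [zero_comp, comp_zero, zero_add, pow_one, neg_smul, one_smul, comp_neg]
  rw [← Category.assoc b, ← hθ]
  simp

lemma f_midAug (hb : S.f ≫ b = aug I) :
    S.f ≫ midAug I J θ h b = aug I ≫ (midInl I J θ h).f 0 := by
  change S.f ≫ biprod.lift b (S.g ≫ aug J) = aug I ≫ biprod.inl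
  ext1
  · simp [hb]
  · simp [S.zero_assoc]

lemma midAug_g : midAug I J θ h b ≫ (midSnd I J θ h).f 0 = S.g ≫ aug J :=
  biprod.lift_snd _ _

instance : Mono ((midInl I J θ h).f 0) :=
  inferInstanceAs (Mono (biprod.inl : I.cocomplex.X 0 ⟶ I.cocomplex.X 0 ⊞ J.cocomplex.X 0))

lemma mono_midAug (hS : S.ShortExact) (hb : S.f ≫ b = aug I) : Mono (midAug I J θ h b) := by
  have := hS.mono_f
  apply mono_of_cancel_zero
  intro A x hx
  have h1 : x ≫ S.g = 0 := by
    rw [← cancel_mono (aug J), Category.assoc, ← midAug_g I J θ h b, reassoc_of% hx]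
    simp
  have h2 : hS.exact.lift x h1 ≫ S.f = x := hS.exact.lift_f x h1
  rw [← h2] at hx ⊢
  rw [Category.assoc, f_midAug I J θ h b hb, ← Category.assoc] at hx
  have h3 := zero_of_comp_mono _ hx
  rw [zero_of_comp_mono _ h3, zero_comp]

lemma eq_fst_inl {A X Y : C} (w : A ⟶ X ⊞ Y) (hw : w ≫ (biprod.snd : X ⊞ Y ⟶ Y) = 0) :
    (w ≫ (biprod.fst : X ⊞ Y ⟶ X)) ≫ biprod.inl = w := by
  apply biprod.hom_ext
  · simp
  · simp [hw]

lemma midAug_exact (hS : S.ShortExact) (hb : S.f ≫ b = aug I)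
    (hθ : S.g ≫ aug J ≫ θ 0 = b ≫ I.cocomplex.d 0 1) :
    (ShortComplex.mk _ _ (midAug_d I J θ h b hθ)).Exact := by
  have := hS.epi_g
  rw [ShortComplex.exact_iff_exact_up_to_refinements]
  intro A x hx
  dsimp at x hx
  have h1 : (x ≫ (midSnd I J θ h).f 0) ≫ J.cocomplex.d 0 1 = 0 := by
    rw [Category.assoc, (midSnd I J θ h).comm, reassoc_of% hx, zero_comp]
  let z : A ⟶ S.X₃ := (aug_exact J).lift _ h1
  have hz : z ≫ aug J = x ≫ (midSnd I J θ h).f 0 := (aug_exact J).lift_f _ h1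
  obtain ⟨A', π, hπ, y, hy⟩ := surjective_up_to_refinements_of_epi S.g z
  let w := π ≫ x - y ≫ midAug I J θ h b
  have hw : w ≫ (midSnd I J θ h).f 0 = 0 := by
    simp only [w, sub_comp, Category.assoc, midAug_g, ← hz]
    rw [reassoc_of% hy, sub_self]
  have hwd : w ≫ (mid I J θ h).d 0 1 = 0 := by
    simp only [w, sub_comp, Category.assoc, hx, midAug_d I J θ h b hθ, comp_zero, sub_self]
  let i : A' ⟶ I.cocomplex.X 0 := w ≫ (biprod.fst : I.cocomplex.X 0 ⊞ J.cocomplex.X 0 ⟶ _)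
  have hi : i ≫ (midInl I J θ h).f 0 = w := by
    exact eq_fst_inl w hw
  have hid : i ≫ I.cocomplex.d 0 1 = 0 := by
    have : Mono ((midInl I J θ h).f 1) :=
      inferInstanceAs (Mono (biprod.inl : I.cocomplex.X 1 ⟶ I.cocomplex.X 1 ⊞ J.cocomplex.X 1))
    rw [← cancel_mono ((midInl I J θ h).f 1), Category.assoc, ← (midInl I J θ h).comm,
      reassoc_of% hi, hwd, zero_comp]
  have ht : (aug_exact I).lift i hid ≫ aug I = i := (aug_exact I).lift_f i hid
  refine ⟨A', π, hπ, y + (aug_exact I).lift i hid ≫ S.f, ?_⟩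
  dsimp
  rw [add_comp, Category.assoc, f_midAug I J θ h b hb, reassoc_of% ht, hi]
  simp [w]

lemma exists_resolvedSequence [EnoughInjectives C] (hS : S.ShortExact) :
    Nonempty (ResolvedSequence S) := by
  have := hS.mono_f
  have := hS.epi_g
  let I := injectiveResolution S.X₁
  let J := injectiveResolution S.X₃
  let b : S.X₂ ⟶ I.cocomplex.X 0 := Injective.factorThru (aug I) S.f
  have hb : S.f ≫ b = aug I := Injective.comp_factorThru _ _
  let c : S.X₃ ⟶ I.cocomplex.X 1 := hS.exact.desc (b ≫ I.cocomplex.d 0 1)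
    (by rw [reassoc_of% hb, aug_d])
  have hc : S.g ≫ c = b ≫ I.cocomplex.d 0 1 := hS.exact.g_desc _ _
  obtain ⟨θ, hθ0, h⟩ := exists_twist I J c (by
    rw [← cancel_epi S.g, reassoc_of% hc]
    simp)
  have hθ : S.g ≫ aug J ≫ θ 0 = b ≫ I.cocomplex.d 0 1 := by rw [hθ0, hc]
  let ι : (CochainComplex.single₀ C).obj S.X₂ ⟶ mid I J θ h :=
    (CochainComplex.fromSingle₀Equiv _ _).symm ⟨midAug I J θ h b, midAug_d I J θ h b hθ⟩
  have hι : ι.f 0 = midAug I J θ h b := CochainComplex.fromSingle₀Equiv_symm_apply_f_zero _ _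
  refine ⟨⟨I, ⟨mid I J θ h, ?_, ι, ?_⟩, J, midInl I J θ h, midSnd I J θ h,
    midInl_midSnd I J θ h, mid_shortExact I J θ h, ?_, ?_⟩⟩
  · intro n
    exact inferInstanceAs (Injective (I.cocomplex.X n ⊞ J.cocomplex.X n))
  · refine ⟨fun n => ?_⟩
    cases n with
    | zero =>
      rw [CochainComplex.quasiIsoAt₀_iff, ShortComplex.quasiIso_iff_of_zeros]
      · refine (ShortComplex.exact_and_mono_f_iff_of_iso ?_).2
          ⟨midAug_exact I J θ h b hS hb hθ, mono_midAug I J θ h b hS hb⟩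
        exact ShortComplex.isoMk (Iso.refl _) (Iso.refl _) (Iso.refl _) (by
          erw [Category.id_comp, Category.comp_id]
          exact hι.symm) (by
          erw [Category.id_comp, Category.comp_id]
          rfl)
      all_goals rfl
    | succ n =>
      rw [quasiIsoAt_iff_exactAt]
      · exact mid_exactAt_succ I J θ h n
      · exact CochainComplex.exactAt_succ_single_obj _ _
  · apply HomologicalComplex.from_single_hom_ext
    rw [HomologicalComplex.comp_f, HomologicalComplex.comp_f, CochainComplex.single₀_map_f_zero]
    exact (f_midAug I J θ h b hb).symm.trans (congrArg (S.f ≫ ·) hι.symm)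
  · apply HomologicalComplex.from_single_hom_ext
    rw [HomologicalComplex.comp_f, HomologicalComplex.comp_f, CochainComplex.single₀_map_f_zero]
    exact (congrArg (· ≫ (midSnd I J θ h).f 0) hι).trans (midAug_g I J θ h b)

end Horseshoe

end Horseshoe

section Delta

universe v₁ u₁ v₂ u₂

variable {C : Type u₁} [Category.{v₁} C] [Abelian C] {D : Type u₂} [Category.{v₂} D] [Abelian D]

lemma ResolvedSequence.map_shortExact {S : ShortComplex C} (P : ResolvedSequence S) (F : C ⥤ D)
    [F.Additive] : ((ShortComplex.mk P.f P.g P.zero).map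
      (F.mapHomologicalComplex (ComplexShape.up ℕ))).ShortExact := by
  refine HomologicalComplex.shortExact_of_degreewise_shortExact _ fun n => ?_
  have h := (HomologicalComplex.shortExact_iff_degreewise_shortExact _).1 P.shortExact n
  have : Injective ((ShortComplex.mk P.f P.g P.zero).map
      (HomologicalComplex.eval C (ComplexShape.up ℕ) n)).X₁ :=
    inferInstanceAs (Injective (P.res₁.cocomplex.X n))
  exact (h.splittingOfInjective.map F).shortExact

variable [EnoughInjectives C]

/-- The connecting homomorphism `R^n F(X₃) ⟶ R^(n+1) F(X₁)` of a short exact sequence: the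
connecting homomorphism of the short exact sequence of complexes obtained by applying `F` to a short
exact sequence of injective resolutions. -/
noncomputable def rightDerivedDelta (F : C ⥤ D) [F.Additive] {S : ShortComplex C}
    (hS : S.ShortExact) (n : ℕ) :
    (F.rightDerived n).obj S.X₃ ⟶ (F.rightDerived (n + 1)).obj S.X₁ :=
  let P := (Horseshoe.exists_resolvedSequence hS).some
  (P.res₃.isoRightDerivedObj F n).hom ≫ (P.map_shortExact F).δ n (n + 1) rfl ≫
    (P.res₁.isoRightDerivedObj F (n + 1)).inv

end Delta

section ExtDelta

variable {R : Type u} [Ring R] [TopologicalSpace R] [IsTopologicalRing R]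

/-- The connecting homomorphism `Ext^n(Z, S.X₃) → Ext^(n+1)(Z, S.X₁)` of a short exact sequence of
discrete modules. -/
noncomputable def extDelta (Z : PMod R) {S : ShortComplex (DMod R)} (hS : S.ShortExact) (n : ℕ) :
    ExtR Z S.X₃ n →+ ExtR Z S.X₁ (n + 1) :=
  (rightDerivedDelta (homFunctor Z) hS n).hom

/-- A pair of composable maps of profinite modules is a short exact sequence. -/
structure PMod.IsShortExact {Z' Z Z'' : PMod R} (i : Z' ⟶ Z) (q : Z ⟶ Z'') : Prop where
  injective : Function.Injective i.hom.hom
  exact : Function.Exact i.hom.hom q.hom.hom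
  surjective : Function.Surjective q.hom.hom

lemma PMod.exists_open_submodule [CompactSpace R] (Z : PMod R) (V : Set Z.obj) (hV : IsOpen V)
    (h0 : (0 : Z.obj) ∈ V) :
    ∃ U : Submodule Rᵐᵒᵖ Z.obj, IsOpen (U : Set Z.obj) ∧ (U : Set Z.obj) ⊆ V := by
  obtain ⟨h1, h2, h3⟩ := Z.property
  have : CompactSpace Rᵐᵒᵖ := MulOpposite.opHomeomorph.compactSpace
  obtain ⟨W, hW, h0W, hWV⟩ := compact_exists_isClopen_in_isOpen hV h0
  obtain ⟨H, hH⟩ := IsTopologicalAddGroup.exist_openAddSubgroup_sub_clopen_nhds_of_zero hW h0W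
  let U : Submodule Rᵐᵒᵖ Z.obj :=
    { carrier := {z | ∀ r : Rᵐᵒᵖ, r • z ∈ H}
      zero_mem' := fun r => by simp
      add_mem' := fun {a b} ha hb r => by
        rw [smul_add]
        exact H.add_mem (ha r) (hb r)
      smul_mem' := fun s z hz r => by
        rw [← mul_smul]
        exact hz _ }
  refine ⟨U, ?_, fun z hz => hWV (hH ?_)⟩
  · have hcl : IsClosed {p : Z.obj × Rᵐᵒᵖ | p.2 • p.1 ∉ H} := by
      have hc : Continuous fun p : Z.obj × Rᵐᵒᵖ => p.2 • p.1 := by fun_prop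
      exact (H.isOpen.preimage hc).isClosed_compl
    have := (isClosedMap_fst_of_compactSpace _ hcl).isOpen_compl
    convert this using 1
    ext z
    simp [U]
  · have := hz 1
    rwa [one_smul] at this

lemma isDiscreteMod_quotient {Z : PMod R} (U : Submodule Rᵐᵒᵖ Z.obj)
    (hU : IsOpen (U : Set Z.obj)) :
    IsDiscreteMod R (ModuleCat.of Rᵐᵒᵖ (Z.obj ⧸ U)) := by
  refine .of_isOpen_ann fun m => ?_
  obtain ⟨z, rfl⟩ := U.mkQ_surjective m
  have h : {r : Rᵐᵒᵖ | r • U.mkQ z = 0} = (fun r : Rᵐᵒᵖ => r • z) ⁻¹' (U : Set Z.obj) := by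
    ext r
    exact Submodule.Quotient.mk_eq_zero U (x := r • z)
  change IsOpen {r : Rᵐᵒᵖ | r • U.mkQ z = 0}
  rw [h]
  exact hU.preimage (by fun_prop)

lemma isLocallyConstant_mkQ {Z : PMod R} (U : Submodule Rᵐᵒᵖ Z.obj)
    (hU : IsOpen (U : Set Z.obj)) : IsLocallyConstant U.mkQ := by
  rw [IsLocallyConstant.iff_eventually_eq]
  intro z
  have : (fun w => w - z) ⁻¹' (U : Set Z.obj) ∈ nhds z :=
    (hU.preimage (by fun_prop)).mem_nhds (by simp)
  filter_upwards [this] with w hw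
  exact (Submodule.Quotient.eq U).2 hw

/-- Homomorphisms from a closed submodule to an injective discrete module extend. -/
lemma contHom_extend [CompactSpace R] {Z' Z : PMod R} (i : Z' ⟶ Z)
    (hi : Function.Injective i.hom.hom) (I : DMod R) [Injective I] (f : contHom Z' I) :
    ∃ g : contHom Z I, ∀ z, g.1 (i.hom.hom z) = f.1 z := by
  obtain ⟨_, _, _⟩ := Z.property
  obtain ⟨_, _, _⟩ := Z'.property
  have hemb : Topology.IsClosedEmbedding i.hom.hom :=
    i.hom.hom.continuous.isClosedEmbedding hi
  obtain ⟨W, hW, hWf⟩ := hemb.isInducing.isOpen_iff.1 (f.2.isOpen_fiber 0)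
  obtain ⟨U, hU, hUW⟩ := Z.exists_open_submodule W hW (by
    have h0 : (0 : Z'.obj) ∈ {x | f.1 x = 0} := map_zero f.1
    rw [← hWf] at h0
    simpa using h0)
  let N : Submodule Rᵐᵒᵖ Z'.obj := U.comap i.hom.hom.toLinearMap
  have hN : IsOpen (N : Set Z'.obj) := hU.preimage i.hom.hom.continuous
  let Q : DMod R := ⟨ModuleCat.of Rᵐᵒᵖ (Z.obj ⧸ U), isDiscreteMod_quotient U hU⟩
  let Q' : DMod R := ⟨ModuleCat.of Rᵐᵒᵖ (Z'.obj ⧸ N), isDiscreteMod_quotient N hN⟩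
  have hNf : N ≤ LinearMap.ker f.1 := fun z hz => by
    have h1 : z ∈ i.hom.hom ⁻¹' W := hUW hz
    rw [hWf] at h1
    exact h1
  let j : Q' ⟶ Q := ObjectProperty.homMk (ModuleCat.ofHom (N.mapQ U i.hom.hom.toLinearMap le_rfl))
  let φ : Q' ⟶ I := ObjectProperty.homMk (ModuleCat.ofHom (N.liftQ f.1 hNf))
  have hj : Mono j := by
    have : Mono ((IsDiscreteMod R).ι.map j) := by
      refine (ModuleCat.mono_iff_injective _).2 ?_
      refine (injective_iff_map_eq_zero (N.mapQ U i.hom.hom.toLinearMap le_rfl)).2 fun a ha => ?_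
      obtain ⟨z, rfl⟩ := N.mkQ_surjective a
      simpa [N] using ha
    exact (IsDiscreteMod R).ι.mono_of_mono_map this
  let ψ : Q ⟶ I := Injective.factorThru φ j
  have hψ : j ≫ ψ = φ := Injective.comp_factorThru φ j
  refine ⟨⟨ψ.hom.hom ∘ₗ U.mkQ, (isLocallyConstant_mkQ U hU).comp ψ.hom.hom⟩, fun z => ?_⟩
  have h1 : (j ≫ ψ).hom.hom (N.mkQ z) = φ.hom.hom (N.mkQ z) := by rw [hψ]
  exact h1

lemma PMod.IsShortExact.comp_eq_zero {Z' Z Z'' : PMod R} {i : Z' ⟶ Z} {q : Z ⟶ Z''}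
    (h : PMod.IsShortExact i q) : homPrecomp q ≫ homPrecomp i = 0 := by
  ext A f
  apply Subtype.ext
  ext z
  change f.1 (q.hom.hom (i.hom.hom z)) = 0
  rw [h.exact.apply_apply_eq_zero, map_zero]

/-- For `A` injective, `Hom(-, A)` is exact. -/
lemma PMod.IsShortExact.hom_shortExact [CompactSpace R] {Z' Z Z'' : PMod R} {i : Z' ⟶ Z}
    {q : Z ⟶ Z''} (h : PMod.IsShortExact i q) (A : DMod R) [Injective A] :
    (ShortComplex.mk ((homPrecomp q).app A) ((homPrecomp i).app A)
      (congr_app h.comp_eq_zero A)).ShortExact where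
  mono_f := by
    rw [AddCommGrpCat.mono_iff_injective]
    intro f g hfg
    apply Subtype.ext
    ext z
    obtain ⟨w, rfl⟩ := h.surjective z
    exact congrArg (fun k : contHom Z A => k.1 w) hfg
  epi_g := by
    rw [AddCommGrpCat.epi_iff_surjective]
    intro f
    obtain ⟨g, hg⟩ := contHom_extend i h.injective A f
    refine ⟨g, Subtype.ext (LinearMap.ext hg)⟩
  exact := by
    rw [ShortComplex.ab_exact_iff]
    intro (f : contHom Z A) hf
    obtain ⟨_, _, _⟩ := Z.property
    obtain ⟨_, _, _⟩ := Z''.property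
    have hf' : ∀ z, f.1 (i.hom.hom z) = 0 := fun z =>
      congrArg (fun k : contHom Z' A => k.1 z) hf
    have hker : LinearMap.ker q.hom.hom.toLinearMap ≤ LinearMap.ker f.1 := fun z hz => by
      obtain ⟨w, rfl⟩ := (h.exact z).1 hz
      exact hf' w
    let e := q.hom.hom.toLinearMap.quotKerEquivOfSurjective h.surjective
    let g : Z''.obj →ₗ[Rᵐᵒᵖ] A.obj := (Submodule.liftQ _ f.1 hker) ∘ₗ e.symm.toLinearMap
    have hg : ∀ z, g (q.hom.hom z) = f.1 z := fun z => by
      have h1 : e.symm (q.hom.hom z) = Submodule.Quotient.mk z := by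
        rw [LinearEquiv.symm_apply_eq]
        rfl
      change (Submodule.liftQ _ f.1 hker) (e.symm (q.hom.hom z)) = f.1 z
      rw [h1]
      rfl
    have hquot : Topology.IsQuotientMap q.hom.hom :=
      q.hom.hom.continuous.isClosedMap.isQuotientMap q.hom.hom.continuous h.surjective
    have hglc : IsLocallyConstant g := by
      intro s
      rw [← hquot.isOpen_preimage]
      have : q.hom.hom ⁻¹' (g ⁻¹' s) = f.1 ⁻¹' s := by
        ext z
        simp [hg]
      rw [this]
      exact f.2 s
    exact ⟨⟨g, hglc⟩, Subtype.ext (LinearMap.ext hg)⟩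

/-- The short exact sequence of complexes `0 → Hom(Z'', I) → Hom(Z, I) → Hom(Z', I) → 0`. -/
noncomputable def PMod.IsShortExact.complexes {Z' Z Z'' : PMod R} {i : Z' ⟶ Z} {q : Z ⟶ Z''}
    (h : PMod.IsShortExact i q) (K : CochainComplex (DMod R) ℕ) :
    ShortComplex (CochainComplex AddCommGrpCat.{u} ℕ) :=
  ShortComplex.mk ((NatTrans.mapHomologicalComplex (homPrecomp q) _).app K)
    ((NatTrans.mapHomologicalComplex (homPrecomp i) _).app K) (by
      ext n : 1
      exact congr_app h.comp_eq_zero (K.X n))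

lemma PMod.IsShortExact.complexes_shortExact [CompactSpace R] {Z' Z Z'' : PMod R} {i : Z' ⟶ Z}
    {q : Z ⟶ Z''} (h : PMod.IsShortExact i q) {A : DMod R} (I : InjectiveResolution A) :
    (h.complexes I.cocomplex).ShortExact :=
  HomologicalComplex.shortExact_of_degreewise_shortExact _ fun n =>
    h.hom_shortExact (I.cocomplex.X n)

/-- The connecting homomorphism `Ext^n(Z', A) → Ext^(n+1)(Z'', A)` of a short exact sequence
`0 → Z' → Z → Z'' → 0` of profinite modules: the connecting homomorphism of the short exact sequence
of complexes obtained by mapping it to an injective resolution of `A`. -/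
noncomputable def extDeltaPre [CompactSpace R] {Z' Z Z'' : PMod R} {i : Z' ⟶ Z} {q : Z ⟶ Z''}
    (h : PMod.IsShortExact i q) (A : DMod R) (n : ℕ) : ExtR Z' A n →+ ExtR Z'' A (n + 1) :=
  let I := injectiveResolution A
  ((I.isoRightDerivedObj (homFunctor Z') n).hom ≫ (h.complexes_shortExact I).δ n (n + 1) rfl ≫
    (I.isoRightDerivedObj (homFunctor Z'') (n + 1)).inv).hom

end ExtDelta

section Etale

open TopologicalSpace Topology

/-- The total space `⨆ x, G x × {x}` of a family of sets indexed by `X`. -/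
@[ext]
structure Tot {X : Type u} (G : X → Type u) where
  /-- the base point -/
  base : X
  /-- the element of the fibre -/
  val : G base

/-- The fibre square of the total space, with its topology as a subspace of the square. -/
@[reducible] def pairTop {X : Type u} (G : X → Type u) (τ : TopologicalSpace (Tot G)) :
    TopologicalSpace (Tot fun x => G x × G x) :=
  .induced (fun t => ((⟨t.base, t.val.1⟩, ⟨t.base, t.val.2⟩) : Tot G × Tot G)) inferInstance

/-- The pullback of the total space along `f : Y → X`, with its topology as a subspace of the
product of the total space with `Y`. -/
@[reducible] def pullTop {X Y : Type u} [TopologicalSpace Y] (f : Y → X) (G : X → Type u)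
    (τ : TopologicalSpace (Tot G)) : TopologicalSpace (Tot fun y => G (f y)) :=
  .induced (fun t => ((⟨f t.base, t.val⟩, t.base) : Tot G × Y)) inferInstance

lemma continuous_pullTop_fst {X Y : Type u} [TopologicalSpace Y] (f : Y → X) (G : X → Type u)
    (τ : TopologicalSpace (Tot G)) :
    Continuous[pullTop f G τ, τ] fun t => (⟨f t.base, t.val⟩ : Tot G) := by
  let _ := pullTop f G τ
  have h : Continuous fun t : Tot fun y => G (f y) => ((⟨f t.base, t.val⟩, t.base) : Tot G × Y) :=
    continuous_induced_dom
  exact continuous_fst.comp h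

lemma continuous_pullTop_base {X Y : Type u} [σ : TopologicalSpace Y] (f : Y → X) (G : X → Type u)
    (τ : TopologicalSpace (Tot G)) :
    Continuous[pullTop f G τ, σ] (Tot.base : (Tot fun y => G (f y)) → Y) := by
  let _ := pullTop f G τ
  have h : Continuous fun t : Tot fun y => G (f y) => ((⟨f t.base, t.val⟩, t.base) : Tot G × Y) :=
    continuous_induced_dom
  exact continuous_snd.comp h

/-- An étale space of (right) `R`-modules over the profinite space `X`. -/
structure EtaleMod (R : Type u) [Ring R] [TopologicalSpace R] (X : Profinite.{u}) where
  /-- the fibres -/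
  fib : X → DMod R
  /-- the topology on the total space -/
  [top : TopologicalSpace (Tot fun x => (fib x).obj)]
  isLocalHomeomorph : IsLocalHomeomorph (Tot.base : (Tot fun x => (fib x).obj) → X)
  continuous_zero : Continuous fun x : X => (⟨x, 0⟩ : Tot fun x => (fib x).obj)
  continuous_add : Continuous[pairTop _ top, top]
    fun t : Tot fun x => (fib x).obj × (fib x).obj => ⟨t.base, t.val.1 + t.val.2⟩
  continuous_smul : Continuous fun q : (Tot fun x => (fib x).obj) × Rᵐᵒᵖ =>
    (⟨q.1.base, q.2 • q.1.val⟩ : Tot fun x => (fib x).obj)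

variable {R : Type u} [Ring R] [TopologicalSpace R]

namespace EtaleMod

variable {X Y W : Profinite.{u}}

/-- The underlying family of sets of an étale space. -/
abbrev Fam (𝒜 : EtaleMod R X) : X → Type u := fun x => (𝒜.fib x).obj

instance (𝒜 : EtaleMod R X) : TopologicalSpace (Tot 𝒜.Fam) := 𝒜.top

lemma continuous_add_comp {T : Type u} [TopologicalSpace T] (𝒜 : EtaleMod R X) (f : T → X)
    (s t : ∀ y, 𝒜.Fam (f y)) (hs : Continuous fun y => (⟨f y, s y⟩ : Tot 𝒜.Fam))
    (ht : Continuous fun y => (⟨f y, t y⟩ : Tot 𝒜.Fam)) :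
    Continuous fun y => (⟨f y, s y + t y⟩ : Tot 𝒜.Fam) := by
  let _ := pairTop 𝒜.Fam 𝒜.top
  have h : Continuous fun y => (⟨f y, (s y, t y)⟩ : Tot fun x => 𝒜.Fam x × 𝒜.Fam x) :=
    continuous_induced_rng.2 (hs.prodMk ht)
  exact 𝒜.continuous_add.comp h

/-- The module of continuous maps `s : T → 𝒜` lifting `f : T → X`. -/
def liftSubmodule {T : Type u} [TopologicalSpace T] (𝒜 : EtaleMod R X) (f : C(T, X)) :
    Submodule Rᵐᵒᵖ (∀ y, 𝒜.Fam (f y)) where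
  carrier := {s | Continuous fun y => (⟨f y, s y⟩ : Tot 𝒜.Fam)}
  zero_mem' := 𝒜.continuous_zero.comp f.continuous
  add_mem' {s t} hs ht := 𝒜.continuous_add_comp f s t hs ht
  smul_mem' r s hs :=
    𝒜.continuous_smul.comp (Continuous.prodMk hs (continuous_const (y := r)))

lemma isOpen_zero (𝒜 : EtaleMod R X) : IsOpen (Set.range fun x : X => (⟨x, 0⟩ : Tot 𝒜.Fam)) :=
  (𝒜.isLocalHomeomorph.isOpenEmbedding_of_comp
    (f := fun x : X => (⟨x, 0⟩ : Tot 𝒜.Fam)) .id 𝒜.continuous_zero).isOpen_range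

variable [IsTopologicalRing R]

lemma isDiscreteMod_lift {T : Type u} [TopologicalSpace T] [CompactSpace T] (𝒜 : EtaleMod R X)
    (f : C(T, X)) : IsDiscreteMod R (ModuleCat.of Rᵐᵒᵖ (𝒜.liftSubmodule f)) := by
  refine .of_isOpen_ann fun s => ?_
  have hs : Continuous fun y => (⟨f y, s.1 y⟩ : Tot 𝒜.Fam) := s.2
  have hc : Continuous fun p : Rᵐᵒᵖ × T => (⟨f p.2, p.1 • s.1 p.2⟩ : Tot 𝒜.Fam) :=
    𝒜.continuous_smul.comp ((hs.comp continuous_snd).prodMk continuous_fst)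
  have hcl := isClosedMap_fst_of_compactSpace _ (𝒜.isOpen_zero.preimage hc).isClosed_compl
  convert hcl.isOpen_compl using 1
  have h0 : ∀ (x : X) (a : 𝒜.Fam x), (⟨x, a⟩ : Tot 𝒜.Fam) ∈
      Set.range (fun x : X => (⟨x, 0⟩ : Tot 𝒜.Fam)) ↔ a = 0 := by
    intro x a
    constructor
    · rintro ⟨x', hx⟩
      cases hx
      rfl
    · rintro rfl
      exact ⟨x, rfl⟩
  ext r
  simp only [Set.mem_compl_iff, Set.mem_image, Set.mem_preimage, h0, Set.mem_ofPred_eq]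
  constructor
  · rintro hr ⟨⟨r', y⟩, hy, rfl⟩
    exact hy (congrFun (congrArg Subtype.val hr) y)
  · intro h
    refine Subtype.ext (funext fun y => ?_)
    by_contra hy
    exact h ⟨(r, y), hy, rfl⟩

/-- The continuous product of `𝒜`: the discrete `R`-module of global sections. -/
def cprod (𝒜 : EtaleMod R X) : DMod R :=
  ⟨ModuleCat.of Rᵐᵒᵖ (𝒜.liftSubmodule (ContinuousMap.id X)), 𝒜.isDiscreteMod_lift _⟩

/-- The discrete `R`-module of sections of `𝒜` over the clopen set `U`. -/
def sectionsOn (𝒜 : EtaleMod R X) (U : Clopens X) : DMod R :=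
  have : CompactSpace U := isCompact_iff_compactSpace.1 U.isClosed.isCompact
  ⟨ModuleCat.of Rᵐᵒᵖ (𝒜.liftSubmodule ⟨((↑) : U → X), continuous_subtype_val⟩),
    𝒜.isDiscreteMod_lift _⟩

/-- Evaluation of global sections at `x`. -/
def ev (𝒜 : EtaleMod R X) (x : X) : 𝒜.cprod ⟶ 𝒜.fib x :=
  ObjectProperty.homMk (ModuleCat.ofHom
    ((LinearMap.proj (φ := 𝒜.Fam) x) ∘ₗ (𝒜.liftSubmodule (ContinuousMap.id X)).subtype))

/-- Evaluation of sections over `U` at `x ∈ U`. -/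
def evOn (𝒜 : EtaleMod R X) (U : Clopens X) (x : U) : 𝒜.sectionsOn U ⟶ 𝒜.fib x :=
  ObjectProperty.homMk (ModuleCat.ofHom
    ((LinearMap.proj (φ := fun x : U => 𝒜.Fam x) x) ∘ₗ (𝒜.liftSubmodule _).subtype))

/-- A morphism of étale spaces of `R`-modules `(𝒜, X) → (ℬ, Y)` over the continuous map
`f : Y → X`. -/
@[ext]
structure Hom (f : C(Y, X)) (𝒜 : EtaleMod R X) (ℬ : EtaleMod R Y) where
  /-- the homomorphisms on fibres -/
  app : ∀ y, 𝒜.fib (f y) ⟶ ℬ.fib y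
  cont : Continuous[pullTop f 𝒜.Fam 𝒜.top, ℬ.top]
    fun t : Tot fun y => 𝒜.Fam (f y) => ⟨t.base, (app t.base).hom.hom t.val⟩

lemma Hom.continuous_comp {f : C(Y, X)} {𝒜 : EtaleMod R X} {ℬ : EtaleMod R Y} (φ : Hom f 𝒜 ℬ)
    {T : Type u} [TopologicalSpace T] (g : C(T, Y)) (s : ∀ t, 𝒜.Fam (f (g t)))
    (hs : Continuous fun t => (⟨f (g t), s t⟩ : Tot 𝒜.Fam)) :
    Continuous fun t => (⟨g t, (φ.app (g t)).hom.hom (s t)⟩ : Tot ℬ.Fam) := by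
  let _ := pullTop f 𝒜.Fam 𝒜.top
  have h : Continuous fun t => (⟨g t, s t⟩ : Tot fun y => 𝒜.Fam (f y)) :=
    continuous_induced_rng.2 (hs.prodMk g.continuous)
  exact φ.cont.comp h

/-- The map on continuous products induced by a morphism of étale spaces. -/
def Hom.cprodMap {f : C(Y, X)} {𝒜 : EtaleMod R X} {ℬ : EtaleMod R Y} (φ : Hom f 𝒜 ℬ) :
    𝒜.cprod ⟶ ℬ.cprod :=
  ObjectProperty.homMk (ModuleCat.ofHom
    { toFun := fun s => ⟨fun y => (φ.app y).hom.hom (s.1 (f y)),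
        φ.continuous_comp (ContinuousMap.id Y) (fun y => s.1 (f y)) (s.2.comp f.continuous)⟩
      map_add' := fun s t => Subtype.ext (funext fun y => map_add (φ.app y).hom.hom _ _)
      map_smul' := fun r s => Subtype.ext (funext fun y => map_smul (φ.app y).hom.hom _ _) })

/-- Étale spaces of `R`-modules over a fixed profinite space. -/
instance : Category (EtaleMod R X) where
  Hom 𝒜 ℬ := Hom (ContinuousMap.id X) 𝒜 ℬ
  id 𝒜 := ⟨fun x => 𝟙 (𝒜.fib x), continuous_pullTop_fst (ContinuousMap.id X) 𝒜.Fam 𝒜.top⟩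
  comp {𝒜 ℬ 𝒞} φ ψ := ⟨fun x => φ.app x ≫ ψ.app x,
    let _ := pullTop (ContinuousMap.id X) 𝒜.Fam 𝒜.top
    ψ.continuous_comp (T := Tot fun x => 𝒜.Fam (ContinuousMap.id X x))
      ⟨Tot.base, continuous_pullTop_base (ContinuousMap.id X) 𝒜.Fam 𝒜.top⟩
      (fun t => (φ.app t.base).hom.hom t.val) φ.cont⟩
  id_comp φ := Hom.ext (funext fun x => Category.id_comp (φ.app x))
  comp_id φ := Hom.ext (funext fun x => Category.comp_id (φ.app x))
  assoc φ ψ χ := Hom.ext (funext fun x => Category.assoc (φ.app x) (ψ.app x) (χ.app x))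

end EtaleMod

end Etale

section EtaleExact

open TopologicalSpace Topology

variable {R : Type u} [Ring R] [TopologicalSpace R] [IsTopologicalRing R]

lemma DMod.shortExact_of {S : ShortComplex (DMod R)} (hf : Function.Injective S.f.hom.hom)
    (h : Function.Exact S.f.hom.hom S.g.hom.hom) (hg : Function.Surjective S.g.hom.hom) :
    S.ShortExact := by
  have : ∀ {A B : DMod R} (f : A ⟶ B), PreservesLimit (parallelPair f 0) (IsDiscreteMod R).ι :=
    fun f => (IsDiscreteMod R).preservesKernels_ι f
  have : ∀ {A B : DMod R} (f : A ⟶ B), PreservesColimit (parallelPair f 0) (IsDiscreteMod R).ι :=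
    fun f => (IsDiscreteMod R).preservesCokernels_ι f
  have hp : (IsDiscreteMod R).ι.PreservesHomology := { }
  have hm : Mono S.f :=
    (IsDiscreteMod R).ι.mono_of_mono_map ((ModuleCat.mono_iff_injective _).2 hf)
  have he : Epi S.g :=
    (IsDiscreteMod R).ι.epi_of_epi_map ((ModuleCat.epi_iff_surjective _).2 hg)
  refine ShortComplex.ShortExact.mk ?_
  rw [← ShortComplex.exact_map_iff_of_faithful S (IsDiscreteMod R).ι]
  exact (ShortComplex.ShortExact.moduleCat_exact_iff_function_exact _).2 h

namespace EtaleMod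

variable {X Y : Profinite.{u}} {𝒜' 𝒜 𝒜'' : EtaleMod R X}

/-- A pair of composable maps of étale spaces over `X` is a short exact sequence if it is one on
every fibre. -/
structure IsShortExact (φ : 𝒜' ⟶ 𝒜) (ψ : 𝒜 ⟶ 𝒜'') : Prop where
  injective : ∀ x, Function.Injective (Hom.app φ x).hom.hom
  exact : ∀ x, Function.Exact (Hom.app φ x).hom.hom (Hom.app ψ x).hom.hom
  surjective : ∀ x, Function.Surjective (Hom.app ψ x).hom.hom

variable {φ : 𝒜' ⟶ 𝒜} {ψ : 𝒜 ⟶ 𝒜''}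

/-- The short exact sequence on the fibres over `x`. -/
def IsShortExact.fibSeq (h : IsShortExact φ ψ) (x : X) : ShortComplex (DMod R) where
  X₁ := 𝒜'.fib x
  X₂ := 𝒜.fib x
  X₃ := 𝒜''.fib x
  f := Hom.app φ x
  g := Hom.app ψ x
  zero := by
    ext a
    exact (h.exact x).apply_apply_eq_zero a

lemma IsShortExact.fibSeq_shortExact (h : IsShortExact φ ψ) (x : X) :
    (h.fibSeq x).ShortExact :=
  DMod.shortExact_of (h.injective x) (h.exact x) (h.surjective x)

/-- The sequence of modules of global sections. -/
def IsShortExact.cprodSeq (h : IsShortExact φ ψ) : ShortComplex (DMod R) where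
  X₁ := 𝒜'.cprod
  X₂ := 𝒜.cprod
  X₃ := 𝒜''.cprod
  f := Hom.cprodMap φ
  g := Hom.cprodMap ψ
  zero := by
    ext s
    exact Subtype.ext (funext fun x => (h.exact x).apply_apply_eq_zero (s.1 x))

lemma eventually_eq_of_eq {𝒜 : EtaleMod R X} {x : X} {s t : ∀ y, 𝒜.Fam y}
    (hs : ContinuousAt (fun y => (⟨y, s y⟩ : Tot 𝒜.Fam)) x)
    (ht : ContinuousAt (fun y => (⟨y, t y⟩ : Tot 𝒜.Fam)) x) (h : s x = t x) :
    ∀ᶠ y in 𝓝 x, s y = t y := by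
  obtain ⟨W, hW, hxW, hinj⟩ := 𝒜.isLocalHomeomorph.isLocallyInjective ⟨x, s x⟩
  have h1 := hs (hW.mem_nhds hxW)
  have hxW' : (⟨x, t x⟩ : Tot 𝒜.Fam) ∈ W := by
    rw [← h]
    exact hxW
  have h2 := ht (hW.mem_nhds hxW')
  filter_upwards [h1, h2] with y hy1 hy2
  exact eq_of_heq (Tot.mk.inj (hinj hy1 hy2 rfl)).2

lemma exists_local_section (𝒜 : EtaleMod R X) (x : X) (a : 𝒜.Fam x) :
    ∃ s : ∀ y, 𝒜.Fam y, s x = a ∧ ∀ᶠ y in 𝓝 x, ContinuousAt (fun y => (⟨y, s y⟩ : Tot 𝒜.Fam)) y := by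
  obtain ⟨e, he, hbase⟩ := 𝒜.isLocalHomeomorph ⟨x, a⟩
  classical
  let s : ∀ y, 𝒜.Fam y := fun y =>
    if h : (e.symm y).base = y then h ▸ (e.symm y).val else 0
  have hs : ∀ y ∈ e.target, (⟨y, s y⟩ : Tot 𝒜.Fam) = e.symm y := by
    intro y hy
    have h1 : (e.symm y).base = y := by
      have := e.right_inv hy
      rwa [← hbase] at this
    have : s y = h1 ▸ (e.symm y).val := dif_pos h1
    rw [this]
    generalize e.symm y = t at h1
    subst h1
    rfl
  have hx : x ∈ e.target := by
    have := e.map_source he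
    rwa [← hbase] at this
  have hxa : e.symm x = ⟨x, a⟩ := by
    have := e.left_inv he
    rwa [← hbase] at this
  refine ⟨s, ?_, ?_⟩
  · exact eq_of_heq (Tot.mk.inj ((hs x hx).trans hxa)).2
  · filter_upwards [e.open_target.mem_nhds hx] with y hy
    refine (e.symm.continuousAt hy).congr ?_
    filter_upwards [e.open_target.mem_nhds hy] with z hz
    exact (hs z hz).symm

lemma Hom.continuousAt {f : C(Y, X)} {𝒜 : EtaleMod R X} {ℬ : EtaleMod R Y} (φ : Hom f 𝒜 ℬ)
    (s : ∀ y, 𝒜.Fam (f y)) (y : Y) (hs : ContinuousAt (fun y => (⟨f y, s y⟩ : Tot 𝒜.Fam)) y) :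
    ContinuousAt (fun y => (⟨y, (φ.app y).hom.hom (s y)⟩ : Tot ℬ.Fam)) y := by
  let _ := pullTop f 𝒜.Fam 𝒜.top
  have h : ContinuousAt (fun y => (⟨y, s y⟩ : Tot fun y => 𝒜.Fam (f y))) y := by
    have hi : IsInducing fun t : Tot fun y => 𝒜.Fam (f y) =>
        ((⟨f t.base, t.val⟩, t.base) : Tot 𝒜.Fam × Y) := ⟨rfl⟩
    rw [hi.continuousAt_iff]
    exact hs.prodMk continuousAt_id
  exact φ.cont.continuousAt.comp h

lemma IsShortExact.cprod_surjective (h : IsShortExact φ ψ) :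
    Function.Surjective (Hom.cprodMap ψ).hom.hom := by
  intro s
  have key : ∃ U : Set X, IsClopen U ∧ Set.univ ⊆ U ∧ ∃ r : ∀ y, 𝒜.Fam y, ∀ y ∈ U,
      ContinuousAt (fun y => (⟨y, r y⟩ : Tot 𝒜.Fam)) y ∧ (Hom.app ψ y).hom.hom (r y) = s.1 y := by
    refine IsCompact.induction_on (p := fun K => ∃ U : Set X, IsClopen U ∧ K ⊆ U ∧
      ∃ r : ∀ y, 𝒜.Fam y, ∀ y ∈ U, ContinuousAt (fun y => (⟨y, r y⟩ : Tot 𝒜.Fam)) y ∧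
        (Hom.app ψ y).hom.hom (r y) = s.1 y) isCompact_univ ?_ ?_ ?_ ?_
    · exact ⟨∅, isClopen_empty, subset_rfl, fun _ => 0, by simp⟩
    · rintro K L hKL ⟨U, hU, hLU, r, hr⟩
      exact ⟨U, hU, hKL.trans hLU, r, hr⟩
    · rintro K L ⟨U, hU, hKU, r, hr⟩ ⟨V, hV, hLV, t, ht⟩
      classical
      refine ⟨U ∪ V, hU.union hV, Set.union_subset_union hKU hLV,
        fun y => if y ∈ U then r y else t y, fun y hy => ?_⟩
      by_cases hyU : y ∈ U
      · refine ⟨(hr y hyU).1.congr ?_, by simpa [hyU] using (hr y hyU).2⟩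
        filter_upwards [hU.isOpen.mem_nhds hyU] with z hz
        simp [hz]
      · have hyV : y ∈ V := hy.resolve_left hyU
        refine ⟨(ht y hyV).1.congr ?_, by simpa [hyU] using (ht y hyV).2⟩
        filter_upwards [hU.compl.isOpen.mem_nhds hyU] with z hz
        simp [show z ∉ U from hz]
    · intro x _
      obtain ⟨a, ha⟩ := h.surjective x (s.1 x)
      obtain ⟨r, hrx, hr⟩ := 𝒜.exists_local_section x a
      have hs : ∀ y, ContinuousAt (fun y => (⟨y, s.1 y⟩ : Tot 𝒜''.Fam)) y :=
        fun y => Continuous.continuousAt s.2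
      have h1 := eventually_eq_of_eq (Hom.continuousAt ψ r x hr.self_of_nhds) (hs x)
        (by rw [hrx]; exact ha)
      obtain ⟨V, hV, hVo, hxV⟩ := mem_nhds_iff.1 (hr.and h1)
      obtain ⟨U, hU, hxU, hUV⟩ := compact_exists_isClopen_in_isOpen hVo hxV
      exact ⟨U, mem_nhdsWithin_of_mem_nhds (hU.isOpen.mem_nhds hxU), U, hU, subset_rfl, r,
        fun y hy => hV (hUV hy)⟩
  obtain ⟨U, _, hU, r, hr⟩ := key
  exact ⟨⟨r, continuous_iff_continuousAt.2 fun y => (hr y (hU trivial)).1⟩,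
    Subtype.ext (funext fun y => (hr y (hU trivial)).2)⟩

lemma IsShortExact.cprodSeq_shortExact (h : IsShortExact φ ψ) : h.cprodSeq.ShortExact := by
  refine DMod.shortExact_of ?_ ?_ h.cprod_surjective
  · intro s t hst
    exact Subtype.ext (funext fun x => h.injective x (congrFun (congrArg Subtype.val hst) x))
  · intro s
    constructor
    · intro hs
      have hs' : ∀ x, (Hom.app ψ x).hom.hom (s.1 x) = 0 := fun x =>
        congrFun (congrArg Subtype.val hs) x
      choose r hr using fun x => (h.exact x (s.1 x)).1 (hs' x)
      refine ⟨⟨r, continuous_iff_continuousAt.2 fun x => ?_⟩,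
        Subtype.ext (funext fun x => hr x)⟩
      obtain ⟨t, htx, ht⟩ := 𝒜'.exists_local_section x (r x)
      have hsx : ∀ y, ContinuousAt (fun y => (⟨y, s.1 y⟩ : Tot 𝒜.Fam)) y :=
        fun y => Continuous.continuousAt s.2
      have h1 := eventually_eq_of_eq (Hom.continuousAt φ t x ht.self_of_nhds) (hsx x)
        (by rw [htx]; exact hr x)
      refine ht.self_of_nhds.congr ?_
      filter_upwards [h1] with y hy
      have : t y = r y := h.injective y (hy.trans (hr y).symm)
      exact congrArg (Tot.mk (G := 𝒜'.Fam) y) this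
    · rintro ⟨r, rfl⟩
      exact Subtype.ext (funext fun x => (h.exact x).apply_apply_eq_zero (r.1 x))

end EtaleMod

end EtaleExact

section ExtEtale

open TopologicalSpace Topology

/-- A topology on the total space of a family of abelian groups over the profinite space `X` makes
it an étale space of discrete torsion abelian groups (the same as discrete modules over the
profinite completion of `ℤ`). -/
structure IsEtaleTorsion {X : Profinite.{u}} (G : X → Type u) [∀ x, AddCommGroup (G x)]
    (τ : TopologicalSpace (Tot G)) : Prop where
  isLocalHomeomorph : IsLocalHomeomorph (Tot.base : Tot G → X)
  continuous_zero : Continuous fun x : X => (⟨x, 0⟩ : Tot G)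
  continuous_add : Continuous[pairTop G τ, τ]
    fun t : Tot fun x => G x × G x => ⟨t.base, t.val.1 + t.val.2⟩
  continuous_neg : Continuous fun t : Tot G => (⟨t.base, -t.val⟩ : Tot G)
  torsion : ∀ x, IsAddTorsion (G x)

/-- The continuous product (group of global sections) of an étale space of discrete torsion abelian
groups. -/
def IsEtaleTorsion.cprod {X : Profinite.{u}} {G : X → Type u} [∀ x, AddCommGroup (G x)]
    {τ : TopologicalSpace (Tot G)} (h : IsEtaleTorsion G τ) : AddSubgroup (∀ x, G x) where
  carrier := {s | Continuous fun x => (⟨x, s x⟩ : Tot G)}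
  zero_mem' := h.continuous_zero
  add_mem' {s t} hs ht := by
    let _ := pairTop G τ
    have hp : Continuous fun x => (⟨x, (s x, t x)⟩ : Tot fun x => G x × G x) :=
      continuous_induced_rng.2 (Continuous.prodMk hs ht)
    exact h.continuous_add.comp hp
  neg_mem' hs := h.continuous_neg.comp hs

variable {R : Type u} [Ring R] [TopologicalSpace R] [IsTopologicalRing R]

/-- The family of groups `Ext_R^n(Z, A_x)`. -/
abbrev ExtFam (Z : PMod R) {X : Profinite.{u}} (𝒜 : EtaleMod R X) (n : ℕ) : X → Type u :=
  fun x => ExtR Z (𝒜.fib x) n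

/-- The topology on the disjoint union of the groups `Ext_R^n(Z, A_x)`: it is generated by the sets
of germs `{(s|_x, x) | x ∈ U}` of elements `s ∈ Ext_R^n(Z, 𝒜(U))` for `U ⊆ X` clopen. -/
@[reducible] def extTop (Z : PMod R) {X : Profinite.{u}} (𝒜 : EtaleMod R X) (n : ℕ) :
    TopologicalSpace (Tot (ExtFam Z 𝒜 n)) :=
  .generateFrom {O | ∃ (U : Clopens X) (s : ExtR Z (𝒜.sectionsOn U) n),
    O = Set.range fun x : U => (⟨x, extPost Z (𝒜.evOn U x) n s⟩ : Tot (ExtFam Z 𝒜 n))}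

end ExtEtale

section DeltaFunctor

universe w v₁ u₁

/-- The structure of a (covariant) cohomological δ-functor on a family of abelian groups `T n A`,
for `A` in a category with a distinguished class of short exact sequences. -/
structure CohomologicalDeltaFunctor (C : Type u₁) [Category.{v₁} C]
    (exactSeq : ∀ {A B D : C}, (A ⟶ B) → (B ⟶ D) → Prop)
    (T : ℕ → C → Type w) [∀ n A, AddCommGroup (T n A)] where
  /-- the action on morphisms -/
  map : ∀ (n : ℕ) {A B : C}, (A ⟶ B) → (T n A →+ T n B)
  map_id : ∀ (n : ℕ) (A : C), map n (𝟙 A) = AddMonoidHom.id (T n A)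
  map_comp : ∀ (n : ℕ) {A B D : C} (f : A ⟶ B) (g : B ⟶ D),
    map n (f ≫ g) = (map n g).comp (map n f)
  /-- the connecting homomorphisms -/
  δ : ∀ (n : ℕ) {A B D : C} (f : A ⟶ B) (g : B ⟶ D), exactSeq f g → (T n D →+ T (n + 1) A)
  δ_naturality : ∀ (n : ℕ) {A B D A' B' D' : C} (f : A ⟶ B) (g : B ⟶ D) (h : exactSeq f g)
    (f' : A' ⟶ B') (g' : B' ⟶ D') (h' : exactSeq f' g') (a : A ⟶ A') (b : B ⟶ B') (d : D ⟶ D'),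
    f ≫ b = a ≫ f' → g ≫ d = b ≫ g' →
      (map (n + 1) a).comp (δ n f g h) = (δ n f' g' h').comp (map n d)
  injective_zero : ∀ {A B D : C} (f : A ⟶ B) (g : B ⟶ D), exactSeq f g →
    Function.Injective (map 0 f)
  exact_middle : ∀ (n : ℕ) {A B D : C} (f : A ⟶ B) (g : B ⟶ D), exactSeq f g →
    Function.Exact (map n f) (map n g)
  exact_right : ∀ (n : ℕ) {A B D : C} (f : A ⟶ B) (g : B ⟶ D) (h : exactSeq f g),
    Function.Exact (map n g) (δ n f g h)
  exact_left : ∀ (n : ℕ) {A B D : C} (f : A ⟶ B) (g : B ⟶ D) (h : exactSeq f g),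
    Function.Exact (δ n f g h) (map (n + 1) f)

/-- An isomorphism of cohomological δ-functors. -/
structure CohomologicalDeltaFunctor.Iso {C : Type u₁} [Category.{v₁} C]
    {exactSeq : ∀ {A B D : C}, (A ⟶ B) → (B ⟶ D) → Prop}
    {T T' : ℕ → C → Type w} [∀ n A, AddCommGroup (T n A)] [∀ n A, AddCommGroup (T' n A)]
    (L : CohomologicalDeltaFunctor C exactSeq T) (L' : CohomologicalDeltaFunctor C exactSeq T') where
  /-- the isomorphisms of groups -/
  equiv : ∀ n A, T n A ≃+ T' n A
  map_comm : ∀ (n : ℕ) {A B : C} (f : A ⟶ B) (t : T n A),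
    equiv n B (L.map n f t) = L'.map n f (equiv n A t)
  δ_comm : ∀ (n : ℕ) {A B D : C} (f : A ⟶ B) (g : B ⟶ D) (h : exactSeq f g) (t : T n D),
    equiv (n + 1) A (L.δ n f g h t) = L'.δ n f g h (equiv n D t)

end DeltaFunctor

/-! ### Derived functors: additivity, naturality of connecting homomorphisms, long exact sequences.
-/

section HomologicalAlgebra

open Preadditive

universe v₁ u₁ v₂ u₂

variable {C : Type u₁} [Category.{v₁} C] [Abelian C] {D : Type u₂} [Category.{v₂} D] [Abelian D]

/-! The theorem rests on one fact: `Ext_R^n(Z, -)` commutes with filtered colimits of discrete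
modules (`IsElemColim.comp_extFunctor`). The fibre of an étale space at `x` is the filtered colimit
of the modules of sections over the clopen neighbourhoods of `x` (`isElemColim_stalkCocone`), so the
Ext group of the fibre is the colimit of the Ext groups of these modules.

In degree zero the fact is a matter of compactness. A continuous map from `Z` to a discrete module
has finite image, and orbits in discrete modules under the compact ring `R` are finite; hence being
a homomorphism amounts to finitely many equations, which hold at some stage of the colimit. Higher
degrees follow by dimension shifting. This needs an embedding into injective modules that is
functorial and itself commutes with filtered colimits: `A` is embedded into the module of locally
constant additive maps from `R` to a functorial divisible group `DivHull A`.

Clopen subsets of `X` act on the module of global sections by setting sections to zero outside of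
them. The relations between these endomorphisms pass to `M = Ext_R^n(Z, ∏ 𝒜)` because Ext is
additive. So the Boolean algebra of clopen sets acts on `M`, and the stalks of `M` are the groups
`Ext_R^n(Z, A_x)`. For any such `M` (`GermData`) the germs form an étale space, and compactness of
`X` shows that `M` is its group of global sections.

The δ-functor structures on the side of sections are transported along the resulting isomorphisms.
The transported maps are the fibrewise ones because evaluation at `x` is compatible with all the
sequences involved and connecting homomorphisms are natural. For sequences of coefficients this
naturality requires lifting a morphism of short exact sequences to a strictly commuting diagram of
injective resolutions (`ResolvedSequence.exists_map`). -/

lemma CochainComplex.mono_homologyMap_zero {K L : CochainComplex D ℕ} (f : K ⟶ L) [Mono (f.f 0)] :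
    Mono (HomologicalComplex.homologyMap f 0) := by
  have h1 : Mono (HomologicalComplex.cyclesMap f 0) := by
    have : Mono (HomologicalComplex.cyclesMap f 0 ≫ L.iCycles 0) := by
      rw [HomologicalComplex.cyclesMap_i]
      infer_instance
    exact mono_of_mono _ (L.iCycles 0)
  -- There are no boundaries in degree 0, so homology there is the object of cycles.
  have h2 : Mono (HomologicalComplex.homologyMap f 0 ≫ L.isoHomologyπ₀.inv) := by
    rw [CochainComplex.isoHomologyπ₀_inv_naturality]
    infer_instance
  exact mono_of_mono _ L.isoHomologyπ₀.inv

lemma up_rel (n : ℕ) : (ComplexShape.up ℕ).Rel n (n + 1) := rfl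

/-- A sum of lifts to injective resolutions lifts the sum, and any lift computes the derived
functor. Additivity is what lets decompositions of `X` into clopen sets act on Ext. -/
instance [HasInjectiveResolutions C] (F : C ⥤ D) [F.Additive] (n : ℕ) :
    (F.rightDerived n).Additive where
  map_add {X Y f g} := by
    let I := injectiveResolution X
    let J := injectiveResolution Y
    have hf := InjectiveResolution.desc_commutes f J I
    have hg := InjectiveResolution.desc_commutes g J I
    rw [F.rightDerived_map_eq n f _ hf, F.rightDerived_map_eq n g _ hg,
      F.rightDerived_map_eq n (f + g) (InjectiveResolution.desc f J I +
        InjectiveResolution.desc g J I) (by rw [comp_add, hf, hg, Functor.map_add, add_comp]),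
      Functor.map_add, add_comp, comp_add]

section DerivedIso

variable [EnoughInjectives C] (F : C ⥤ D) [F.Additive]

/-- The value of a right derived functor as the homology of a complex. -/
noncomputable def CategoryTheory.InjectiveResolution.derivedIso {X : C} (I : InjectiveResolution X) (n : ℕ) :
    (F.rightDerived n).obj X ≅
      ((F.mapHomologicalComplex (ComplexShape.up ℕ)).obj I.cocomplex).homology n :=
  I.isoRightDerivedObj F n

lemma CategoryTheory.InjectiveResolution.derivedIso_hom_naturality {X Y : C} (f : X ⟶ Y)
    (I : InjectiveResolution X) (J : InjectiveResolution Y) (φ : I.cocomplex ⟶ J.cocomplex)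
    (h : I.ι ≫ φ = (CochainComplex.single₀ C).map f ≫ J.ι) (n : ℕ) :
    (F.rightDerived n).map f ≫ (J.derivedIso F n).hom = (I.derivedIso F n).hom ≫
      HomologicalComplex.homologyMap ((F.mapHomologicalComplex _).map φ) n :=
  I.isoRightDerivedObj_hom_naturality f J φ (by
    have := HomologicalComplex.congr_hom h 0
    simpa using this) F n

lemma CategoryTheory.InjectiveResolution.derivedIso_hom_nat {G : C ⥤ D} [G.Additive] (α : F ⟶ G) {X : C}
    (I : InjectiveResolution X) (n : ℕ) :
    (NatTrans.rightDerived α n).app X ≫ (I.derivedIso G n).hom = (I.derivedIso F n).hom ≫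
      HomologicalComplex.homologyMap
        ((NatTrans.mapHomologicalComplex α (ComplexShape.up ℕ)).app I.cocomplex) n := by
  have h : (NatTrans.rightDerived α n).app X = (I.derivedIso F n).hom ≫
      HomologicalComplex.homologyMap
        ((NatTrans.mapHomologicalComplex α (ComplexShape.up ℕ)).app I.cocomplex) n ≫
        (I.derivedIso G n).inv := I.rightDerived_app_eq α n
  rw [h, Category.assoc, Category.assoc, Iso.inv_hom_id, Category.comp_id]

end DerivedIso

/-- The connecting homomorphism of a short exact sequence of complexes, conjugated by isomorphisms
of the outer homology groups with given objects. -/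
noncomputable def conjDelta {K : ShortComplex (CochainComplex D ℕ)} (hK : K.ShortExact) {n : ℕ}
    {A B : D} (a : A ≅ K.X₁.homology (n + 1)) (b : B ≅ K.X₃.homology n) : B ⟶ A :=
  b.hom ≫ hK.δ n (n + 1) (up_rel n) ≫ a.inv

section ConjDelta

variable {K K' : ShortComplex (CochainComplex D ℕ)} (hK : K.ShortExact) (hK' : K'.ShortExact)
  {n : ℕ} {A B A' B' M : D} (a : A ≅ K.X₁.homology (n + 1)) (b : B ≅ K.X₃.homology n)
  (a' : A' ≅ K'.X₁.homology (n + 1)) (b' : B' ≅ K'.X₃.homology n)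

lemma conjDelta_hom : conjDelta hK a b ≫ a.hom = b.hom ≫ hK.δ n (n + 1) (up_rel n) := by
  rw [conjDelta, Category.assoc, Category.assoc, Iso.inv_hom_id, Category.comp_id]

/-- The connecting homomorphisms in both variables of Ext have the form `conjDelta`, so this one
square yields all their naturality statements. -/
lemma conjDelta_naturality (Ψ : K ⟶ K') (f : A ⟶ A') (g : B ⟶ B')
    (hf : f ≫ a'.hom = a.hom ≫ HomologicalComplex.homologyMap Ψ.τ₁ (n + 1))
    (hg : g ≫ b'.hom = b.hom ≫ HomologicalComplex.homologyMap Ψ.τ₃ n) :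
    conjDelta hK a b ≫ f = g ≫ conjDelta hK' a' b' := by
  rw [← cancel_mono a'.hom, Category.assoc, hf, ← Category.assoc, conjDelta_hom, Category.assoc,
    HomologicalComplex.HomologySequence.δ_naturality Ψ hK hK', Category.assoc, conjDelta_hom,
    ← Category.assoc, ← Category.assoc, hg]

variable {g : M ⟶ B} {m : M ≅ K.X₂.homology n}
  (hg : g ≫ b.hom = m.hom ≫ HomologicalComplex.homologyMap K.g n)

include hg in
lemma comp_conjDelta : g ≫ conjDelta hK a b = 0 := by
  rw [← cancel_mono a.hom, Category.assoc, conjDelta_hom, ← Category.assoc, hg, Category.assoc,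
    hK.comp_δ, comp_zero, zero_comp]

lemma conjDelta_exact₃ : (ShortComplex.mk _ _ (comp_conjDelta hK a b hg)).Exact :=
  ShortComplex.exact_of_iso (ShortComplex.isoMk m b a hg.symm (conjDelta_hom hK a b).symm).symm
    (hK.homology_exact₃ n (n + 1) (up_rel n))

variable {f : A ⟶ M} {m : M ≅ K.X₂.homology (n + 1)}
  (hf : f ≫ m.hom = a.hom ≫ HomologicalComplex.homologyMap K.f (n + 1))

include hf in
lemma conjDelta_comp : conjDelta hK a b ≫ f = 0 := by
  rw [← cancel_mono m.hom, Category.assoc, hf, ← Category.assoc, conjDelta_hom, Category.assoc,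
    hK.δ_comp, comp_zero, zero_comp]

lemma conjDelta_exact₁ : (ShortComplex.mk _ _ (conjDelta_comp hK a b hf)).Exact :=
  ShortComplex.exact_of_iso (ShortComplex.isoMk b a m (conjDelta_hom hK a b).symm hf.symm).symm
    (hK.homology_exact₁ n (n + 1) (up_rel n))

end ConjDelta

namespace ResolvedSequence

variable {S S' : ShortComplex C}

/-- The short exact sequence of complexes underlying a resolved sequence. -/
abbrev complexes (P : ResolvedSequence S) : ShortComplex (CochainComplex C ℕ) :=
  ShortComplex.mk P.f P.g P.zero

/-- A chain map lifting the middle component of a morphism of short complexes can be chosen to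
commute strictly with a given lift of the first component. -/
lemma exists_lift_middle (P : ResolvedSequence S) (P' : ResolvedSequence S') (φ : S ⟶ S')
    (α : P.res₁.cocomplex ⟶ P'.res₁.cocomplex)
    (hα : P.res₁.ι ≫ α = (CochainComplex.single₀ C).map φ.τ₁ ≫ P'.res₁.ι) :
    ∃ β : P.res₂.cocomplex ⟶ P'.res₂.cocomplex, P.f ≫ β = α ≫ P'.f ∧
      P.res₂.ι ≫ β = (CochainComplex.single₀ C).map φ.τ₂ ≫ P'.res₂.ι := by
  let β := InjectiveResolution.desc φ.τ₂ P'.res₂ P.res₂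
  have hβ : P.res₂.ι ≫ β = (CochainComplex.single₀ C).map φ.τ₂ ≫ P'.res₂.ι :=
    InjectiveResolution.desc_commutes _ _ _
  have hmono : Mono P.f := P.shortExact.mono_f
  -- Both composites lift `S.f ≫ φ.τ₂`, so an arbitrary lift `β` makes the square commute up to
  -- homotopy.
  let H : Homotopy (P.f ≫ β) (α ≫ P'.f) := InjectiveResolution.descHomotopy (S.f ≫ φ.τ₂) _ _
    (by rw [← Category.assoc, P.comm_f, Category.assoc, hβ, Functor.map_comp, Category.assoc])
    (by rw [← Category.assoc, hα, Category.assoc, P'.comm_f, ← Category.assoc,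
      ← Functor.map_comp, φ.comm₁₂])
  -- The homotopy extends along the monomorphism `P.f` because the terms of `P'.res₂` are injective.
  -- Subtracting the null-homotopic map of the extension from `β` makes the square commute strictly.
  let k : ∀ i j, P.res₂.cocomplex.X i ⟶ P'.res₂.cocomplex.X j := fun i j =>
    Injective.factorThru (H.hom i j) (P.f.f i)
  have hk : ∀ i j, P.f.f i ≫ k i j = H.hom i j := fun i j => Injective.comp_factorThru _ _
  have hH : P.f ≫ Homotopy.nullHomotopicMap k = P.f ≫ β - α ≫ P'.f := by
    rw [Homotopy.comp_nullHomotopicMap]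
    ext n
    have h1 := H.comm n
    have h2 : (Homotopy.nullHomotopicMap fun i j => P.f.f i ≫ k i j).f n =
        dNext n H.hom + prevD n H.hom := by
      simp only [hk]
      rfl
    rw [h2, HomologicalComplex.sub_f_apply, h1]
    abel
  -- In degree 0 the correction starts with the differential, which kills the augmentation; the
  -- corrected map therefore still lifts `φ.τ₂`.
  have hι : P.res₂.ι ≫ Homotopy.nullHomotopicMap k = 0 := by
    apply HomologicalComplex.from_single_hom_ext
    have h0 : (Homotopy.nullHomotopicMap k).f 0 = P.res₂.cocomplex.d 0 1 ≫ k 1 0 :=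
      Homotopy.nullHomotopicMap_f_of_not_rel_right (c := ComplexShape.up ℕ) (k₁ := 0) (k₀ := 1)
        (by simp) (by simp) k
    rw [HomologicalComplex.comp_f, h0]
    have h1 : P.res₂.ι.f 0 ≫ P.res₂.cocomplex.d 0 1 = 0 := Horseshoe.aug_d P.res₂
    rw [← Category.assoc, h1, zero_comp]
    rfl
  refine ⟨β - Homotopy.nullHomotopicMap k, ?_, ?_⟩
  · rw [comp_sub, hH, sub_sub_cancel]
  · rw [comp_sub, hι, sub_zero, hβ]

/-- A morphism of short complexes lifts to a morphism of short exact sequences of resolutions. -/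
lemma exists_map (hS : S.ShortExact) (P : ResolvedSequence S) (P' : ResolvedSequence S')
    (φ : S ⟶ S') :
    ∃ Ψ : P.complexes ⟶ P'.complexes,
      P.res₁.ι ≫ Ψ.τ₁ = (CochainComplex.single₀ C).map φ.τ₁ ≫ P'.res₁.ι ∧
      P.res₂.ι ≫ Ψ.τ₂ = (CochainComplex.single₀ C).map φ.τ₂ ≫ P'.res₂.ι ∧
      P.res₃.ι ≫ Ψ.τ₃ = (CochainComplex.single₀ C).map φ.τ₃ ≫ P'.res₃.ι := by
  let α := InjectiveResolution.desc φ.τ₁ P'.res₁ P.res₁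
  have hα : P.res₁.ι ≫ α = (CochainComplex.single₀ C).map φ.τ₁ ≫ P'.res₁.ι :=
    InjectiveResolution.desc_commutes _ _ _
  obtain ⟨β, hβ, hβι⟩ := exists_lift_middle P P' φ α hα
  have hepi : Epi P.g := P.shortExact.epi_g
  have hw : P.f ≫ β ≫ P'.g = 0 := by
    rw [← Category.assoc, hβ, Category.assoc, P'.zero, comp_zero]
  let γ : P.res₃.cocomplex ⟶ P'.res₃.cocomplex := P.shortExact.exact.desc (β ≫ P'.g) hw
  have hγ : P.g ≫ γ = β ≫ P'.g := P.shortExact.exact.g_desc _ hw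
  refine ⟨⟨α, β, γ, hβ.symm, hγ.symm⟩, hα, hβι, ?_⟩
  -- That `γ` respects the augmentations can be tested after precomposing with the epimorphism
  -- `S.g`; there it follows from the same property of `β`.
  have := hS.epi_g
  apply HomologicalComplex.from_single_hom_ext
  have e1 : P.res₂.ι.f 0 ≫ P.g.f 0 = S.g ≫ P.res₃.ι.f 0 := by
    have := HomologicalComplex.congr_hom P.comm_g 0
    simpa using this
  have e2 : P'.res₂.ι.f 0 ≫ P'.g.f 0 = S'.g ≫ P'.res₃.ι.f 0 := by
    have := HomologicalComplex.congr_hom P'.comm_g 0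
    simpa using this
  have e3 : P.res₂.ι.f 0 ≫ β.f 0 = φ.τ₂ ≫ P'.res₂.ι.f 0 := by
    have := HomologicalComplex.congr_hom hβι 0
    simpa using this
  have e4 : P.g.f 0 ≫ γ.f 0 = β.f 0 ≫ P'.g.f 0 := HomologicalComplex.congr_hom hγ 0
  rw [HomologicalComplex.comp_f, HomologicalComplex.comp_f, CochainComplex.single₀_map_f_zero]
  have e5 : S.g ≫ P.res₃.ι.f 0 ≫ γ.f 0 = S.g ≫ φ.τ₃ ≫ P'.res₃.ι.f 0 :=
    (Category.assoc _ _ _).symm.trans <| ((reassoc_of% e1) (γ.f 0)).symm.trans <|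
      (congrArg (P.res₂.ι.f 0 ≫ ·) e4).trans <| ((reassoc_of% e3) (P'.g.f 0)).trans <|
      (Category.assoc _ _ _).trans <| (congrArg (φ.τ₂ ≫ ·) e2).trans <|
      (reassoc_of% φ.comm₂₃) (P'.res₃.ι.f 0)
  exact (cancel_epi S.g).1 e5

variable [EnoughInjectives C] (F : C ⥤ D) [F.Additive]

/-- The connecting homomorphism computed with a given resolved sequence. -/
noncomputable def delta (P : ResolvedSequence S) (n : ℕ) :
    (F.rightDerived n).obj S.X₃ ⟶ (F.rightDerived (n + 1)).obj S.X₁ :=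
  conjDelta (P.map_shortExact F) (P.res₁.derivedIso F (n + 1)) (P.res₃.derivedIso F n)

lemma map_f_comp_iso (P : ResolvedSequence S) (n : ℕ) :
    (F.rightDerived n).map S.f ≫ (P.res₂.derivedIso F n).hom =
      (P.res₁.derivedIso F n).hom ≫
        HomologicalComplex.homologyMap ((F.mapHomologicalComplex _).map P.f) n :=
  InjectiveResolution.derivedIso_hom_naturality F _ _ _ _ P.comm_f n

lemma map_g_comp_iso (P : ResolvedSequence S) (n : ℕ) :
    (F.rightDerived n).map S.g ≫ (P.res₃.derivedIso F n).hom =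
      (P.res₂.derivedIso F n).hom ≫
        HomologicalComplex.homologyMap ((F.mapHomologicalComplex _).map P.g) n :=
  InjectiveResolution.derivedIso_hom_naturality F _ _ _ _ P.comm_g n

/-- The two resolved sequences are arbitrary. With the identity for `φ` this shows that `delta` does
not depend on the resolutions, so the choice made in `rightDerivedDelta` is harmless. -/
lemma delta_naturality (hS : S.ShortExact) (P : ResolvedSequence S) (P' : ResolvedSequence S')
    (φ : S ⟶ S') (n : ℕ) :
    P.delta F n ≫ (F.rightDerived (n + 1)).map φ.τ₁ =
      (F.rightDerived n).map φ.τ₃ ≫ P'.delta F n := by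
  obtain ⟨Ψ, h1, -, h3⟩ := exists_map hS P P' φ
  exact conjDelta_naturality _ _ _ _ _ _
    ((F.mapHomologicalComplex (ComplexShape.up ℕ)).mapShortComplex.map Ψ) _ _
    (InjectiveResolution.derivedIso_hom_naturality F _ _ _ _ h1 (n + 1))
    (InjectiveResolution.derivedIso_hom_naturality F _ _ _ _ h3 n)

lemma exact₂ (P : ResolvedSequence S) (n : ℕ) :
    (ShortComplex.mk ((F.rightDerived n).map S.f) ((F.rightDerived n).map S.g) (by
      rw [← Functor.map_comp, S.zero, Functor.map_zero])).Exact :=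
  ShortComplex.exact_of_iso
    (ShortComplex.isoMk (P.res₁.derivedIso F n) (P.res₂.derivedIso F n)
      (P.res₃.derivedIso F n) (P.map_f_comp_iso F n).symm
      (P.map_g_comp_iso F n).symm).symm
    ((P.map_shortExact F).homology_exact₂ n)

lemma exact₃ (P : ResolvedSequence S) (n : ℕ) :
    ∃ h, (ShortComplex.mk ((F.rightDerived n).map S.g) (P.delta F n) h).Exact :=
  ⟨_, conjDelta_exact₃ (P.map_shortExact F) _ _ (P.map_g_comp_iso F n)⟩

lemma exact₁ (P : ResolvedSequence S) (n : ℕ) :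
    ∃ h, (ShortComplex.mk (P.delta F n) ((F.rightDerived (n + 1)).map S.f) h).Exact :=
  ⟨_, conjDelta_exact₁ (P.map_shortExact F) _ _ (P.map_f_comp_iso F (n + 1))⟩

/-- No left exactness of `F` enters: the sequence of resolutions splits degreewise, so `F` keeps its
first map monic, and in degree 0 this suffices for homology. -/
lemma mono_map_zero (P : ResolvedSequence S) : Mono ((F.rightDerived 0).map S.f) := by
  have h : Mono (((F.mapHomologicalComplex (ComplexShape.up ℕ)).map P.f).f 0) :=
    (((HomologicalComplex.shortExact_iff_degreewise_shortExact _).1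
      (P.map_shortExact F)) 0).mono_f
  have := CochainComplex.mono_homologyMap_zero ((F.mapHomologicalComplex _).map P.f)
  have : Mono ((F.rightDerived 0).map S.f ≫ (P.res₂.derivedIso F 0).hom) := by
    rw [P.map_f_comp_iso F 0]
    infer_instance
  exact mono_of_mono _ (P.res₂.derivedIso F 0).hom

end ResolvedSequence

end HomologicalAlgebra

/-! ### Long exact sequences of Ext in both variables and their naturality. -/

section ExtSequences

variable {R : Type u} [Ring R] [TopologicalSpace R] [IsTopologicalRing R]

lemma extPost_id (Z : PMod R) (A : DMod R) (n : ℕ) : extPost Z (𝟙 A) n = AddMonoidHom.id _ := by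
  unfold extPost
  rw [CategoryTheory.Functor.map_id]
  rfl

lemma extPost_comp (Z : PMod R) {A B C : DMod R} (f : A ⟶ B) (g : B ⟶ C) (n : ℕ) :
    extPost Z (f ≫ g) n = (extPost Z g n).comp (extPost Z f n) := by
  unfold extPost
  rw [Functor.map_comp]
  rfl

lemma extPost_extPost (Z : PMod R) {A B C : DMod R} (f : A ⟶ B) (g : B ⟶ C) (n : ℕ)
    (a : ExtR Z A n) : extPost Z g n (extPost Z f n a) = extPost Z (f ≫ g) n a := by
  rw [extPost_comp]
  rfl

instance (Z : PMod R) (n : ℕ) : (extFunctor Z n).Additive :=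
  inferInstanceAs ((homFunctor Z).rightDerived n).Additive

lemma extPost_add (Z : PMod R) {A B : DMod R} (f g : A ⟶ B) (n : ℕ) :
    extPost Z (f + g) n = extPost Z f n + extPost Z g n := by
  unfold extPost
  rw [Functor.map_add]
  rfl

lemma extPost_zero (Z : PMod R) (A B : DMod R) (n : ℕ) :
    extPost Z (0 : A ⟶ B) n = 0 := by
  unfold extPost
  rw [Functor.map_zero]
  rfl

lemma extPre_id (Z : PMod R) (A : DMod R) (n : ℕ) : extPre (𝟙 Z) A n = AddMonoidHom.id _ := by
  have h : homPrecomp (𝟙 Z) = 𝟙 (homFunctor Z) := rfl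
  unfold extPre
  rw [h, NatTrans.rightDerived_id]
  rfl

lemma extPre_comp {Z Z' Z'' : PMod R} (f : Z'' ⟶ Z') (g : Z' ⟶ Z) (A : DMod R) (n : ℕ) :
    extPre (f ≫ g) A n = (extPre f A n).comp (extPre g A n) := by
  have h : homPrecomp (f ≫ g) = homPrecomp g ≫ homPrecomp f := rfl
  unfold extPre
  rw [h, NatTrans.rightDerived_comp]
  rfl

lemma extPost_extPre {Z' Z : PMod R} (ζ : Z' ⟶ Z) {A B : DMod R} (φ : A ⟶ B) (n : ℕ)
    (a : ExtR Z A n) :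
    extPost Z' φ n (extPre ζ A n a) = extPre ζ B n (extPost Z φ n a) :=
  (ConcreteCategory.congr_hom ((NatTrans.rightDerived (homPrecomp ζ) n).naturality φ) a).symm

section First

variable (Z : PMod R) {S S' : ShortComplex (DMod R)} (hS : S.ShortExact) (hS' : S'.ShortExact)

lemma extPost_extDelta (φ : S ⟶ S') (n : ℕ) (t : ExtR Z S.X₃ n) :
    extPost Z φ.τ₁ (n + 1) (extDelta Z hS n t) = extDelta Z hS' n (extPost Z φ.τ₃ n t) :=
  -- By unfolding, `extDelta` is `ResolvedSequence.delta` of the chosen resolved sequence.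
  ConcreteCategory.congr_hom (ResolvedSequence.delta_naturality (homFunctor Z) hS
    (Horseshoe.exists_resolvedSequence hS).some (Horseshoe.exists_resolvedSequence hS').some φ n) t

include hS in
lemma extPost_exact (n : ℕ) : Function.Exact (extPost Z S.f n) (extPost Z S.g n) :=
  (ShortComplex.ab_exact_iff_function_exact _).1
    ((Horseshoe.exists_resolvedSequence hS).some.exact₂ (homFunctor Z) n)

lemma extPost_extDelta_exact (n : ℕ) : Function.Exact (extPost Z S.g n) (extDelta Z hS n) :=
  (ShortComplex.ab_exact_iff_function_exact _).1
    ((Horseshoe.exists_resolvedSequence hS).some.exact₃ (homFunctor Z) n).2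

lemma extDelta_extPost_exact (n : ℕ) : Function.Exact (extDelta Z hS n) (extPost Z S.f (n + 1)) :=
  (ShortComplex.ab_exact_iff_function_exact _).1
    ((Horseshoe.exists_resolvedSequence hS).some.exact₁ (homFunctor Z) n).2

include hS in
lemma extPost_zero_injective : Function.Injective (extPost Z S.f 0) :=
  (AddCommGrpCat.mono_iff_injective _).1
    ((Horseshoe.exists_resolvedSequence hS).some.mono_map_zero (homFunctor Z))

end First

section Second

variable [CompactSpace R] {Z' Z Z'' : PMod R} {i : Z' ⟶ Z} {q : Z ⟶ Z''}
  (h : PMod.IsShortExact i q)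

/-- One injective resolution of `A` serves both sequences, so the squares commute already on the
level of complexes. -/
lemma extPre_extDeltaPre {W' W W'' : PMod R} {j : W' ⟶ W} {p : W ⟶ W''}
    (k : PMod.IsShortExact j p) (a : W'' ⟶ Z'') (b : W ⟶ Z) (c : W' ⟶ Z')
    (hc : j ≫ b = c ≫ i) (ha : p ≫ a = b ≫ q) (A : DMod R) (n : ℕ) (t : ExtR Z' A n) :
    extPre a A (n + 1) (extDeltaPre h A n t) = extDeltaPre k A n (extPre c A n t) := by
  let I := injectiveResolution A
  let Ψ : h.complexes I.cocomplex ⟶ k.complexes I.cocomplex :=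
    { τ₁ := (NatTrans.mapHomologicalComplex (homPrecomp a) _).app I.cocomplex
      τ₂ := (NatTrans.mapHomologicalComplex (homPrecomp b) _).app I.cocomplex
      τ₃ := (NatTrans.mapHomologicalComplex (homPrecomp c) _).app I.cocomplex
      comm₁₂ := by
        have e : homPrecomp a ≫ homPrecomp p = homPrecomp q ≫ homPrecomp b := by
          change homPrecomp (p ≫ a) = homPrecomp (b ≫ q)
          rw [ha]
        ext m : 1
        exact congr_app e (I.cocomplex.X m)
      comm₂₃ := by
        have e : homPrecomp b ≫ homPrecomp j = homPrecomp i ≫ homPrecomp c := by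
          change homPrecomp (j ≫ b) = homPrecomp (c ≫ i)
          rw [hc]
        ext m : 1
        exact congr_app e (I.cocomplex.X m) }
  exact ConcreteCategory.congr_hom (conjDelta_naturality (h.complexes_shortExact I)
    (k.complexes_shortExact I) _ _ _ _ Ψ _ _
    (I.derivedIso_hom_nat (homFunctor Z'') (homPrecomp a) (n + 1))
    (I.derivedIso_hom_nat (homFunctor Z') (homPrecomp c) n)) t

/-- A chain map lifting `φ` commutes strictly with precomposition, hence is a morphism of the
sequences of complexes. Applied to the evaluations `𝒜.ev x`, this compares connecting homomorphisms
in `Z` with those in the fibres. -/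
lemma extPost_extDeltaPre {A B : DMod R} (φ : A ⟶ B) (n : ℕ) (t : ExtR Z' A n) :
    extPost Z'' φ (n + 1) (extDeltaPre h A n t) = extDeltaPre h B n (extPost Z' φ n t) := by
  let I := injectiveResolution A
  let J := injectiveResolution B
  let d := InjectiveResolution.desc φ J I
  have hd := InjectiveResolution.desc_commutes φ J I
  let Ψ : h.complexes I.cocomplex ⟶ h.complexes J.cocomplex :=
    { τ₁ := ((homFunctor Z'').mapHomologicalComplex _).map d
      τ₂ := ((homFunctor Z).mapHomologicalComplex _).map d
      τ₃ := ((homFunctor Z').mapHomologicalComplex _).map d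
      comm₁₂ := (NatTrans.mapHomologicalComplex (homPrecomp q) _).naturality d
      comm₂₃ := (NatTrans.mapHomologicalComplex (homPrecomp i) _).naturality d }
  exact ConcreteCategory.congr_hom (conjDelta_naturality (h.complexes_shortExact I)
    (h.complexes_shortExact J) _ _ _ _ Ψ _ _
    (InjectiveResolution.derivedIso_hom_naturality (homFunctor Z'') φ I J d hd (n + 1))
    (InjectiveResolution.derivedIso_hom_naturality (homFunctor Z') φ I J d hd n)) t

include h in
lemma extPre_exact (A : DMod R) (n : ℕ) : Function.Exact (extPre q A n) (extPre i A n) := by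
  let I := injectiveResolution A
  refine (ShortComplex.ab_exact_iff_function_exact (ShortComplex.mk
    ((NatTrans.rightDerived (homPrecomp q) n).app A)
    ((NatTrans.rightDerived (homPrecomp i) n).app A) ?_)).1 ?_
  · rw [← cancel_mono (I.derivedIso (homFunctor Z') n).hom, Category.assoc,
      I.derivedIso_hom_nat (homFunctor Z), ← Category.assoc,
      I.derivedIso_hom_nat (homFunctor Z''), Category.assoc,
      ← HomologicalComplex.homologyMap_comp]
    have h0 : (NatTrans.mapHomologicalComplex (homPrecomp q) (ComplexShape.up ℕ)).app I.cocomplex ≫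
      (NatTrans.mapHomologicalComplex (homPrecomp i) (ComplexShape.up ℕ)).app I.cocomplex = 0 :=
      (h.complexes I.cocomplex).zero
    rw [h0, HomologicalComplex.homologyMap_zero, comp_zero, zero_comp]
  · exact ShortComplex.exact_of_iso (ShortComplex.isoMk (I.derivedIso (homFunctor Z'') n)
      (I.derivedIso (homFunctor Z) n) (I.derivedIso (homFunctor Z') n)
      (I.derivedIso_hom_nat _ _ n).symm (I.derivedIso_hom_nat _ _ n).symm).symm
      ((h.complexes_shortExact I).homology_exact₂ n)

lemma extPre_extDeltaPre_exact (A : DMod R) (n : ℕ) :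
    Function.Exact (extPre i A n) (extDeltaPre h A n) :=
  (ShortComplex.ab_exact_iff_function_exact _).1
    (conjDelta_exact₃ (h.complexes_shortExact (injectiveResolution A)) _ _
      ((injectiveResolution A).derivedIso_hom_nat (homFunctor Z) (homPrecomp i) n))

lemma extDeltaPre_extPre_exact (A : DMod R) (n : ℕ) :
    Function.Exact (extDeltaPre h A n) (extPre q A (n + 1)) :=
  (ShortComplex.ab_exact_iff_function_exact _).1
    (conjDelta_exact₁ (h.complexes_shortExact (injectiveResolution A)) _ _
      ((injectiveResolution A).derivedIso_hom_nat (homFunctor Z'') (homPrecomp q) (n + 1)))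

include h in
lemma extPre_zero_injective (A : DMod R) : Function.Injective (extPre q A 0) := by
  let I := injectiveResolution A
  have h0 : Mono (((NatTrans.mapHomologicalComplex (homPrecomp q)
      (ComplexShape.up ℕ)).app I.cocomplex).f 0) :=
    (h.hom_shortExact (I.cocomplex.X 0)).mono_f
  have := CochainComplex.mono_homologyMap_zero
    ((NatTrans.mapHomologicalComplex (homPrecomp q) (ComplexShape.up ℕ)).app I.cocomplex)
  have h1 : Mono ((NatTrans.rightDerived (homPrecomp q) 0).app A ≫
      (I.derivedIso (homFunctor Z) 0).hom) := by
    rw [I.derivedIso_hom_nat (homFunctor Z'')]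
    infer_instance
  exact (AddCommGrpCat.mono_iff_injective _).1 (mono_of_mono _ (I.derivedIso (homFunctor Z) 0).hom)

end Second

end ExtSequences

/-! ### Filtered colimits of abelian groups in terms of elements. -/

section ElementwiseColimit

universe v w v' w'

variable {J : Type w} [Category.{v} J] {C : Type w'} [Category.{v'} C] {F : J ⥤ C}

/-- The functor `G` takes the cocone `c` to a filtered colimit of abelian groups, in terms of
elements. -/
structure IsElemColim (c : Cocone F) (G : C ⥤ AddCommGrpCat.{u}) : Prop where
  exists_rep : ∀ a : G.obj c.pt, ∃ (j : J) (m : G.obj (F.obj j)), G.map (c.ι.app j) m = a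
  exists_map_eq_zero : ∀ (j : J) (m : G.obj (F.obj j)), G.map (c.ι.app j) m = 0 →
    ∃ (k : J) (f : j ⟶ k), G.map (F.map f) m = 0

lemma CategoryTheory.Limits.Cocone.map_w_apply (c : Cocone F) (G : C ⥤ AddCommGrpCat.{u}) {j k : J} (f : j ⟶ k)
    (m : G.obj (F.obj j)) : G.map (c.ι.app k) (G.map (F.map f) m) = G.map (c.ι.app j) m := by
  rw [← c.w f, G.map_comp]
  rfl

lemma map_map_apply (F : J ⥤ C) (G : C ⥤ AddCommGrpCat.{u}) {j k l : J} (f : j ⟶ k) (g : k ⟶ l)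
    (m : G.obj (F.obj j)) : G.map (F.map g) (G.map (F.map f) m) = G.map (F.map (f ≫ g)) m := by
  rw [F.map_comp, G.map_comp]
  rfl

namespace IsElemColim

variable {c : Cocone F} {G : C ⥤ AddCommGrpCat.{u}} [IsFiltered J] (h : IsElemColim c G)

include h

/-- By filteredness finitely many elements are represented at a common stage. The lift `σ` is only a
map of sets, and its values outside `S` play no role. -/
lemma exists_rep_finite {S : Set (G.obj c.pt)} (hS : S.Finite) :
    ∃ (j : J) (σ : G.obj c.pt → G.obj (F.obj j)), ∀ a ∈ S, G.map (c.ι.app j) (σ a) = a := by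
  classical
  induction S, hS using Set.Finite.induction_on with
  | empty =>
    exact ⟨IsFiltered.nonempty.some, fun _ => 0, by simp⟩
  | @insert a S _ _ ih =>
    obtain ⟨j, σ, hσ⟩ := ih
    obtain ⟨k, m, hm⟩ := h.exists_rep a
    refine ⟨IsFiltered.max j k, fun b => if b = a then
      G.map (F.map (IsFiltered.rightToMax j k)) m else
      G.map (F.map (IsFiltered.leftToMax j k)) (σ b), fun b hb => ?_⟩
    by_cases hba : b = a
    · dsimp only
      rw [if_pos hba, c.map_w_apply, hm, hba]
    · dsimp only
      rw [if_neg hba, c.map_w_apply, hσ b (hb.resolve_left hba)]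

lemma exists_map_eq_zero_finite {j : J} {S : Set (G.obj (F.obj j))} (hS : S.Finite)
    (h0 : ∀ m ∈ S, G.map (c.ι.app j) m = 0) :
    ∃ (k : J) (f : j ⟶ k), ∀ m ∈ S, G.map (F.map f) m = 0 := by
  induction S, hS using Set.Finite.induction_on with
  | empty => exact ⟨j, 𝟙 j, by simp⟩
  | @insert a S _ _ ih =>
    obtain ⟨k, f, hf⟩ := ih fun m hm => h0 m (Set.mem_insert_of_mem _ hm)
    obtain ⟨l, g, hg⟩ := h.exists_map_eq_zero k (G.map (F.map f) a) (by
      rw [c.map_w_apply]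
      exact h0 a (Set.mem_insert _ _))
    refine ⟨l, f ≫ g, ?_⟩
    rintro m (rfl | hm)
    · rw [← map_map_apply, hg]
    · rw [← map_map_apply, hf m hm, map_zero]

variable {Z : Type*} [TopologicalSpace Z] [CompactSpace Z]

lemma exists_map_eq_zero_of_locallyConstant {j : J} {g : Z → G.obj (F.obj j)}
    (hg : IsLocallyConstant g) (h0 : ∀ z, G.map (c.ι.app j) (g z) = 0) :
    ∃ (k : J) (f : j ⟶ k), ∀ z, G.map (F.map f) (g z) = 0 := by
  obtain ⟨k, f, hf⟩ := h.exists_map_eq_zero_finite hg.range_finite (by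
    rintro _ ⟨z, rfl⟩
    exact h0 z)
  exact ⟨k, f, fun z => hf _ ⟨z, rfl⟩⟩

/-- The map `f` has finite image, so its values lift to one stage. The lift is additive as soon as
finitely many relations hold, one for each pair of values; they hold in the colimit, hence at a
later stage. -/
lemma exists_lift_addMonoidHom [AddCommGroup Z] (f : Z →+ G.obj c.pt) (hf : IsLocallyConstant f) :
    ∃ (j : J) (g : Z →+ G.obj (F.obj j)), IsLocallyConstant g ∧
      ∀ z, G.map (c.ι.app j) (g z) = f z := by
  obtain ⟨j, σ, hσ⟩ := h.exists_rep_finite hf.range_finite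
  -- The defects of additivity of `σ` on the image of `f`.
  let T : Set (G.obj (F.obj j)) :=
    (fun p : G.obj c.pt × G.obj c.pt => σ (p.1 + p.2) - σ p.1 - σ p.2) ''
      (Set.range f ×ˢ Set.range f)
  have hT : T.Finite := (hf.range_finite.prod hf.range_finite).image _
  obtain ⟨k, φ, hφ⟩ := h.exists_map_eq_zero_finite hT (by
    rintro _ ⟨⟨_, _⟩, ⟨⟨a, rfl⟩, ⟨b, rfl⟩⟩, rfl⟩
    simp only [map_sub]
    rw [hσ _ ⟨a, rfl⟩, hσ _ ⟨b, rfl⟩, ← map_add, hσ _ ⟨a + b, rfl⟩, map_add,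
      add_sub_cancel_left, sub_self])
  refine ⟨k, AddMonoidHom.mk' (fun z => G.map (F.map φ) (σ (f z))) fun a b => ?_,
    hf.comp fun x => G.map (F.map φ) (σ x), fun z => ?_⟩
  · have h1 := hφ _ ⟨(f a, f b), ⟨⟨a, rfl⟩, ⟨b, rfl⟩⟩, rfl⟩
    simp only [map_sub] at h1
    rw [map_add f]
    rw [sub_sub, sub_eq_zero] at h1
    exact h1
  · exact (c.map_w_apply G φ _).trans (hσ _ ⟨z, rfl⟩)

section Quotient

variable {P Q : C ⥤ AddCommGrpCat.{u}}

/-- The elements of the colimit that are represented by elements in the kernel of `π`. -/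
def repKer (c : Cocone F) (π : P ⟶ Q) : AddSubgroup (P.obj c.pt) where
  carrier := {x | ∃ (j : J) (y : P.obj (F.obj j)), π.app _ y = 0 ∧ P.map (c.ι.app j) y = x}
  zero_mem' := ⟨IsFiltered.nonempty.some, 0, map_zero _, map_zero _⟩
  add_mem' := by
    rintro _ _ ⟨j, x, hx, rfl⟩ ⟨k, y, hy, rfl⟩
    refine ⟨IsFiltered.max j k, P.map (F.map (IsFiltered.leftToMax j k)) x +
      P.map (F.map (IsFiltered.rightToMax j k)) y, ?_, ?_⟩
    · have h1 := ConcreteCategory.congr_hom (π.naturality (F.map (IsFiltered.leftToMax j k))) x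
      have h2 := ConcreteCategory.congr_hom (π.naturality (F.map (IsFiltered.rightToMax j k))) y
      simp only [ConcreteCategory.comp_apply] at h1 h2
      rw [map_add, h1, h2, hx, hy, map_zero, map_zero, add_zero]
    · rw [map_add, c.map_w_apply, c.map_w_apply]
  neg_mem' := by
    rintro _ ⟨j, x, hx, rfl⟩
    exact ⟨j, -x, by rw [map_neg, hx, neg_zero], map_neg _ _⟩

omit h in
-- Commutation with the colimit passes to a quotient functor when the kernel in the colimit comes
-- from kernels at the stages. It is used for divisible hulls, cokernels of the embeddings into
-- injectives, isomorphic functors and the induction step for Ext.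
lemma of_surjective (hP : IsElemColim c P) (π : P ⟶ Q)
    (hπ : ∀ A, Function.Surjective (π.app A))
    (hker : ∀ x : P.obj c.pt, π.app _ x = 0 → x ∈ repKer c π) : IsElemColim c Q where
  exists_rep a := by
    obtain ⟨x, rfl⟩ := hπ _ a
    obtain ⟨j, y, rfl⟩ := hP.exists_rep x
    exact ⟨j, π.app _ y, (ConcreteCategory.congr_hom (π.naturality (c.ι.app j)) y).symm⟩
  exists_map_eq_zero j m hm := by
    obtain ⟨x, rfl⟩ := hπ _ m
    have hx : π.app _ (P.map (c.ι.app j) x) = 0 :=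
      (ConcreteCategory.congr_hom (π.naturality (c.ι.app j)) x).trans hm
    obtain ⟨k, y, hy, hyx⟩ := hker _ hx
    -- Since `x` and `y` have the same image in the colimit, they agree at a later stage `p`, where
    -- the image of `y` in `Q` is zero.
    obtain ⟨p, f, hf⟩ := hP.exists_map_eq_zero (IsFiltered.max j k)
      (P.map (F.map (IsFiltered.leftToMax j k)) x - P.map (F.map (IsFiltered.rightToMax j k)) y)
      (by rw [map_sub, c.map_w_apply, c.map_w_apply, hyx, sub_self])
    rw [map_sub, map_map_apply, map_map_apply, sub_eq_zero] at hf
    refine ⟨p, IsFiltered.leftToMax j k ≫ f, ?_⟩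
    have h1 := ConcreteCategory.congr_hom (π.naturality (F.map (IsFiltered.leftToMax j k ≫ f))) x
    have h2 := ConcreteCategory.congr_hom (π.naturality (F.map (IsFiltered.rightToMax j k ≫ f))) y
    simp only [ConcreteCategory.comp_apply] at h1 h2
    rw [← h1, hf, h2, hy, map_zero]

end Quotient

end IsElemColim

end ElementwiseColimit

/-! ### A functorial embedding into divisible groups that commutes with filtered colimits. -/

section DivisibleEmbedding

/-- The relations defining `DivHull`. -/
noncomputable def divRel (A : Type u) [AddCommGroup A] : AddSubgroup (A →₀ ℚ) :=
  AddSubgroup.closure (Set.range fun p : A × A =>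
    Finsupp.single (p.1 + p.2) (1 : ℚ) - Finsupp.single p.1 1 - Finsupp.single p.2 1)

/-- A functorial divisible group containing the abelian group `A`. -/
abbrev DivHull (A : Type u) [AddCommGroup A] : Type u := (A →₀ ℚ) ⧸ divRel A

namespace DivHull

variable {A B C : Type u} [AddCommGroup A] [AddCommGroup B] [AddCommGroup C]

noncomputable instance : DivisibleBy (A →₀ ℚ) ℤ where
  div x n := (n : ℚ)⁻¹ • x
  div_zero x := by simp
  div_cancel {n} x hn := by
    rw [← Int.cast_smul_eq_zsmul ℚ, smul_smul, mul_inv_cancel₀ (by exact_mod_cast hn), one_smul]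

noncomputable instance : DivisibleBy (DivHull A) ℤ :=
  Function.Surjective.divisibleBy (QuotientAddGroup.mk' (divRel A))
    (QuotientAddGroup.mk'_surjective _) fun x n => map_zsmul (QuotientAddGroup.mk' (divRel A)) n x

/-- The projection from the free `ℚ`-vector space to the divisible hull. -/
noncomputable def mk : (A →₀ ℚ) →+ DivHull A := QuotientAddGroup.mk' (divRel A)

lemma mk_surjective : Function.Surjective (mk : (A →₀ ℚ) →+ DivHull A) :=
  QuotientAddGroup.mk'_surjective _

lemma mk_eq_zero_iff {x : A →₀ ℚ} : mk x = 0 ↔ x ∈ divRel A := QuotientAddGroup.eq_zero_iff _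

/-- The inclusion of a group into its divisible hull. -/
noncomputable def of : A →+ DivHull A :=
  AddMonoidHom.mk' (fun a => QuotientAddGroup.mk (Finsupp.single a 1)) fun a b => by
    rw [← QuotientAddGroup.mk_add, QuotientAddGroup.eq]
    have h : Finsupp.single (a + b) (1 : ℚ) - Finsupp.single a 1 - Finsupp.single b 1 ∈ divRel A :=
      AddSubgroup.subset_closure ⟨(a, b), rfl⟩
    have := neg_mem h
    convert this using 1
    abel

/-- The relations generate only a subgroup, not a `ℚ`-subspace, so torsion of `A` survives. Elements
of `divRel A` have integer coefficients, and evaluating formal sums with integer coefficients in `A`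
kills them; but `single a 1` evaluates to `a`. -/
lemma of_injective : Function.Injective (of : A →+ DivHull A) := by
  rw [injective_iff_map_eq_zero]
  intro a ha
  have h1 : Finsupp.single a (1 : ℚ) ∈ divRel A := (QuotientAddGroup.eq_zero_iff _).1 ha
  let j : (A →₀ ℤ) →+ (A →₀ ℚ) := Finsupp.mapRange.addMonoidHom (Int.castAddHom ℚ)
  have hj : Function.Injective j := Finsupp.mapRange_injective _ (map_zero (Int.castAddHom ℚ)) Int.cast_injective
  let s : (A →₀ ℤ) →+ A := Finsupp.liftAddHom fun a => zmultiplesHom A a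
  have key : ∀ x ∈ divRel A, ∃ y, j y = x ∧ s y = 0 := by
    intro x hx
    induction hx using AddSubgroup.closure_induction with
    | mem x hx =>
      obtain ⟨⟨a, b⟩, rfl⟩ := hx
      exact ⟨Finsupp.single (a + b) 1 - Finsupp.single a 1 - Finsupp.single b 1,
        by
          simp only [map_sub]
          simp [j], by
          simp only [map_sub]
          simp [s]⟩
    | zero => exact ⟨0, by simp, by simp⟩
    | add x y _ _ hx hy =>
      obtain ⟨x', rfl, hx'⟩ := hx
      obtain ⟨y', rfl, hy'⟩ := hy
      exact ⟨x' + y', by simp, by simp [hx', hy']⟩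
    | neg x _ hx =>
      obtain ⟨x', rfl, hx'⟩ := hx
      exact ⟨-x', by simp, by simp [hx']⟩
  obtain ⟨y, hy, hy0⟩ := key _ h1
  have : y = Finsupp.single a 1 := hj (hy.trans (by simp [j]))
  rw [this] at hy0
  simpa [s] using hy0

lemma mapDomain_mem_divRel (f : A →+ B) {x : A →₀ ℚ} (hx : x ∈ divRel A) :
    Finsupp.mapDomain f x ∈ divRel B := by
  have h : divRel A ≤ (divRel B).comap (Finsupp.mapDomain.addMonoidHom f) := by
    rw [divRel, AddSubgroup.closure_le]
    rintro _ ⟨⟨a, b⟩, rfl⟩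
    refine AddSubgroup.subset_closure ⟨(f a, f b), ?_⟩
    simp only [map_sub]
    simp [Finsupp.mapDomain_single]
  exact h hx

/-- The functoriality of the divisible hull. -/
noncomputable def map (f : A →+ B) : DivHull A →+ DivHull B :=
  QuotientAddGroup.map _ _ (Finsupp.mapDomain.addMonoidHom f) fun _ => mapDomain_mem_divRel f

lemma map_mk (f : A →+ B) (x : A →₀ ℚ) :
    map f (QuotientAddGroup.mk x) = QuotientAddGroup.mk (Finsupp.mapDomain f x) := rfl

lemma map_of (f : A →+ B) (a : A) : map f (of a) = of (f a) := by
  change map f (QuotientAddGroup.mk _) = QuotientAddGroup.mk _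
  rw [map_mk, Finsupp.mapDomain_single]

end DivHull

/-- The free `ℚ`-vector space as a functor to abelian groups. -/
noncomputable def freeRatFunctor : AddCommGrpCat.{u} ⥤ AddCommGrpCat.{u} where
  obj A := AddCommGrpCat.of (A →₀ ℚ)
  map f := AddCommGrpCat.ofHom (Finsupp.mapDomain.addMonoidHom f.hom)
  map_id A := AddCommGrpCat.hom_ext (AddMonoidHom.ext fun x => Finsupp.mapDomain_id (v := x))
  map_comp f g := AddCommGrpCat.hom_ext
    (AddMonoidHom.ext fun x => Finsupp.mapDomain_comp (v := x) (f := f.hom) (g := g.hom))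

/-- The divisible hull as a functor. -/
noncomputable def divHullFunctor : AddCommGrpCat.{u} ⥤ AddCommGrpCat.{u} where
  obj A := AddCommGrpCat.of (DivHull A)
  map f := AddCommGrpCat.ofHom (DivHull.map f.hom)
  map_id A := AddCommGrpCat.hom_ext (AddMonoidHom.ext fun x => by
    obtain ⟨x, rfl⟩ := QuotientAddGroup.mk_surjective x
    exact congrArg _ (Finsupp.mapDomain_id (v := x)))
  map_comp f g := AddCommGrpCat.hom_ext (AddMonoidHom.ext fun x => by
    obtain ⟨x, rfl⟩ := QuotientAddGroup.mk_surjective x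
    exact congrArg _ (Finsupp.mapDomain_comp (v := x) (f := f.hom) (g := g.hom)))

section

universe v w v' w'

variable {J : Type w} [Category.{v} J] [IsFiltered J] {C : Type w'} [Category.{v'} C] {F : J ⥤ C}
  {c : Cocone F} {G : C ⥤ AddCommGrpCat.{u}}

/-- The support of `x` is finite, so at some stage any two of its points that become equal in the
colimit are already equal. On the support, the map to that stage then factors through the map to the
colimit, along which the pushforward of `x` vanishes. -/
lemma IsElemColim.exists_mapDomain_eq_zero (h : IsElemColim c G) {j : J}
    (x : G.obj (F.obj j) →₀ ℚ) (hx : Finsupp.mapDomain (G.map (c.ι.app j)) x = 0) :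
    ∃ (k : J) (f : j ⟶ k), Finsupp.mapDomain (G.map (F.map f)) x = 0 := by
  let T : Set (G.obj (F.obj j)) :=
    {m | ∃ a ∈ x.support, ∃ b ∈ x.support, G.map (c.ι.app j) m = 0 ∧ a - b = m}
  have hT : T.Finite := by
    refine ((x.support.finite_toSet.prod x.support.finite_toSet).image
      fun p => p.1 - p.2).subset ?_
    rintro _ ⟨a, ha, b, hb, -, rfl⟩
    exact ⟨(a, b), ⟨ha, hb⟩, rfl⟩
  obtain ⟨k, f, hf⟩ := h.exists_map_eq_zero_finite hT (by
    rintro _ ⟨a, ha, b, hb, hm, rfl⟩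
    exact hm)
  refine ⟨k, f, ?_⟩
  have h1 : ∀ a ∈ x.support, ∀ b ∈ x.support, G.map (c.ι.app j) a = G.map (c.ι.app j) b →
      G.map (F.map f) a = G.map (F.map f) b := by
    intro a ha b hb hab
    have := hf (a - b) ⟨a, ha, b, hb, by rw [map_sub, hab, sub_self], rfl⟩
    rwa [map_sub, sub_eq_zero] at this
  classical
  -- The factorisation is merely a map of sets; it is zero at points that do not come from the
  -- support.
  let g : G.obj c.pt → G.obj (F.obj k) := fun b =>
    if hb : ∃ a ∈ x.support, G.map (c.ι.app j) a = b then G.map (F.map f) hb.choose else 0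
  have hg : ∀ a ∈ x.support, G.map (F.map f) a = (g ∘ G.map (c.ι.app j)) a := by
    intro a ha
    have hb : ∃ a' ∈ x.support, G.map (c.ι.app j) a' = G.map (c.ι.app j) a := ⟨a, ha, rfl⟩
    rw [Function.comp_apply, show g (G.map (c.ι.app j) a) = G.map (F.map f) hb.choose from
      dif_pos hb]
    exact h1 a ha _ hb.choose_spec.1 hb.choose_spec.2.symm
  rw [Finsupp.mapDomain_congr hg, Finsupp.mapDomain_comp, hx, Finsupp.mapDomain_zero]

lemma IsElemColim.freeRat (h : IsElemColim c G) : IsElemColim c (G ⋙ freeRatFunctor) where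
  exists_rep x := by
    let x' : G.obj c.pt →₀ ℚ := x
    obtain ⟨j, σ, hσ⟩ := h.exists_rep_finite x'.support.finite_toSet
    refine ⟨j, Finsupp.mapDomain σ x', ?_⟩
    change Finsupp.mapDomain (G.map (c.ι.app j)) (Finsupp.mapDomain σ x') = x'
    rw [← Finsupp.mapDomain_comp]
    conv_rhs => rw [← Finsupp.mapDomain_id (v := x')]
    exact Finsupp.mapDomain_congr fun a ha => hσ a ha
  exists_map_eq_zero _ x hx := h.exists_mapDomain_eq_zero x hx

/-- The projection `DivHull.mk` as a natural transformation. -/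
noncomputable def freeRatToDivHull : freeRatFunctor.{u} ⟶ divHullFunctor where
  app A := AddCommGrpCat.ofHom DivHull.mk

/-- Each generator of `divRel` in the colimit involves only two free elements, so it comes from a
generator at a stage. -/
lemma IsElemColim.divHull (h : IsElemColim c G) : IsElemColim c (G ⋙ divHullFunctor) := by
  refine h.freeRat.of_surjective (Functor.whiskerLeft G freeRatToDivHull)
    (fun A => DivHull.mk_surjective (A := G.obj A)) fun x hx => ?_
  have hx' : x ∈ divRel (G.obj c.pt) := DivHull.mk_eq_zero_iff.1 hx
  let K : AddSubgroup (G.obj c.pt →₀ ℚ) :=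
    IsElemColim.repKer c (Functor.whiskerLeft G freeRatToDivHull)
  have hle : divRel (G.obj c.pt) ≤ K := by
    refine (AddSubgroup.closure_le K).2 ?_
    rintro _ ⟨⟨a, b⟩, rfl⟩
    obtain ⟨j, σ, hσ⟩ := h.exists_rep_finite (S := {a, b}) (by simp)
    -- The first term uses `σ a + σ b` and not a lift of `a + b`, so that the lifted element is
    -- itself a defining relation.
    refine ⟨j, (Finsupp.single (σ a + σ b) 1 - Finsupp.single (σ a) 1 -
      Finsupp.single (σ b) 1 : G.obj (F.obj j) →₀ ℚ), DivHull.mk_eq_zero_iff.2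
      (AddSubgroup.subset_closure ⟨(σ a, σ b), rfl⟩), ?_⟩
    change Finsupp.mapDomain.addMonoidHom (G.map (c.ι.app j)) (Finsupp.single (σ a + σ b) (1 : ℚ) -
      Finsupp.single (σ a) 1 - Finsupp.single (σ b) 1) = _
    rw [map_sub, map_sub]
    change Finsupp.mapDomain _ _ - Finsupp.mapDomain _ _ - Finsupp.mapDomain _ _ = _
    rw [Finsupp.mapDomain_single, Finsupp.mapDomain_single, Finsupp.mapDomain_single, map_add,
      hσ a (by simp), hσ b (by simp)]
  exact hle hx'

end

end DivisibleEmbedding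

/-! ### Coinduced discrete modules. -/

section Coinduced

variable (R : Type u) [Ring R] [TopologicalSpace R]

/-- The coinduced module: locally constant additive maps from `R` to the abelian group `D`. -/
def Coind (D : Type u) [AddCommGroup D] : AddSubgroup (R →+ D) where
  carrier := {f | IsLocallyConstant f}
  zero_mem' := IsLocallyConstant.const (0 : D)
  add_mem' hf hg := IsLocallyConstant.add hf hg
  neg_mem' hf := IsLocallyConstant.neg hf

variable {R} {D D' : Type u} [AddCommGroup D] [AddCommGroup D']

lemma Coind.ext {f g : Coind R D} (h : ∀ r, f.1 r = g.1 r) : f = g :=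
  Subtype.ext (AddMonoidHom.ext h)

variable [IsTopologicalRing R]

instance : Module Rᵐᵒᵖ (Coind R D) where
  smul r f := ⟨f.1.comp (AddMonoidHom.mulLeft r.unop),
    f.2.comp_continuous (continuous_const_mul r.unop)⟩
  one_smul f := Coind.ext fun s => congrArg f.1 (one_mul s)
  mul_smul r r' f := Coind.ext fun s => congrArg f.1 (mul_assoc r'.unop r.unop s)
  smul_zero r := rfl
  smul_add r f g := rfl
  add_smul r r' f := Coind.ext fun s =>
    (congrArg f.1 (add_mul r.unop r'.unop s)).trans (map_add f.1 _ _)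
  zero_smul f := Coind.ext fun s => (congrArg f.1 (zero_mul s)).trans (map_zero f.1)

lemma Coind.smul_apply (r : Rᵐᵒᵖ) (f : Coind R D) (s : R) : (r • f).1 s = f.1 (r.unop * s) := rfl

/-- The functoriality of coinduced modules. -/
def Coind.map (g : D →+ D') : Coind R D →ₗ[Rᵐᵒᵖ] Coind R D' where
  toFun f := ⟨g.comp f.1, f.2.comp g⟩
  map_add' f f' := Coind.ext fun s => map_add g _ _
  map_smul' r f := rfl

lemma isLocallyConstant_smul {M : ModuleCat.{u} Rᵐᵒᵖ} (hM : IsDiscreteMod R M) (m : M) :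
    IsLocallyConstant fun r : R => op r • m := by
  let _ : TopologicalSpace M := ⊥
  have : DiscreteTopology M := ⟨rfl⟩
  have : ContinuousSMul Rᵐᵒᵖ M := hM
  refine (IsLocallyConstant.iff_continuous _).2 ?_
  fun_prop

/-- The homomorphism to a coinduced module that corresponds to an additive map. -/
def Coind.lift {M : ModuleCat.{u} Rᵐᵒᵖ} (hM : IsDiscreteMod R M) (g : M →+ D) :
    M →ₗ[Rᵐᵒᵖ] Coind R D where
  toFun m := ⟨AddMonoidHom.mk' (fun r => g (op r • m)) fun r s => by
    rw [MulOpposite.op_add, add_smul, map_add], (isLocallyConstant_smul hM m).comp g⟩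
  map_add' m m' := Coind.ext fun r => (congrArg g (smul_add (op r) m m')).trans (map_add g _ _)
  map_smul' s m := Coind.ext fun r => congrArg g (by rw [← mul_smul]; rfl)

lemma Coind.lift_apply {M : ModuleCat.{u} Rᵐᵒᵖ} (hM : IsDiscreteMod R M) (g : M →+ D) (m : M)
    (r : R) : (Coind.lift hM g m).1 r = g (op r • m) := rfl

variable [CompactSpace R]

/-- An element `r` fails to annihilate `f` exactly when `f (r * s) ≠ 0` for some `s`. Such `r` form
the projection along the compact space `R` of a closed set, hence a closed set. -/
lemma isDiscreteMod_coind (D : Type u) [AddCommGroup D] :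
    IsDiscreteMod R (ModuleCat.of Rᵐᵒᵖ (Coind R D)) := by
  refine .of_isOpen_ann fun f => ?_
  have hc : Continuous fun p : Rᵐᵒᵖ × R => p.1.unop * p.2 := by fun_prop
  have hcl := isClosedMap_fst_of_compactSpace (Y := R) _
    ((f.2.isOpen_fiber 0).preimage hc).isClosed_compl
  convert hcl.isOpen_compl using 1
  ext r
  simp only [Set.mem_compl_iff, Set.mem_image, Set.mem_preimage]
  constructor
  · rintro hr ⟨⟨r', s⟩, hs, rfl⟩
    exact hs (DFunLike.congr_fun (congrArg Subtype.val hr) s)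
  · intro h
    refine Coind.ext fun s => ?_
    by_contra hs
    exact h ⟨(r, s), hs, rfl⟩

/-- The coinduced module as a discrete module. -/
def coindObj (D : Type u) [AddCommGroup D] : DMod R :=
  ⟨ModuleCat.of Rᵐᵒᵖ (Coind R D), isDiscreteMod_coind D⟩

/-- Coinduction is right adjoint to the forgetful functor to abelian groups, which preserves
monomorphisms, and a divisible group is injective. The additive map that corresponds to `f` is `m ↦
f m 1`. -/
instance [DivisibleBy D ℤ] : Injective (coindObj (R := R) D) where
  factors {M N} f g hg := by
    have hg' : Function.Injective g.hom.hom :=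
      (ModuleCat.mono_iff_injective g.hom).1 (inferInstanceAs (Mono ((IsDiscreteMod R).ι.map g)))
    let f' : M.obj →ₗ[Rᵐᵒᵖ] Coind R D := f.hom.hom
    let e : M.obj →+ D := AddMonoidHom.mk' (fun m => (f' m).1 1) fun m m' => by
      rw [map_add]
      rfl
    let a : AddCommGrpCat.of M.obj ⟶ AddCommGrpCat.of N.obj :=
      AddCommGrpCat.ofHom g.hom.hom.toAddMonoidHom
    have ha : Mono a := (AddCommGrpCat.mono_iff_injective a).2 hg'
    let e' : N.obj →+ D := (Injective.factorThru (J := AddCommGrpCat.of D)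
      (AddCommGrpCat.ofHom e) a).hom
    have he : ∀ m, e' (g.hom.hom m) = e m := fun m =>
      ConcreteCategory.congr_hom (Injective.comp_factorThru (J := AddCommGrpCat.of D)
        (AddCommGrpCat.ofHom e) a) m
    refine ⟨ObjectProperty.homMk (ModuleCat.ofHom (Coind.lift N.property e')), ?_⟩
    ext m
    refine Coind.ext fun r => ?_
    change e' (op r • g.hom.hom m) = (f' m).1 r
    rw [← map_smul, he]
    change (f' (op r • m)).1 1 = _
    rw [map_smul, Coind.smul_apply, unop_op, mul_one]

end Coinduced

/-! ### The functorial short exact sequence with injective middle term and its filtered colimits. -/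

section InjectiveEmbedding

variable (R : Type u) [Ring R] [TopologicalSpace R] [IsTopologicalRing R]

/-- The underlying abelian group of a discrete module. -/
def toAb : DMod R ⥤ AddCommGrpCat.{u} where
  obj A := AddCommGrpCat.of A.obj
  map f := AddCommGrpCat.ofHom f.hom.hom.toAddMonoidHom

variable [CompactSpace R]

/-- A functor to injective discrete modules. -/
noncomputable def injFunctor : DMod R ⥤ DMod R where
  obj A := coindObj (DivHull A.obj)
  map f := ObjectProperty.homMk (ModuleCat.ofHom (Coind.map (DivHull.map f.hom.hom.toAddMonoidHom)))
  map_id A := by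
    ext f
    exact Coind.ext fun r =>
      ConcreteCategory.congr_hom (divHullFunctor.map_id ((toAb R).obj A)) (f.1 r)
  map_comp {A B C} g h := by
    ext f
    exact Coind.ext fun r => ConcreteCategory.congr_hom
      (divHullFunctor.map_comp ((toAb R).map g) ((toAb R).map h)) (f.1 r)

instance (A : DMod R) : Injective ((injFunctor R).obj A) :=
  inferInstanceAs (Injective (coindObj (DivHull A.obj)))

/-- The natural embedding of a discrete module into an injective one. -/
noncomputable def toInjFunctor : 𝟭 (DMod R) ⟶ injFunctor R where
  app A := ObjectProperty.homMk (ModuleCat.ofHom (Coind.lift A.property DivHull.of))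
  naturality {A B} f := by
    ext a
    refine Coind.ext fun r => ?_
    change DivHull.of (op r • f.hom.hom a) =
      DivHull.map f.hom.hom.toAddMonoidHom (DivHull.of (op r • a))
    rw [DivHull.map_of, ← map_smul]
    rfl

lemma toInjFunctor_injective (A : DMod R) :
    Function.Injective ((toInjFunctor R).app A).hom.hom := by
  intro a b hab
  have h1 : (Coind.lift A.property DivHull.of a).1 1 = (Coind.lift A.property DivHull.of b).1 1 :=
    DFunLike.congr_fun (congrArg Subtype.val hab) 1
  rw [Coind.lift_apply, Coind.lift_apply, op_one, one_smul, one_smul] at h1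
  exact DivHull.of_injective h1

/-- The cokernel of `toInjFunctor`. -/
noncomputable def injCoker : DMod R ⥤ DMod R where
  obj A := ⟨ModuleCat.of Rᵐᵒᵖ
    (((injFunctor R).obj A).obj ⧸ LinearMap.range ((toInjFunctor R).app A).hom.hom),
    ObjectProperty.prop_of_epi (IsDiscreteMod R)
      (ModuleCat.ofHom (Submodule.mkQ (LinearMap.range ((toInjFunctor R).app A).hom.hom)))
      ((injFunctor R).obj A).property⟩
  map {A B} f := ObjectProperty.homMk (ModuleCat.ofHom (Submodule.mapQ _ _
    ((injFunctor R).map f).hom.hom (by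
      rintro _ ⟨a, rfl⟩
      exact ⟨f.hom.hom a, ConcreteCategory.congr_hom ((toInjFunctor R).naturality f) a⟩)))
  map_id A := by
    ext x
    exact congrArg (Submodule.mkQ _) (ConcreteCategory.congr_hom ((injFunctor R).map_id A) x)
  map_comp {A B C} g h := by
    ext x
    exact congrArg (Submodule.mkQ _) (ConcreteCategory.congr_hom ((injFunctor R).map_comp g h) x)

/-- The projection to the cokernel of `toInjFunctor`. -/
noncomputable def toInjCoker : injFunctor R ⟶ injCoker R where
  app A := ObjectProperty.homMk (ModuleCat.ofHom
    (Submodule.mkQ (LinearMap.range ((toInjFunctor R).app A).hom.hom)))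

variable {R} in
lemma toInjCoker_surjective (A : DMod R) :
    Function.Surjective ((toInjCoker R).app A).hom.hom :=
  Submodule.mkQ_surjective (LinearMap.range ((toInjFunctor R).app A).hom.hom)

variable {R} in
lemma toInj_exact (A : DMod R) :
    Function.Exact ((toInjFunctor R).app A).hom.hom ((toInjCoker R).app A).hom.hom :=
  fun _ => Submodule.Quotient.mk_eq_zero (LinearMap.range ((toInjFunctor R).app A).hom.hom)

/-- The functorial short exact sequence `0 → A → I → I / A → 0` with `I` injective. -/
noncomputable def injSeq (A : DMod R) : ShortComplex (DMod R) where
  X₁ := A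
  X₂ := (injFunctor R).obj A
  X₃ := (injCoker R).obj A
  f := (toInjFunctor R).app A
  g := (toInjCoker R).app A
  zero := by
    ext a
    exact (toInj_exact A).apply_apply_eq_zero a

lemma injSeq_shortExact (A : DMod R) : (injSeq R A).ShortExact :=
  DMod.shortExact_of (toInjFunctor_injective R A) (toInj_exact A) (toInjCoker_surjective A)

/-- The functoriality of `injSeq`. -/
noncomputable def injSeqMap {A B : DMod R} (f : A ⟶ B) : injSeq R A ⟶ injSeq R B where
  τ₁ := f
  τ₂ := (injFunctor R).map f
  τ₃ := (injCoker R).map f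
  comm₁₂ := (toInjFunctor R).naturality f
  comm₂₃ := (toInjCoker R).naturality f

section

universe v w

variable {R} {J : Type w} [Category.{v} J] [IsFiltered J] {F : J ⥤ DMod R} {c : Cocone F}

/-- Elements of the coinduced module are locally constant on the compact ring `R`, so they lift, and
vanish, at a stage of the colimit of divisible hulls. -/
lemma IsElemColim.comp_injFunctor (h : IsElemColim c (toAb R)) :
    IsElemColim c (injFunctor R ⋙ toAb R) where
  exists_rep f := by
    let f' : Coind R (DivHull c.pt.obj) := f
    obtain ⟨j, g, hg, hgf⟩ := h.divHull.exists_lift_addMonoidHom f'.1 f'.2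
    exact ⟨j, (⟨g, hg⟩ : Coind R (DivHull (F.obj j).obj)), Coind.ext hgf⟩
  exists_map_eq_zero j m hm := by
    let m' : Coind R (DivHull (F.obj j).obj) := m
    obtain ⟨k, f, hf⟩ := h.divHull.exists_map_eq_zero_of_locallyConstant m'.2
      fun r => DFunLike.congr_fun (congrArg Subtype.val hm) r
    exact ⟨k, f, Coind.ext hf⟩

lemma IsElemColim.comp_injCoker (h : IsElemColim c (toAb R)) :
    IsElemColim c (injCoker R ⋙ toAb R) := by
  have hker : ∀ x : (injFunctor R ⋙ toAb R).obj c.pt,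
      (Functor.whiskerRight (toInjCoker R) (toAb R)).app c.pt x = 0 →
      x ∈ IsElemColim.repKer c (Functor.whiskerRight (toInjCoker R) (toAb R)) := by
    intro x hx
    obtain ⟨a, ha⟩ := (toInj_exact c.pt x).1 hx
    obtain ⟨j, m, hm⟩ := h.exists_rep a
    refine ⟨j, ((toInjFunctor R).app _).hom.hom m, (toInj_exact _).apply_apply_eq_zero m, ?_⟩
    have h1 := ConcreteCategory.congr_hom ((toInjFunctor R).naturality (c.ι.app j)) m
    exact h1.symm.trans ((congrArg ((toInjFunctor R).app c.pt).hom.hom hm).trans ha)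
  exact h.comp_injFunctor.of_surjective (Functor.whiskerRight (toInjCoker R) (toAb R))
    toInjCoker_surjective hker

end

end InjectiveEmbedding

/-! ### Ext is torsion and commutes with filtered colimits. -/

section ExtColimit

variable {R : Type u} [Ring R] [TopologicalSpace R] [IsTopologicalRing R]

lemma DMod.exact_of_shortComplex_exact {S : ShortComplex (DMod R)} (hS : S.Exact) :
    Function.Exact S.f.hom.hom S.g.hom.hom := by
  have : ∀ {A B : DMod R} (f : A ⟶ B), PreservesLimit (parallelPair f 0) (IsDiscreteMod R).ι :=
    fun f => (IsDiscreteMod R).preservesKernels_ι f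
  have : ∀ {A B : DMod R} (f : A ⟶ B), PreservesColimit (parallelPair f 0) (IsDiscreteMod R).ι :=
    fun f => (IsDiscreteMod R).preservesCokernels_ι f
  have hp : (IsDiscreteMod R).ι.PreservesHomology := { }
  exact (ShortComplex.ShortExact.moduleCat_exact_iff_function_exact _).1
    ((ShortComplex.exact_map_iff_of_faithful S (IsDiscreteMod R).ι).2 hS)

/-- Left exactness serves to identify `Ext⁰` with `Hom`, the base case of the inductions on the
degree. -/
instance (Z : PMod R) : PreservesFiniteLimits (homFunctor Z) := by
  refine ((Functor.preservesFiniteLimits_tfae (homFunctor Z)).out 0 3).1 fun S hS => ?_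
  have hm := hS.mono_f
  have hf : Function.Injective S.f.hom.hom :=
    (ModuleCat.mono_iff_injective S.f.hom).1 (inferInstanceAs (Mono ((IsDiscreteMod R).ι.map S.f)))
  have hex := DMod.exact_of_shortComplex_exact hS.exact
  constructor
  · rw [ShortComplex.ab_exact_iff]
    intro (f : contHom Z S.X₂) hf0
    have hf0' : ∀ z, S.g.hom.hom (f.1 z) = 0 := fun z =>
      congrArg (fun k : contHom Z S.X₃ => k.1 z) hf0
    let e := LinearEquiv.ofInjective S.f.hom.hom hf
    have hmem : ∀ z, f.1 z ∈ LinearMap.range S.f.hom.hom := fun z => (hex _).1 (hf0' z)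
    let g : Z.obj →ₗ[Rᵐᵒᵖ] S.X₁.obj := e.symm.toLinearMap ∘ₗ f.1.codRestrict _ hmem
    have hg : ∀ z, S.f.hom.hom (g z) = f.1 z := fun z =>
      congrArg Subtype.val (e.apply_symm_apply ⟨f.1 z, hmem z⟩)
    refine ⟨⟨g, ?_⟩, Subtype.ext (LinearMap.ext hg)⟩
    change IsLocallyConstant g
    -- A map is locally constant if its composite with an injection is.
    refine IsLocallyConstant.desc _ S.f.hom.hom ?_ hf
    have hcomp : ⇑S.f.hom.hom ∘ ⇑g = ⇑f.1 := funext hg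
    rw [hcomp]
    exact f.2
  · refine (AddCommGrpCat.mono_iff_injective _).2 fun f g hfg => ?_
    refine Subtype.ext (LinearMap.ext fun z => hf ?_)
    exact congrArg (fun k : contHom Z S.X₂ => k.1 z) hfg

/-- `Ext⁰` is `Hom`. -/
noncomputable def homIsoExtZero (Z : PMod R) : homFunctor Z ≅ extFunctor Z 0 :=
  (homFunctor Z).rightDerivedZeroIsoSelf.symm

lemma subsingleton_extR_of_injective (Z : PMod R) (A : DMod R) [Injective A] (n : ℕ) :
    Subsingleton (ExtR Z A (n + 1)) :=
  AddCommGrpCat.subsingleton_of_isZero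
    ((homFunctor Z).isZero_rightDerived_obj_injective_succ n A)

variable [CompactSpace R]

/-- The next group in the long exact sequence is a positive-degree Ext of an injective module, which
vanishes. Every class of degree `n + 1` is thus obtained functorially from one of degree `n`. -/
lemma injSeq_extDelta_surjective (Z : PMod R) (A : DMod R) (n : ℕ) :
    Function.Surjective (extDelta Z (injSeq_shortExact R A) n) := by
  intro a
  have : Subsingleton (ExtR Z (injSeq R A).X₂ (n + 1)) :=
    subsingleton_extR_of_injective Z ((injFunctor R).obj A) n
  exact (extDelta_extPost_exact Z (injSeq_shortExact R A) n a).1 (Subsingleton.elim _ _)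

/-- The image of `f` is a finite group, whose order annihilates `f`. -/
lemma isAddTorsion_contHom (Z : PMod R) (A : DMod R) : IsAddTorsion (contHom Z A) := by
  intro f
  obtain ⟨_, _, _⟩ := Z.property
  have hfin : Finite f.1.toAddMonoidHom.range := f.2.range_finite
  refine isOfFinAddOrder_iff_nsmul_eq_zero.2
    ⟨Nat.card f.1.toAddMonoidHom.range, Nat.card_pos, ?_⟩
  refine Subtype.ext (LinearMap.ext fun z => ?_)
  exact congrArg Subtype.val (card_nsmul_eq_zero' (x := (⟨f.1 z, z, rfl⟩ : f.1.toAddMonoidHom.range)))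

lemma isAddTorsion_extR (Z : PMod R) (A : DMod R) (n : ℕ) : IsAddTorsion (ExtR Z A n) := by
  induction n generalizing A with
  | zero =>
    have hs : Function.Surjective ((homIsoExtZero Z).hom.app A) :=
      (AddCommGrpCat.epi_iff_surjective _).1 inferInstance
    exact (isAddTorsion_contHom Z A).of_surjective (f := ((homIsoExtZero Z).hom.app A).hom) hs
  | succ n ih =>
    intro a
    obtain ⟨b, rfl⟩ := injSeq_extDelta_surjective Z A n a
    exact AddMonoidHom.isOfFinAddOrder _ (ih _ b)

section

universe v w v' w'

variable {J : Type w} [Category.{v} J] [IsFiltered J]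

lemma IsElemColim.of_iso {C : Type w'} [Category.{v'} C] {F : J ⥤ C} {c : Cocone F}
    {P Q : C ⥤ AddCommGrpCat.{u}} (h : IsElemColim c P) (e : P ≅ Q) : IsElemColim c Q := by
  refine h.of_surjective e.hom (fun A => ?_) fun x hx => ?_
  · exact (AddCommGrpCat.epi_iff_surjective _).1 inferInstance
  · have hi : Function.Injective (e.hom.app c.pt) :=
      (AddCommGrpCat.mono_iff_injective _).1 inferInstance
    rw [(map_eq_zero_iff _ hi).1 hx]
    exact zero_mem _

variable {F : J ⥤ DMod R} {c : Cocone F}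

lemma finite_range_smul (A : DMod R) (a : A.obj) : (Set.range fun r : Rᵐᵒᵖ => r • a).Finite := by
  have h := (isLocallyConstant_smul A.property a).range_finite
  refine h.subset ?_
  rintro _ ⟨r, rfl⟩
  exact ⟨r.unop, rfl⟩

/-- An additive lift to some stage exists by compactness of `Z`. It is made linear by passing to a
later stage: the conditions `g (r • z) = r • g z` amount to finitely many, since `g` has finite
image and orbits in a discrete module are finite. -/
lemma IsElemColim.comp_homFunctor (Z : PMod R) (h : IsElemColim c (toAb R)) :
    IsElemColim c (homFunctor Z) where
  exists_rep f := by
    obtain ⟨_, _, _⟩ := Z.property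
    let f' : contHom Z c.pt := f
    obtain ⟨j, g, hg, hgf⟩ := h.exists_lift_addMonoidHom f'.1.toAddMonoidHom f'.2
    let g' : Z.obj →+ (F.obj j).obj := g
    -- A finite set that contains all defects of linearity `g' (r • z) - r • g' z`. Only those of
    -- its elements that vanish in the colimit are killed at the stage `k`.
    let T : Set ((toAb R).obj (F.obj j)) := Set.image2 (fun a b : (F.obj j).obj => a - b)
      (Set.range g') (⋃ a ∈ Set.range g', Set.range fun r : Rᵐᵒᵖ => r • a)
    have hT : T.Finite := hg.range_finite.image2 _
      (hg.range_finite.biUnion fun a _ => finite_range_smul (F.obj j) a)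
    have hgf' : ∀ z, (c.ι.app j).hom.hom (g' z) = f'.1 z := hgf
    obtain ⟨k, φ, hφ⟩ := h.exists_map_eq_zero_finite (S := T ∩ {m | (c.ι.app j).hom.hom m = 0})
      (hT.subset Set.inter_subset_left) (fun m hm => hm.2)
    let l : Z.obj →ₗ[Rᵐᵒᵖ] (F.obj k).obj :=
      { toFun := fun z => (F.map φ).hom.hom (g' z)
        map_add' := fun a b => by rw [map_add, map_add]
        map_smul' := fun r z => by
          have h1 : (F.map φ).hom.hom (g' (r • z) - r • g' z) = 0 := by
            refine hφ _ ⟨⟨g' (r • z), ⟨_, rfl⟩, r • g' z, ?_, rfl⟩, ?_⟩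
            · simp only [Set.mem_iUnion]
              exact ⟨g' z, ⟨z, rfl⟩, r, rfl⟩
            · change (c.ι.app j).hom.hom (g' (r • z) - r • g' z) = 0
              rw [map_sub, hgf', map_smul f'.1, map_smul (c.ι.app j).hom.hom, hgf', sub_self]
          rw [map_sub, map_smul (F.map φ).hom.hom, sub_eq_zero] at h1
          exact h1 }
    refine ⟨k, (⟨l, hg.comp (F.map φ).hom.hom⟩ : contHom Z (F.obj k)),
      Subtype.ext (LinearMap.ext fun z => ?_)⟩
    exact (c.map_w_apply (toAb R) φ (g' z)).trans (hgf z)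
  exists_map_eq_zero j m hm := by
    obtain ⟨_, _, _⟩ := Z.property
    let m' : contHom Z (F.obj j) := m
    obtain ⟨k, f, hf⟩ := h.exists_map_eq_zero_of_locallyConstant m'.2
      fun z => congrArg (fun k : contHom Z c.pt => k.1 z) hm
    exact ⟨k, f, Subtype.ext (LinearMap.ext hf)⟩

/-- By dimension shifting `Ext^(n+1)(Z, A)` is naturally the cokernel of `Ext^n(Z, I) → Ext^n(Z,
I/A)` for the functorial embedding of `A` into `I`. Both `I` and `I/A` commute with filtered
colimits, so the induction hypothesis applies to them; this is why it must cover all diagrams `F`.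
-/
lemma IsElemColim.comp_extFunctor (Z : PMod R) (n : ℕ) (h : IsElemColim c (toAb R)) :
    IsElemColim c (extFunctor Z n) := by
  induction n generalizing F c with
  | zero => exact (h.comp_homFunctor Z).of_iso (homIsoExtZero Z)
  | succ n ih =>
    have hE : IsElemColim c (_root_.injFunctor R ⋙ extFunctor Z n) := by
      have := ih (c := (_root_.injFunctor R).mapCocone c)
        ⟨h.comp_injFunctor.exists_rep, h.comp_injFunctor.exists_map_eq_zero⟩
      exact ⟨this.exists_rep, this.exists_map_eq_zero⟩
    have hQ : IsElemColim c (injCoker R ⋙ extFunctor Z n) := by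
      have := ih (c := (injCoker R).mapCocone c)
        ⟨h.comp_injCoker.exists_rep, h.comp_injCoker.exists_map_eq_zero⟩
      exact ⟨this.exists_rep, this.exists_map_eq_zero⟩
    let π : injCoker R ⋙ extFunctor Z n ⟶ extFunctor Z (n + 1) :=
      { app A := AddCommGrpCat.ofHom (extDelta Z (injSeq_shortExact R A) n)
        naturality {A B} f := AddCommGrpCat.hom_ext (AddMonoidHom.ext fun t =>
          (extPost_extDelta Z (injSeq_shortExact R A) (injSeq_shortExact R B)
            (injSeqMap R f) n t).symm) }
    refine hQ.of_surjective π (fun A => injSeq_extDelta_surjective Z A n) fun x hx => ?_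
    -- A class killed by the connecting map comes from the injective module, and there it is
    -- represented at a stage.
    obtain ⟨y, rfl⟩ := (extPost_extDelta_exact Z (injSeq_shortExact R c.pt) n x).1 hx
    obtain ⟨j, y, rfl⟩ := hE.exists_rep y
    refine ⟨j, extPost Z ((toInjCoker R).app _) n y,
      (extPost_extDelta_exact Z (injSeq_shortExact R (F.obj j)) n).apply_apply_eq_zero y, ?_⟩
    have h1 := extPost_extPost Z ((toInjCoker R).app (F.obj j)) ((injCoker R).map (c.ι.app j)) n y
    have h2 := extPost_extPost Z ((_root_.injFunctor R).map (c.ι.app j)) ((toInjCoker R).app c.pt) n y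
    rw [← (toInjCoker R).naturality] at h1
    exact h1.trans h2.symm

end

end ExtColimit

/-! ### Étale spaces from groups with an action of the clopen sets. -/

section Germs

open TopologicalSpace Topology

/-- A family of quotients `ev x : M → G x` of an abelian group `M` with an action of the Boolean
algebra of clopen sets of a profinite space `X`, such that `G x` is the stalk of `M` at `x`. -/
structure GermData (X : Profinite.{u}) (G : X → Type u) [∀ x, AddCommGroup (G x)]
    (M : Type u) [AddCommGroup M] where
  /-- the projections to the stalks -/
  ev : ∀ x, M →+ G x
  /-- the action of clopen sets -/
  proj : Clopens X → M →+ M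
  ev_surjective : ∀ x, Function.Surjective (ev x)
  exists_proj_eq_zero : ∀ x a, ev x a = 0 → ∃ U : Clopens X, x ∈ U ∧ proj U a = 0
  ev_proj_of_mem : ∀ (x : X) (U : Clopens X) (a : M), x ∈ U → ev x (proj U a) = ev x a
  ev_proj_of_notMem : ∀ (x : X) (U : Clopens X) (a : M), x ∉ U → ev x (proj U a) = 0
  proj_top : ∀ a, proj ⊤ a = a
  proj_sup : ∀ (U V : Clopens X) (a : M), Disjoint U V → proj (U ⊔ V) a = proj U a + proj V a
  proj_proj_of_le : ∀ (U V : Clopens X) (a : M), U ≤ V → proj U (proj V a) = proj U a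

namespace GermData

variable {X : Profinite.{u}} {G : X → Type u} [∀ x, AddCommGroup (G x)]
    {M : Type u} [AddCommGroup M] (D : GermData X G M)

/-- The set of germs of an element of `M` at the points of a clopen set. -/
def germs (U : Clopens X) (a : M) : Set (Tot G) := {t | t.base ∈ U ∧ t.val = D.ev t.base a}

/-- The topology on the disjoint union of the stalks generated by the sets of germs. -/
@[reducible] def top : TopologicalSpace (Tot G) :=
  .generateFrom {O | ∃ (U : Clopens X) (a : M), O = D.germs U a}

lemma isOpen_germs (U : Clopens X) (a : M) : IsOpen[D.top] (D.germs U a) :=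
  .basic _ ⟨U, a, rfl⟩

lemma exists_ev_eq_of_ev_eq {x : X} {a b : M} (h : D.ev x a = D.ev x b) :
    ∃ U : Clopens X, x ∈ U ∧ ∀ y ∈ U, D.ev y a = D.ev y b := by
  obtain ⟨U, hxU, hU⟩ := D.exists_proj_eq_zero x (a - b) (by rw [map_sub, h, sub_self])
  refine ⟨U, hxU, fun y hy => ?_⟩
  rw [← sub_eq_zero, ← map_sub, ← D.ev_proj_of_mem y U _ hy, hU, map_zero]

lemma continuous_base : Continuous[D.top, inferInstance] (Tot.base : Tot G → X) := by
  let _ := D.top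
  refine (isTopologicalBasis_isClopen (X := X)).continuous_iff.2 fun U hU => ?_
  have h : Tot.base ⁻¹' U = ⋃ a, D.germs ⟨U, hU⟩ a := by
    ext t
    simp only [Set.mem_preimage, Set.mem_iUnion]
    constructor
    · intro ht
      obtain ⟨a, ha⟩ := D.ev_surjective t.base t.val
      exact ⟨a, ht, ha.symm⟩
    · rintro ⟨a, ht, -⟩
      exact ht
  rw [h]
  exact isOpen_iUnion fun a => D.isOpen_germs _ a

/-- Elements of `M` with the same germ at a point have the same germs nearby. With the converse
`eventually_val_eq` this turns questions of continuity into statements about germs of single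
elements. -/
lemma continuousAt_of_eventually {T : Type*} [TopologicalSpace T] {σ : T → Tot G} {t₀ : T}
    (hb : ContinuousAt (fun t => (σ t).base) t₀) (a : M)
    (h : ∀ᶠ t in 𝓝 t₀, (σ t).val = D.ev (σ t).base a) :
    @ContinuousAt _ _ _ D.top σ t₀ := by
  refine tendsto_nhds_generateFrom_iff.2 ?_
  rintro _ ⟨U, b, rfl⟩ ⟨hU, hval⟩
  obtain ⟨W, hxW, hW⟩ := D.exists_ev_eq_of_ev_eq (h.self_of_nhds.symm.trans hval)
  filter_upwards [h, hb (W.isOpen.mem_nhds hxW), hb (U.isOpen.mem_nhds hU)] with t ht htW htU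
  exact ⟨htU, ht.trans (hW _ htW)⟩

lemma continuous_ev (a : M) : Continuous[inferInstance, D.top]
    fun x : X => (⟨x, D.ev x a⟩ : Tot G) := by
  let _ := D.top
  exact continuous_iff_continuousAt.2 fun x =>
    D.continuousAt_of_eventually continuousAt_id a (.of_forall fun _ => rfl)

lemma eventually_val_eq {T : Type*} [TopologicalSpace T] {σ : T → Tot G} {t₀ : T}
    (hσ : @ContinuousAt _ _ _ D.top σ t₀) {a : M} (ha : (σ t₀).val = D.ev (σ t₀).base a) :
    ∀ᶠ t in 𝓝 t₀, (σ t).val = D.ev (σ t).base a := by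
  let _ := D.top
  filter_upwards [hσ ((D.isOpen_germs ⊤ a).mem_nhds ⟨trivial, ha⟩)] with t ht
  exact ht.2

lemma isLocalHomeomorph : @IsLocalHomeomorph _ _ D.top _ (Tot.base : Tot G → X) := by
  let _ := D.top
  intro t
  obtain ⟨a, ha⟩ := D.ev_surjective t.base t.val
  -- Every point of the total space is a germ of some `a : M`, and `a` has germs everywhere; so the
  -- chart maps onto all of `X`.
  exact ⟨{ toFun := Tot.base
           invFun := fun x => ⟨x, D.ev x a⟩
           source := D.germs ⊤ a
           target := Set.univ
           map_source' := fun _ _ => trivial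
           map_target' := fun _ _ => ⟨trivial, rfl⟩
           left_inv' := by
             rintro ⟨x, g⟩ ⟨-, h⟩
             exact congrArg (Tot.mk x) (Eq.symm h)
           right_inv' := fun _ _ => rfl
           open_source := D.isOpen_germs ⊤ a
           open_target := isOpen_univ
           continuousOn_toFun := D.continuous_base.continuousOn
           continuousOn_invFun := (D.continuous_ev a).continuousOn }, ⟨trivial, ha.symm⟩, rfl⟩

lemma isEtaleTorsion (h : ∀ x, IsAddTorsion (G x)) : IsEtaleTorsion G D.top := by
  let _ := D.top
  refine ⟨D.isLocalHomeomorph, ?_, ?_, ?_, h⟩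
  · simpa using D.continuous_ev 0
  · let _ := pairTop G D.top
    have hc : Continuous fun t : Tot fun x => G x × G x =>
        ((⟨t.base, t.val.1⟩, ⟨t.base, t.val.2⟩) : Tot G × Tot G) := continuous_induced_dom
    have h1 := continuous_fst.comp hc
    have h2 := continuous_snd.comp hc
    refine continuous_iff_continuousAt.2 fun t => ?_
    obtain ⟨a, ha⟩ := D.ev_surjective t.base t.val.1
    obtain ⟨b, hb⟩ := D.ev_surjective t.base t.val.2
    refine D.continuousAt_of_eventually (D.continuous_base.comp h1).continuousAt (a + b) ?_
    filter_upwards [D.eventually_val_eq h1.continuousAt ha.symm,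
      D.eventually_val_eq h2.continuousAt hb.symm] with s hs1 hs2
    have e1 : s.val.1 = D.ev s.base a := hs1
    have e2 : s.val.2 = D.ev s.base b := hs2
    change s.val.1 + s.val.2 = D.ev s.base (a + b)
    rw [e1, e2, map_add]
  · refine continuous_iff_continuousAt.2 fun t => ?_
    obtain ⟨a, ha⟩ := D.ev_surjective t.base t.val
    refine D.continuousAt_of_eventually D.continuous_base.continuousAt (-a) ?_
    filter_upwards [D.eventually_val_eq continuousAt_id ha.symm] with s hs
    exact (congrArg Neg.neg hs).trans (map_neg _ _).symm

lemma proj_bot (a : M) : D.proj ⊥ a = 0 := by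
  have h := D.proj_sup ⊥ ⊥ a disjoint_bot_left
  rw [sup_idem] at h
  exact left_eq_add.1 h

lemma proj_sup_eq_zero {U V : Clopens X} {a : M} (hU : D.proj U a = 0) (hV : D.proj V a = 0) :
    D.proj (U ⊔ V) a = 0 := by
  rw [← sup_sdiff_self_right, D.proj_sup _ _ _ disjoint_sdiff_self_right, hU,
    ← D.proj_proj_of_le (V \ U) V a sdiff_le, hV, map_zero, add_zero]

/-- Each point has a clopen neighbourhood that cuts `a` to zero. Such clopen sets are closed under
unions, and `X` is compact. -/
lemma eq_zero_of_ev_eq_zero (a : M) (h : ∀ x, D.ev x a = 0) : a = 0 := by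
  have key : ∃ U : Clopens X, (Set.univ : Set X) ⊆ U ∧ D.proj U a = 0 := by
    refine IsCompact.induction_on (p := fun K : Set X => ∃ U : Clopens X, K ⊆ (U : Set X) ∧ D.proj U a = 0)
      isCompact_univ ⟨⊥, Set.empty_subset _, D.proj_bot a⟩ ?_ ?_ ?_
    · rintro K L hKL ⟨U, hU, h0⟩
      exact ⟨U, hKL.trans hU, h0⟩
    · rintro K L ⟨U, hU, hU0⟩ ⟨V, hV, hV0⟩
      exact ⟨U ⊔ V, Set.union_subset_union hU hV, D.proj_sup_eq_zero hU0 hV0⟩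
    · intro x _
      obtain ⟨U, hxU, hU⟩ := D.exists_proj_eq_zero x a (h x)
      exact ⟨U, mem_nhdsWithin_of_mem_nhds (U.isOpen.mem_nhds hxU), U, subset_rfl, hU⟩
  obtain ⟨U, hU, h0⟩ := key
  have hU' : U = ⊤ := SetLike.coe_injective (Set.univ_subset_iff.1 hU)
  rwa [hU', D.proj_top] at h0

lemma exists_ev_eq (s : ∀ x, G x)
    (hs : Continuous[inferInstance, D.top] fun x => (⟨x, s x⟩ : Tot G)) :
    ∃ a, ∀ x, D.ev x a = s x := by
  let _ := D.top
  have key : ∃ U : Clopens X, (Set.univ : Set X) ⊆ U ∧ ∃ a, ∀ x ∈ U, D.ev x a = s x := by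
    refine IsCompact.induction_on
      (p := fun K : Set X => ∃ U : Clopens X, K ⊆ (U : Set X) ∧ ∃ a, ∀ x ∈ U, D.ev x a = s x)
      isCompact_univ ⟨⊥, Set.empty_subset _, 0, fun x hx => hx.elim⟩ ?_ ?_ ?_
    · rintro K L hKL ⟨U, hU, h0⟩
      exact ⟨U, hKL.trans hU, h0⟩
    · rintro K L ⟨U, hU, a, ha⟩ ⟨V, hV, b, hb⟩
      -- Patching: `a` is used on `U` and `b` on the part of `V` outside `U`. No compatibility on
      -- the overlap is needed.
      refine ⟨U ⊔ V, Set.union_subset_union hU hV, D.proj U a + D.proj Uᶜ b, fun x hx => ?_⟩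
      by_cases hxU : x ∈ U
      · rw [map_add, D.ev_proj_of_mem _ _ _ hxU, D.ev_proj_of_notMem _ _ _ (show x ∉ Uᶜ from fun h => (show x ∈ (U : Set X)ᶜ from h) hxU),
          add_zero, ha x hxU]
      · rw [map_add, D.ev_proj_of_notMem _ _ _ hxU, D.ev_proj_of_mem _ _ _ hxU, zero_add,
          hb x (hx.resolve_left hxU)]
    · intro x _
      obtain ⟨a, ha⟩ := D.ev_surjective x (s x)
      have h1 := D.eventually_val_eq (σ := fun x => (⟨x, s x⟩ : Tot G)) hs.continuousAt ha.symm
      obtain ⟨V, hV, hVo, hxV⟩ := mem_nhds_iff.1 h1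
      obtain ⟨U, hU, hxU, hUV⟩ := compact_exists_isClopen_in_isOpen hVo hxV
      exact ⟨U, mem_nhdsWithin_of_mem_nhds (hU.isOpen.mem_nhds hxU), ⟨U, hU⟩, subset_rfl, a,
        fun y hy => (hV (hUV hy)).symm⟩
  obtain ⟨U, hU, a, ha⟩ := key
  exact ⟨a, fun x => ha x (hU trivial)⟩

/-- The isomorphism of `M` with the group of global sections. -/
noncomputable def cprodEquiv (h : IsEtaleTorsion G D.top) : M ≃+ h.cprod :=
  AddEquiv.ofBijective
    (AddMonoidHom.mk' (fun a => (⟨fun x => D.ev x a, D.continuous_ev a⟩ : h.cprod)) fun a b =>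
      Subtype.ext (funext fun x => map_add (D.ev x) a b))
    ⟨(injective_iff_map_eq_zero _).2 fun a ha => D.eq_zero_of_ev_eq_zero a fun x =>
        congrFun (congrArg Subtype.val ha) x,
      fun s => by
        obtain ⟨a, ha⟩ := D.exists_ev_eq s.1 s.2
        exact ⟨a, Subtype.ext (funext ha)⟩⟩

end GermData

end Germs

/-! ### Sections over clopen sets, extension by zero, and fibres as colimits. -/

section EtaleStalks

open TopologicalSpace Topology

variable {R : Type u} [Ring R] [TopologicalSpace R] {X : Profinite.{u}}

namespace EtaleMod

variable (𝒜 : EtaleMod R X)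

open Classical in
/-- Extension by zero of a map on a clopen set. -/
noncomputable def zeroExt (U : Clopens X) (s : ∀ y : U, 𝒜.Fam y) (x : X) : 𝒜.Fam x :=
  if h : x ∈ U then s ⟨x, h⟩ else 0

variable {𝒜} in
lemma zeroExt_of_mem {U : Clopens X} (s : ∀ y : U, 𝒜.Fam y) {x : X} (h : x ∈ U) :
    𝒜.zeroExt U s x = s ⟨x, h⟩ := dif_pos h

variable {𝒜} in
lemma zeroExt_of_notMem {U : Clopens X} (s : ∀ y : U, 𝒜.Fam y) {x : X} (h : x ∉ U) :
    𝒜.zeroExt U s x = 0 := dif_neg h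

lemma continuous_zeroExt {U : Clopens X} {s : ∀ y : U, 𝒜.Fam y}
    (hs : Continuous fun y : U => (⟨y, s y⟩ : Tot 𝒜.Fam)) :
    Continuous fun x => (⟨x, 𝒜.zeroExt U s x⟩ : Tot 𝒜.Fam) := by
  refine continuous_iff_continuousAt.2 fun x => ?_
  by_cases hx : x ∈ U
  · refine (U.isOpen.isOpenEmbedding_subtypeVal.continuousAt_iff (x := (⟨x, hx⟩ : U))).1 ?_
    refine hs.continuousAt.congr (.of_forall fun y => ?_)
    exact congrArg (Tot.mk (G := 𝒜.Fam) y.1) (zeroExt_of_mem s y.2).symm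
  · refine 𝒜.continuous_zero.continuousAt.congr ?_
    filter_upwards [U.isClosed.isOpen_compl.mem_nhds hx] with y hy
    exact congrArg (Tot.mk (G := 𝒜.Fam) y) (zeroExt_of_notMem s hy).symm

variable [IsTopologicalRing R]

/-- Restriction of global sections to a clopen set. -/
def restrict (U : Clopens X) : 𝒜.cprod ⟶ 𝒜.sectionsOn U :=
  ObjectProperty.homMk (ModuleCat.ofHom
    { toFun := fun s => ⟨fun y => s.1 y, s.2.comp continuous_subtype_val⟩
      map_add' := fun _ _ => rfl
      map_smul' := fun _ _ => rfl })

/-- Extension by zero of sections over a clopen set. -/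
noncomputable def extendZero (U : Clopens X) : 𝒜.sectionsOn U ⟶ 𝒜.cprod :=
  ObjectProperty.homMk (ModuleCat.ofHom
    { toFun := fun s => ⟨𝒜.zeroExt U s.1, 𝒜.continuous_zeroExt s.2⟩
      map_add' := fun s t => Subtype.ext (funext fun x => by
        by_cases hx : x ∈ U
        · exact (zeroExt_of_mem _ hx).trans
            (congrArg₂ (· + ·) (zeroExt_of_mem s.1 hx) (zeroExt_of_mem t.1 hx)).symm
        · exact (zeroExt_of_notMem _ hx).trans ((congrArg₂ (· + ·) (zeroExt_of_notMem s.1 hx)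
            (zeroExt_of_notMem t.1 hx)).trans (add_zero _)).symm)
      map_smul' := fun r s => Subtype.ext (funext fun x => by
        by_cases hx : x ∈ U
        · exact (zeroExt_of_mem _ hx).trans
            (congrArg (r • ·) (zeroExt_of_mem s.1 hx)).symm
        · exact (zeroExt_of_notMem _ hx).trans ((congrArg (r • ·)
            (zeroExt_of_notMem s.1 hx)).trans (smul_zero r)).symm) })

lemma restrict_evOn (U : Clopens X) (x : U) : 𝒜.restrict U ≫ 𝒜.evOn U x = 𝒜.ev x := rfl

lemma extendZero_ev_of_mem (U : Clopens X) (x : U) :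
    𝒜.extendZero U ≫ 𝒜.ev x = 𝒜.evOn U x := by
  ext s
  exact zeroExt_of_mem s.1 x.2

lemma extendZero_ev_of_notMem (U : Clopens X) (x : X) (hx : x ∉ U) :
    𝒜.extendZero U ≫ 𝒜.ev x = 0 := by
  ext s
  exact zeroExt_of_notMem s.1 hx

variable {𝒜} in
lemma hom_cprod_ext {A : DMod R} {f g : A ⟶ 𝒜.cprod} (h : ∀ x, f ≫ 𝒜.ev x = g ≫ 𝒜.ev x) :
    f = g := by
  ext a
  exact Subtype.ext (funext fun x =>
    congrArg (fun k : A ⟶ 𝒜.fib x => k.hom.hom a) (h x))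

variable {𝒜} in
lemma hom_sectionsOn_ext {A : DMod R} {U : Clopens X} {f g : A ⟶ 𝒜.sectionsOn U}
    (h : ∀ x, f ≫ 𝒜.evOn U x = g ≫ 𝒜.evOn U x) : f = g := by
  ext a
  exact Subtype.ext (funext fun x =>
    congrArg (fun k : A ⟶ 𝒜.fib x => k.hom.hom a) (h x))

/-- Restriction to a smaller clopen set (set to zero on the complement of the first one). -/
noncomputable def transition (U V : Clopens X) : 𝒜.sectionsOn U ⟶ 𝒜.sectionsOn V :=
  𝒜.extendZero U ≫ 𝒜.restrict V

lemma transition_evOn {U V : Clopens X} (h : V ≤ U) (x : V) :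
    𝒜.transition U V ≫ 𝒜.evOn V x = 𝒜.evOn U ⟨x, h x.2⟩ := by
  rw [transition, Category.assoc, restrict_evOn]
  exact 𝒜.extendZero_ev_of_mem U ⟨x, h x.2⟩

lemma extendZero_restrict (U : Clopens X) : 𝒜.extendZero U ≫ 𝒜.restrict U = 𝟙 _ :=
  hom_sectionsOn_ext fun x => (𝒜.transition_evOn le_rfl x).trans (Category.id_comp _).symm

/-- The endomorphism of the module of global sections that sets a section to zero outside of a
clopen set. -/
noncomputable def cut (U : Clopens X) : 𝒜.cprod ⟶ 𝒜.cprod := 𝒜.restrict U ≫ 𝒜.extendZero U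

lemma cut_ev_of_mem {U : Clopens X} {x : X} (hx : x ∈ U) : 𝒜.cut U ≫ 𝒜.ev x = 𝒜.ev x := by
  rw [cut, Category.assoc, 𝒜.extendZero_ev_of_mem U ⟨x, hx⟩, restrict_evOn]

lemma cut_ev_of_notMem {U : Clopens X} {x : X} (hx : x ∉ U) : 𝒜.cut U ≫ 𝒜.ev x = 0 := by
  rw [cut, Category.assoc, 𝒜.extendZero_ev_of_notMem U x hx, comp_zero]

lemma cut_top : 𝒜.cut ⊤ = 𝟙 _ :=
  hom_cprod_ext fun x => (𝒜.cut_ev_of_mem (Set.mem_univ x)).trans (Category.id_comp _).symm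

lemma cut_sup {U V : Clopens X} (h : Disjoint U V) : 𝒜.cut (U ⊔ V) = 𝒜.cut U + 𝒜.cut V := by
  refine hom_cprod_ext fun x => ?_
  rw [Preadditive.add_comp]
  by_cases hU : x ∈ U
  · have hV : x ∉ V := fun hV =>
      h.le_bot (show x ∈ U ⊓ V from ⟨hU, hV⟩)
    rw [𝒜.cut_ev_of_mem hU, 𝒜.cut_ev_of_notMem hV, 𝒜.cut_ev_of_mem (Or.inl hU), add_zero]
  · rw [𝒜.cut_ev_of_notMem hU, zero_add]
    by_cases hV : x ∈ V
    · rw [𝒜.cut_ev_of_mem hV, 𝒜.cut_ev_of_mem (Or.inr hV)]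
    · rw [𝒜.cut_ev_of_notMem hV, 𝒜.cut_ev_of_notMem (show x ∉ U ⊔ V from fun h =>
        (show x ∈ (U : Set X) ∪ V from h).elim hU hV)]

lemma cut_cut {U V : Clopens X} (h : U ≤ V) : 𝒜.cut V ≫ 𝒜.cut U = 𝒜.cut U := by
  refine hom_cprod_ext fun x => ?_
  rw [Category.assoc]
  by_cases hU : x ∈ U
  · rw [𝒜.cut_ev_of_mem hU, 𝒜.cut_ev_of_mem (h hU)]
  · rw [𝒜.cut_ev_of_notMem hU, comp_zero]

/-- The clopen neighbourhoods of a point, ordered by reverse inclusion. -/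
abbrev ClopenNhds (x : X) : Type u := {U : Clopens X // x ∈ U}ᵒᵈ

instance (x : X) : Nonempty (ClopenNhds x) := ⟨OrderDual.toDual ⟨⊤, trivial⟩⟩

instance (x : X) : IsDirectedOrder (ClopenNhds x) :=
  ⟨fun U V => ⟨OrderDual.toDual ⟨U.ofDual.1 ⊓ V.ofDual.1, U.ofDual.2, V.ofDual.2⟩,
    fun _ h => h.1, fun _ h => h.2⟩⟩

/-- The modules of sections over the clopen neighbourhoods of a point. -/
noncomputable def sectionsFunctor (x : X) : ClopenNhds x ⥤ DMod R where
  obj U := 𝒜.sectionsOn U.ofDual.1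
  map {U V} _ := 𝒜.transition U.ofDual.1 V.ofDual.1
  map_id U := 𝒜.extendZero_restrict U.ofDual.1
  map_comp {U V W} f g := by
    have h1 : V.ofDual.1 ≤ U.ofDual.1 := leOfHom f
    have h2 : W.ofDual.1 ≤ V.ofDual.1 := leOfHom g
    refine hom_sectionsOn_ext fun y => ?_
    rw [Category.assoc, 𝒜.transition_evOn h2, 𝒜.transition_evOn h1, 𝒜.transition_evOn (h2.trans h1)]

/-- The evaluations at a point of sections over its clopen neighbourhoods. -/
noncomputable def stalkCocone (x : X) : Cocone (𝒜.sectionsFunctor x) where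
  pt := 𝒜.fib x
  ι :=
    { app := fun U => 𝒜.evOn U.ofDual.1 ⟨x, U.ofDual.2⟩
      naturality := fun U V f =>
        (𝒜.transition_evOn (leOfHom f : V.ofDual.1 ≤ U.ofDual.1) ⟨x, V.ofDual.2⟩).trans
          (Category.comp_id _).symm }

/-- This is étaleness: each element of a fibre extends to a section near `x`, and a section that
vanishes at `x` vanishes near `x`. -/
lemma isElemColim_stalkCocone (x : X) : IsElemColim (𝒜.stalkCocone x) (toAb R) where
  exists_rep a := by
    obtain ⟨s, hsx, hs⟩ := 𝒜.exists_local_section x a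
    obtain ⟨V, hV, hVo, hxV⟩ := mem_nhds_iff.1 hs
    obtain ⟨U, hU, hxU, hUV⟩ := compact_exists_isClopen_in_isOpen hVo hxV
    have hc : Continuous fun y : U => (⟨y, s y⟩ : Tot 𝒜.Fam) :=
      continuous_iff_continuousAt.2 fun y =>
        ContinuousAt.comp (f := ((↑) : U → X)) (g := fun y => (⟨y, s y⟩ : Tot 𝒜.Fam))
          (hV (hUV y.2)) continuous_subtype_val.continuousAt
    exact ⟨OrderDual.toDual ⟨⟨U, hU⟩, hxU⟩, ⟨fun y => s y, hc⟩, hsx⟩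
  exists_map_eq_zero U m hm := by
    let s : ∀ y, 𝒜.Fam y := 𝒜.zeroExt U.ofDual.1 m.1
    have hs : Continuous fun y => (⟨y, s y⟩ : Tot 𝒜.Fam) := 𝒜.continuous_zeroExt m.2
    have h0 : s x = 0 := (zeroExt_of_mem m.1 U.ofDual.2).trans hm
    have h1 := eventually_eq_of_eq hs.continuousAt 𝒜.continuous_zero.continuousAt h0
    obtain ⟨V, hV, hVo, hxV⟩ := mem_nhds_iff.1 h1
    obtain ⟨W, hW, hxW, hWV⟩ := compact_exists_isClopen_in_isOpen hVo hxV
    -- Intersecting with the original neighbourhood provides the inclusion that an arrow of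
    -- `ClopenNhds x` requires.
    refine ⟨OrderDual.toDual ⟨⟨W, hW⟩ ⊓ U.ofDual.1, hxW, U.ofDual.2⟩, homOfLE fun _ h => h.2,
      Subtype.ext (funext fun y => ?_)⟩
    exact hV (hWV y.2.1)

end EtaleMod

end EtaleStalks

/-! ### The étale space of Ext groups and its global sections. -/

section ExtEtaleSpace

open TopologicalSpace Topology

variable {R : Type u} [Ring R] [TopologicalSpace R] [IsTopologicalRing R] [CompactSpace R]
  {X Y : Profinite.{u}}

namespace EtaleMod

variable (Z : PMod R) (𝒜 : EtaleMod R X) (n : ℕ)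

lemma exists_extPost_evOn_eq (x : X) (g : ExtR Z (𝒜.fib x) n) :
    ∃ (U : Clopens X) (hx : x ∈ U) (m : ExtR Z (𝒜.sectionsOn U) n),
      extPost Z (𝒜.evOn U ⟨x, hx⟩) n m = g := by
  obtain ⟨U, m, hm⟩ := ((𝒜.isElemColim_stalkCocone x).comp_extFunctor Z n).exists_rep g
  exact ⟨U.ofDual.1, U.ofDual.2, m, hm⟩

lemma exists_extPost_transition_eq_zero {x : X} {U : Clopens X} (hx : x ∈ U)
    (m : ExtR Z (𝒜.sectionsOn U) n) (hm : extPost Z (𝒜.evOn U ⟨x, hx⟩) n m = 0) :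
    ∃ V : Clopens X, x ∈ V ∧ extPost Z (𝒜.transition U V) n m = 0 := by
  obtain ⟨V, f, hV⟩ := ((𝒜.isElemColim_stalkCocone x).comp_extFunctor Z n).exists_map_eq_zero
    (OrderDual.toDual ⟨U, hx⟩) m hm
  exact ⟨V.ofDual.1, V.ofDual.2, hV⟩

/-- The groups `Ext_R^n(Z, A_x)` as the stalks of `Ext_R^n(Z, ∏ 𝒜)`. -/
noncomputable def extGermData : GermData X (ExtFam Z 𝒜 n) (ExtR Z 𝒜.cprod n) where
  ev x := extPost Z (𝒜.ev x) n
  proj U := extPost Z (𝒜.cut U) n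
  -- A class over a clopen neighbourhood becomes global through extension by zero, without changing
  -- its germ at `x`.
  ev_surjective x g := by
    obtain ⟨U, hx, m, rfl⟩ := 𝒜.exists_extPost_evOn_eq Z n x g
    exact ⟨extPost Z (𝒜.extendZero U) n m, by
      rw [extPost_extPost, 𝒜.extendZero_ev_of_mem U ⟨x, hx⟩]⟩
  -- A global class is a class over the neighbourhood `⊤`, so the colimit property yields `V` on
  -- which its restriction vanishes; cutting to `V` factors through that restriction.
  exists_proj_eq_zero x a ha := by
    obtain ⟨V, hV, h0⟩ := 𝒜.exists_extPost_transition_eq_zero Z n (U := ⊤) (Set.mem_univ x)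
      (extPost Z (𝒜.restrict ⊤) n a) (by rwa [extPost_extPost, restrict_evOn])
    refine ⟨V, hV, ?_⟩
    have h1 : 𝒜.restrict ⊤ ≫ 𝒜.transition ⊤ V = 𝒜.restrict V := by
      rw [transition, ← Category.assoc, ← cut, cut_top, Category.id_comp]
    rw [extPost_extPost, h1] at h0
    rw [cut, ← extPost_extPost, h0, map_zero]
  ev_proj_of_mem x U a hx := by rw [extPost_extPost, 𝒜.cut_ev_of_mem hx]
  ev_proj_of_notMem x U a hx := by
    rw [extPost_extPost, 𝒜.cut_ev_of_notMem hx, extPost_zero, AddMonoidHom.zero_apply]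
  proj_top a := by rw [cut_top, extPost_id, AddMonoidHom.id_apply]
  proj_sup U V a h := by rw [𝒜.cut_sup h, extPost_add, AddMonoidHom.add_apply]
  proj_proj_of_le U V a h := by rw [extPost_extPost, 𝒜.cut_cut h]

lemma range_eq_germs (U : Clopens X) (s : ExtR Z (𝒜.sectionsOn U) n)
    (a : ExtR Z 𝒜.cprod n)
    (h : ∀ x : U, extPost Z (𝒜.evOn U x) n s = extPost Z (𝒜.ev x) n a) :
    Set.range (fun x : U => (⟨x, extPost Z (𝒜.evOn U x) n s⟩ : Tot (ExtFam Z 𝒜 n))) =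
      (𝒜.extGermData Z n).germs U a := by
  ext ⟨x, g⟩
  constructor
  · rintro ⟨y, hy⟩
    rw [← hy]
    exact ⟨y.2, h y⟩
  · rintro ⟨hx, hg⟩
    exact ⟨⟨x, hx⟩, congrArg (Tot.mk (G := ExtFam Z 𝒜 n) x) ((h ⟨x, hx⟩).trans hg.symm)⟩

/-- Restriction and extension by zero match classes over `U` with global classes having the same
germs on `U`, so both families of generating sets coincide. -/
lemma extTop_eq : extTop Z 𝒜 n = (𝒜.extGermData Z n).top := by
  refine congrArg TopologicalSpace.generateFrom (Set.ext fun O => ?_)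
  constructor
  · rintro ⟨U, s, rfl⟩
    exact ⟨U, extPost Z (𝒜.extendZero U) n s, 𝒜.range_eq_germs Z n U s _ fun x => by
      rw [extPost_extPost, extendZero_ev_of_mem]⟩
  · rintro ⟨U, a, rfl⟩
    exact ⟨U, extPost Z (𝒜.restrict U) n a, (𝒜.range_eq_germs Z n U _ a fun x => by
      rw [extPost_extPost, restrict_evOn]).symm⟩

lemma isEtaleTorsion_extTop : IsEtaleTorsion (ExtFam Z 𝒜 n) (extTop Z 𝒜 n) := by
  rw [extTop_eq]
  exact (𝒜.extGermData Z n).isEtaleTorsion fun x => isAddTorsion_extR Z (𝒜.fib x) n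

lemma exists_cprodEquiv : ∃ e : ExtR Z 𝒜.cprod n ≃+ (𝒜.isEtaleTorsion_extTop Z n).cprod,
    ∀ a x, (e a).1 x = extPost Z (𝒜.ev x) n a := by
  -- The group of sections depends on the topology, so the equality of topologies is substituted for
  -- a variable `τ`.
  have key : ∀ (τ : TopologicalSpace (Tot (ExtFam Z 𝒜 n))) (_ : τ = (𝒜.extGermData Z n).top)
      (h : IsEtaleTorsion (ExtFam Z 𝒜 n) τ),
      ∃ e : ExtR Z 𝒜.cprod n ≃+ h.cprod, ∀ a x, (e a).1 x = extPost Z (𝒜.ev x) n a := by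
    rintro _ rfl h
    exact ⟨(𝒜.extGermData Z n).cprodEquiv h, fun _ _ => rfl⟩
  exact key _ (𝒜.extTop_eq Z n) _

/-- The isomorphism `Ext_R^n(Z, ∏ 𝒜) ≃ ∏ Ext_R^n(Z, A_x)`. -/
noncomputable def extCprodEquiv :
    ExtR Z 𝒜.cprod n ≃+ (𝒜.isEtaleTorsion_extTop Z n).cprod :=
  (𝒜.exists_cprodEquiv Z n).choose

lemma extCprodEquiv_apply (a : ExtR Z 𝒜.cprod n) (x : X) :
    (𝒜.extCprodEquiv Z n a).1 x = extPost Z (𝒜.ev x) n a :=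
  (𝒜.exists_cprodEquiv Z n).choose_spec a x

variable {𝒜} {ℬ : EtaleMod R Y} {f : C(Y, X)} (φ : Hom f 𝒜 ℬ)

lemma Hom.extPost_ev_extPost_cprodMap (y : Y) (a : ExtR Z 𝒜.cprod n) :
    extPost Z (ℬ.ev y) n (extPost Z φ.cprodMap n a) =
      extPost Z (φ.app y) n (extPost Z (𝒜.ev (f y)) n a) := by
  rw [extPost_extPost, extPost_extPost]
  rfl

/-- Near a given point the total space consists of germs of one global class `a`, and these are sent
to germs of the image of `a` under `φ.cprodMap`. -/
lemma Hom.continuous_extPost : Continuous[pullTop f (ExtFam Z 𝒜 n) (extTop Z 𝒜 n), extTop Z ℬ n]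
    (fun t => (⟨t.base, extPost Z (φ.app t.base) n t.val⟩ : Tot (ExtFam Z ℬ n))) := by
  rw [extTop_eq, extTop_eq]
  let _ := (𝒜.extGermData Z n).top
  let _ := pullTop f (ExtFam Z 𝒜 n) (𝒜.extGermData Z n).top
  let _ := (ℬ.extGermData Z n).top
  refine continuous_iff_continuousAt.2 fun t => ?_
  obtain ⟨a, ha⟩ := (𝒜.extGermData Z n).ev_surjective (f t.base) t.val
  have h1 := continuous_pullTop_fst f (ExtFam Z 𝒜 n) (𝒜.extGermData Z n).top
  refine (ℬ.extGermData Z n).continuousAt_of_eventually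
    (continuous_pullTop_base f _ _).continuousAt (extPost Z φ.cprodMap n a) ?_
  filter_upwards [(𝒜.extGermData Z n).eventually_val_eq h1.continuousAt ha.symm] with s hs
  exact (congrArg (extPost Z (φ.app s.base) n) hs).trans
    (φ.extPost_ev_extPost_cprodMap Z n s.base a).symm

lemma Hom.extCprodEquiv_extPost (a : ExtR Z 𝒜.cprod n) (y : Y) :
    (ℬ.extCprodEquiv Z n (extPost Z φ.cprodMap n a)).1 y =
      extPost Z (φ.app y) n ((𝒜.extCprodEquiv Z n a).1 (f y)) := by
  rw [extCprodEquiv_apply, φ.extPost_ev_extPost_cprodMap Z n y a]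
  exact congrArg _ (𝒜.extCprodEquiv_apply Z n a (f y)).symm

end EtaleMod

end ExtEtaleSpace

/-! ### Transport of δ-functors along isomorphisms. -/

section Transport

universe w v₁ u₁

variable {C : Type u₁} [Category.{v₁} C]
    {exactSeq : ∀ {A B D : C}, (A ⟶ B) → (B ⟶ D) → Prop}
    {T T' : ℕ → C → Type w} [∀ n A, AddCommGroup (T n A)] [∀ n A, AddCommGroup (T' n A)]

lemma Function.Exact.of_conj {A B D A' B' D' : Type*} [AddCommGroup A] [AddCommGroup B]
    [AddCommGroup D] [AddCommGroup A'] [AddCommGroup B'] [AddCommGroup D'] {f : A →+ B}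
    {g : B →+ D} (h : Function.Exact f g) (a : A ≃+ A') (b : B ≃+ B') (d : D ≃+ D') :
    Function.Exact ((b.toAddMonoidHom.comp f).comp a.symm.toAddMonoidHom)
      ((d.toAddMonoidHom.comp g).comp b.symm.toAddMonoidHom) := by
  intro y
  obtain ⟨y, rfl⟩ := b.surjective y
  have h1 : ((d.toAddMonoidHom.comp g).comp b.symm.toAddMonoidHom) (b y) = d (g y) :=
    congrArg (fun z => d (g z)) (b.symm_apply_apply y)
  rw [h1, map_eq_zero_iff d d.injective, h y]
  constructor
  · rintro ⟨x, rfl⟩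
    exact ⟨a x, congrArg (fun z => b (f z)) (a.symm_apply_apply x)⟩
  · rintro ⟨x, hx⟩
    exact ⟨a.symm x, b.injective hx⟩

namespace CohomologicalDeltaFunctor

/-- Transport of a δ-functor along isomorphisms of groups. -/
def transport (L : CohomologicalDeltaFunctor C exactSeq T) (e : ∀ n A, T n A ≃+ T' n A) :
    CohomologicalDeltaFunctor C exactSeq T' where
  map n {A B} f := ((e n B).toAddMonoidHom.comp (L.map n f)).comp (e n A).symm.toAddMonoidHom
  map_id n A := by
    ext t
    rw [L.map_id]
    exact (e n A).apply_symm_apply t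
  map_comp n {A B D} f g := by
    ext t
    rw [L.map_comp]
    exact congrArg (fun z => e n D (L.map n g z)) ((e n B).symm_apply_apply _).symm
  δ n {A B D} f g h :=
    ((e (n + 1) A).toAddMonoidHom.comp (L.δ n f g h)).comp (e n D).symm.toAddMonoidHom
  δ_naturality n {A B D A' B' D'} f g h f' g' h' a b d hab hbd := by
    ext t
    have h1 := DFunLike.congr_fun (L.δ_naturality n f g h f' g' h' a b d hab hbd)
      ((e n D).symm t)
    exact (congrArg (fun z => e (n + 1) A' (L.map (n + 1) a z))
      ((e (n + 1) A).symm_apply_apply _)).trans ((congrArg (e (n + 1) A') h1).trans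
      (congrArg (fun z => e (n + 1) A' (L.δ n f' g' h' z)) ((e n D').symm_apply_apply _).symm))
  injective_zero {A B D} f g h :=
    (e 0 B).injective.comp ((L.injective_zero f g h).comp (e 0 A).symm.injective)
  exact_middle n {A B D} f g h := (L.exact_middle n f g h).of_conj (e n A) (e n B) (e n D)
  exact_right n {A B D} f g h := (L.exact_right n f g h).of_conj (e n B) (e n D) (e (n + 1) A)
  exact_left n {A B D} f g h :=
    (L.exact_left n f g h).of_conj (e n D) (e (n + 1) A) (e (n + 1) B)

lemma transport_map_apply (L : CohomologicalDeltaFunctor C exactSeq T)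
    (e : ∀ n A, T n A ≃+ T' n A) (n : ℕ) {A B : C} (f : A ⟶ B) (t : T n A) :
    (L.transport e).map n f (e n A t) = e n B (L.map n f t) :=
  congrArg (fun z => e n B (L.map n f z)) ((e n A).symm_apply_apply t)

lemma transport_δ_apply (L : CohomologicalDeltaFunctor C exactSeq T)
    (e : ∀ n A, T n A ≃+ T' n A) (n : ℕ) {A B D : C} (f : A ⟶ B) (g : B ⟶ D) (h : exactSeq f g)
    (t : T n D) : (L.transport e).δ n f g h (e n D t) = e (n + 1) A (L.δ n f g h t) :=
  congrArg (fun z => e (n + 1) A (L.δ n f g h z)) ((e n D).symm_apply_apply t)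

/-- A δ-functor is isomorphic to its transports. -/
def isoTransport (L : CohomologicalDeltaFunctor C exactSeq T) (e : ∀ n A, T n A ≃+ T' n A) :
    L.Iso (L.transport e) where
  equiv := e
  map_comm n _ _ f t := (L.transport_map_apply e n f t).symm
  δ_comm n _ _ _ f g h t := (L.transport_δ_apply e n f g h t).symm

end CohomologicalDeltaFunctor

end Transport

/-! ### The δ-functors of Ext in the étale space and in the profinite module. -/

section DeltaFunctors

variable {R : Type u} [Ring R] [TopologicalSpace R] [IsTopologicalRing R]
  {X : Profinite.{u}}

namespace EtaleMod

lemma cprodMap_id (𝒜 : EtaleMod R X) : Hom.cprodMap (𝟙 𝒜) = 𝟙 𝒜.cprod := rfl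

lemma cprodMap_comp {𝒜 ℬ 𝒞 : EtaleMod R X} (φ : 𝒜 ⟶ ℬ) (ψ : ℬ ⟶ 𝒞) :
    Hom.cprodMap (φ ≫ ψ) = Hom.cprodMap φ ≫ Hom.cprodMap ψ := rfl

/-- A map of short exact sequences of étale spaces gives a map of the sequences of global
sections. -/
def IsShortExact.cprodSeqMap {A B D A' B' D' : EtaleMod R X} {f : A ⟶ B} {g : B ⟶ D}
    (h : IsShortExact f g) {f' : A' ⟶ B'} {g' : B' ⟶ D'} (h' : IsShortExact f' g') (a : A ⟶ A')
    (b : B ⟶ B') (d : D ⟶ D') (hab : f ≫ b = a ≫ f') (hbd : g ≫ d = b ≫ g') :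
    h.cprodSeq ⟶ h'.cprodSeq where
  τ₁ := Hom.cprodMap a
  τ₂ := Hom.cprodMap b
  τ₃ := Hom.cprodMap d
  comm₁₂ := (congrArg Hom.cprodMap hab).symm
  comm₂₃ := (congrArg Hom.cprodMap hbd).symm

/-- Evaluation at a point as a map from the sequence of global sections to the sequence of
fibres. -/
def IsShortExact.evSeq {A B D : EtaleMod R X} {f : A ⟶ B} {g : B ⟶ D} (h : IsShortExact f g)
    (x : X) : h.cprodSeq ⟶ h.fibSeq x where
  τ₁ := A.ev x
  τ₂ := B.ev x
  τ₃ := D.ev x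
  comm₁₂ := rfl
  comm₂₃ := rfl

end EtaleMod

lemma EtaleMod.IsShortExact.extPost_cprodMap_zero_injective (Z : PMod R) {A B D : EtaleMod R X}
    {f : A ⟶ B} {g : B ⟶ D} (h : IsShortExact f g) :
    Function.Injective (extPost Z (EtaleMod.Hom.cprodMap f) 0) :=
  have hS : h.cprodSeq.ShortExact := h.cprodSeq_shortExact
  have := extPost_zero_injective Z hS
  this

/-- The δ-functor `Ext_R^n(Z, ∏ 𝒜)` in the étale space `𝒜`. -/
noncomputable def extCprodDelta (X : Profinite.{u}) (Z : PMod R) :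
    CohomologicalDeltaFunctor (EtaleMod R X) EtaleMod.IsShortExact
      (fun n 𝒜 => ExtR Z 𝒜.cprod n) where
  map n {_ _} φ := extPost Z (EtaleMod.Hom.cprodMap φ) n
  map_id n 𝒜 := by
    rw [EtaleMod.cprodMap_id, extPost_id]
  map_comp n {_ _ _} f g := by
    rw [EtaleMod.cprodMap_comp, extPost_comp]
  δ n {_ _ _} _ _ h := extDelta Z h.cprodSeq_shortExact n
  δ_naturality n {_ _ _ _ _ _} _ _ h _ _ h' a b d hab hbd :=
    AddMonoidHom.ext fun t => extPost_extDelta Z h.cprodSeq_shortExact h'.cprodSeq_shortExact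
      (h.cprodSeqMap h' a b d hab hbd) n t
  injective_zero {_ _ _} _ _ h := h.extPost_cprodMap_zero_injective Z
  exact_middle n {_ _ _} _ _ h := extPost_exact Z h.cprodSeq_shortExact n
  exact_right n {_ _ _} _ _ h := extPost_extDelta_exact Z h.cprodSeq_shortExact n
  exact_left n {_ _ _} _ _ h := extDelta_extPost_exact Z h.cprodSeq_shortExact n

/-- The contravariant δ-functor `Ext_R^n(Z, A)` in the profinite module `Z`. -/
noncomputable def extPreDelta [CompactSpace R] (A : DMod R) :
    CohomologicalDeltaFunctor (PMod R)ᵒᵖ (fun f g => PMod.IsShortExact g.unop f.unop)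
      (fun n Z => ExtR Z.unop A n) where
  map n _ _ f := extPre f.unop A n
  map_id n Z := extPre_id Z.unop A n
  map_comp n _ _ _ f g := extPre_comp g.unop f.unop A n
  δ n _ _ _ _ _ h := extDeltaPre h A n
  -- Short exact sequences are reversed in the opposite category, so the two commuting squares
  -- exchange their roles.
  δ_naturality n _ _ _ _ _ _ _ _ h _ _ h' a b d hab hbd :=
    AddMonoidHom.ext fun t => extPre_extDeltaPre h h' a.unop b.unop d.unop
      (congrArg Quiver.Hom.unop hbd).symm (congrArg Quiver.Hom.unop hab).symm A n t
  injective_zero _ _ h := extPre_zero_injective h A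
  exact_middle n _ _ _ _ _ h := extPre_exact h A n
  exact_right n _ _ _ _ _ h := extPre_extDeltaPre_exact h A n
  exact_left n _ _ _ _ _ h := extDeltaPre_extPre_exact h A n

end DeltaFunctors

/-! ### The main theorem. -/

theorem mainTheorem7 {R : Type u} [Ring R] [TopologicalSpace R] [IsTopologicalRing R]
    [CompactSpace R] [T2Space R] [TotallyDisconnectedSpace R] :
    ∃ hE : ∀ (X : Profinite.{u}) (Z : PMod R) (𝒜 : EtaleMod R X) (n : ℕ),
        IsEtaleTorsion (ExtFam Z 𝒜 n) (extTop Z 𝒜 n),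
    ∃ Φ : ∀ (X : Profinite.{u}) (Z : PMod R) (𝒜 : EtaleMod R X) (n : ℕ),
        ExtR Z 𝒜.cprod n ≃+ (hE X Z 𝒜 n).cprod,
      (∀ (X : Profinite.{u}) (Z : PMod R) (𝒜 : EtaleMod R X) (n : ℕ)
        (a : ExtR Z 𝒜.cprod n) (x : X), (Φ X Z 𝒜 n a).1 x = extPost Z (𝒜.ev x) n a) ∧
      (∀ (X Y : Profinite.{u}) (f : C(Y, X)) (Z : PMod R) (𝒜 : EtaleMod R X) (ℬ : EtaleMod R Y)
        (φ : EtaleMod.Hom f 𝒜 ℬ) (n : ℕ),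
        Continuous[pullTop f (ExtFam Z 𝒜 n) (extTop Z 𝒜 n), extTop Z ℬ n]
          (fun t => ⟨t.base, extPost Z (φ.app t.base) n t.val⟩) ∧
        ∀ (a : ExtR Z 𝒜.cprod n) (y : Y),
          (Φ Y Z ℬ n (extPost Z φ.cprodMap n a)).1 y =
            extPost Z (φ.app y) n ((Φ X Z 𝒜 n a).1 (f y))) ∧
      (∀ (X : Profinite.{u}) (Z : PMod R),
        ∃ (L : CohomologicalDeltaFunctor (EtaleMod R X) EtaleMod.IsShortExact
              (fun n 𝒜 => ExtR Z 𝒜.cprod n))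
          (P : CohomologicalDeltaFunctor (EtaleMod R X) EtaleMod.IsShortExact
              (fun n 𝒜 => (hE X Z 𝒜 n).cprod))
          (e : L.Iso P),
          (∀ n (𝒜 ℬ : EtaleMod R X) (φ : 𝒜 ⟶ ℬ),
            L.map n φ = extPost Z (EtaleMod.Hom.cprodMap φ) n) ∧
          (∀ n (𝒜' 𝒜 𝒜'' : EtaleMod R X) (φ : 𝒜' ⟶ 𝒜) (ψ : 𝒜 ⟶ 𝒜'')
            (h : EtaleMod.IsShortExact φ ψ),
            L.δ n φ ψ h = extDelta Z h.cprodSeq_shortExact n) ∧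
          (∀ n (𝒜 ℬ : EtaleMod R X) (φ : 𝒜 ⟶ ℬ) (s : (hE X Z 𝒜 n).cprod) (x : X),
            (P.map n φ s).1 x = extPost Z (EtaleMod.Hom.app φ x) n (s.1 x)) ∧
          (∀ n (𝒜' 𝒜 𝒜'' : EtaleMod R X) (φ : 𝒜' ⟶ 𝒜) (ψ : 𝒜 ⟶ 𝒜'')
            (h : EtaleMod.IsShortExact φ ψ) (s : (hE X Z 𝒜'' n).cprod) (x : X),
            (P.δ n φ ψ h s).1 x = extDelta Z (h.fibSeq_shortExact x) n (s.1 x)) ∧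
          ∀ n 𝒜, e.equiv n 𝒜 = Φ X Z 𝒜 n) ∧
      (∀ (X : Profinite.{u}) (𝒜 : EtaleMod R X),
        ∃ (L : CohomologicalDeltaFunctor (PMod R)ᵒᵖ (fun f g => PMod.IsShortExact g.unop f.unop)
              (fun n Z => ExtR Z.unop 𝒜.cprod n))
          (P : CohomologicalDeltaFunctor (PMod R)ᵒᵖ (fun f g => PMod.IsShortExact g.unop f.unop)
              (fun n Z => (hE X Z.unop 𝒜 n).cprod))
          (e : L.Iso P),
          (∀ n (Z Z' : PMod R) (ζ : Z' ⟶ Z), L.map n ζ.op = extPre ζ 𝒜.cprod n) ∧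
          (∀ n (Z' Z Z'' : PMod R) (i : Z' ⟶ Z) (q : Z ⟶ Z'') (h : PMod.IsShortExact i q),
            L.δ n q.op i.op h = extDeltaPre h 𝒜.cprod n) ∧
          (∀ n (Z Z' : PMod R) (ζ : Z' ⟶ Z) (s : (hE X Z 𝒜 n).cprod) (x : X),
            (P.map n ζ.op s).1 x = extPre ζ (𝒜.fib x) n (s.1 x)) ∧
          (∀ n (Z' Z Z'' : PMod R) (i : Z' ⟶ Z) (q : Z ⟶ Z'') (h : PMod.IsShortExact i q)
            (s : (hE X Z' 𝒜 n).cprod) (x : X),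
            (P.δ n q.op i.op h s).1 x = extDeltaPre h (𝒜.fib x) n (s.1 x)) ∧
          ∀ n Z, e.equiv n Z = Φ X Z.unop 𝒜 n) := by
  refine ⟨fun X Z 𝒜 n => 𝒜.isEtaleTorsion_extTop Z n, fun X Z 𝒜 n => 𝒜.extCprodEquiv Z n,
    fun X Z 𝒜 n => 𝒜.extCprodEquiv_apply Z n,
    fun X Y f Z 𝒜 ℬ φ n => ⟨φ.continuous_extPost Z n, φ.extCprodEquiv_extPost Z n⟩,
    fun X Z => ?_, fun X 𝒜 => ?_⟩
  -- The δ-functor of sections is the transport of the one of Ext groups; what remains is that its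
  -- maps are computed fibrewise. Every section comes from a global class `a`, so this can be
  -- checked on `a`.
  · refine ⟨extCprodDelta X Z, (extCprodDelta X Z).transport fun n 𝒜 => 𝒜.extCprodEquiv Z n,
      (extCprodDelta X Z).isoTransport _, fun _ _ _ _ => rfl, fun _ _ _ _ _ _ _ => rfl, ?_, ?_,
      fun _ _ => rfl⟩
    · intro n 𝒜 ℬ φ s x
      obtain ⟨a, rfl⟩ := (𝒜.extCprodEquiv Z n).surjective s
      exact (congrArg (fun k => k.1 x) ((extCprodDelta X Z).transport_map_apply
        (fun n 𝒜 => 𝒜.extCprodEquiv Z n) n φ a)).trans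
        (EtaleMod.Hom.extCprodEquiv_extPost Z n φ a x)
    · intro n 𝒜' 𝒜 𝒜'' φ ψ h s x
      obtain ⟨a, rfl⟩ := (𝒜''.extCprodEquiv Z n).surjective s
      refine (congrArg (fun k => k.1 x) ((extCprodDelta X Z).transport_δ_apply
        (fun n 𝒜 => 𝒜.extCprodEquiv Z n) n φ ψ h a)).trans ?_
      refine (𝒜'.extCprodEquiv_apply Z (n + 1) _ x).trans ?_
      rw [𝒜''.extCprodEquiv_apply Z n a x]
      -- Evaluation at `x` is a morphism from the sequence of global sections to that of fibres, and
      -- the connecting homomorphism is natural.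
      exact extPost_extDelta Z h.cprodSeq_shortExact (h.fibSeq_shortExact x) (h.evSeq x) n a
  · refine ⟨extPreDelta 𝒜.cprod, (extPreDelta 𝒜.cprod).transport fun n Z =>
      𝒜.extCprodEquiv Z.unop n, (extPreDelta 𝒜.cprod).isoTransport _, fun _ _ _ _ => rfl,
      fun _ _ _ _ _ _ _ => rfl, ?_, ?_, fun _ _ => rfl⟩
    · intro n Z Z' ζ s x
      obtain ⟨a, rfl⟩ := (𝒜.extCprodEquiv Z n).surjective s
      refine (congrArg (fun k => k.1 x) ((extPreDelta 𝒜.cprod).transport_map_apply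
        (fun n Z => 𝒜.extCprodEquiv Z.unop n) n ζ.op a)).trans ?_
      refine (𝒜.extCprodEquiv_apply Z' n _ x).trans ?_
      rw [𝒜.extCprodEquiv_apply Z n a x]
      exact extPost_extPre ζ (𝒜.ev x) n a
    · intro n Z' Z Z'' i q h s x
      obtain ⟨a, rfl⟩ := (𝒜.extCprodEquiv Z' n).surjective s
      refine (congrArg (fun k => k.1 x) ((extPreDelta 𝒜.cprod).transport_δ_apply
        (fun n Z => 𝒜.extCprodEquiv Z.unop n) n q.op i.op h a)).trans ?_
      refine (𝒜.extCprodEquiv_apply Z'' (n + 1) _ x).trans ?_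
      rw [𝒜.extCprodEquiv_apply Z' n a x]
      -- Here the sequence in `Z` is fixed and evaluation at `x` changes the coefficients.
      exact extPost_extDeltaPre h (𝒜.ev x) n a
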